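/- Let $b_1$ and $c$ be càdlàg functions on $[0,\infty)$ with locally bounded variation and $b_1(0)=c(0)=0$, and let $m$ be a $\sigma$-finite measure on $(0,\infty)^2$ with $$\int_{(0,t]}\int_{(0,\infty)} (1\wedge z^2)\, m(ds,dz)<\infty,\qquad t\ge 0 .$$ The parameters $(b_1,c,m)$ are called admissible if $c$ is increasing and continuous, $$\Delta b_1(t)+\int_{(0,1]} z\, m(\{t\},dz)\le 1,\qquad t>0,$$ where $\Delta b_1(t)=b_1(t)-b_1(t-)$, and there is no $s>0$ with $\Delta b_1(s)=1$ and $m(\{s\}\times(0,\infty))=0$. Put $K_1(\lambda,z)=e^{-\lambda z}-1+\lambda z1_{\{z\le 1\}}$. **Theorem 1.1.** Let $(b_1,c,m)$ be admissible. Then for all $t\ge 0$ and $\lambda>0$ there is a unique bounded and strictly positive (Borel) solution $[0,t]\ni r\mapsto v_{r,t}(\lambda)$ of $$v_{r,t}(\lambda)=\lambda-\int_{(r,t]} v_{s,t}(\lambda)\,b_1(ds)-\int_{(r,t]} v_{s,t}(\lambda)^2\,c(ds)-\int_{(r,t]}\int_{(0,\infty)}K_1(v_{s,t}(\lambda),z)\,m(ds,dz),\qquad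 0\le r\le t .$$ The maps $\lambda\mapsto v_{r,t}(\lambda)$, $0\le r\le t$, are continuous on $(0,\infty)$ and form a cumulant semigroup: $v_{r,t}(\lambda)=v_{r,s}(v_{s,t}(\lambda))$ for $0\le r\le s\le t$ and $\lambda>0$, and for all $0\le r\le t$ there are $a_{r,t},h_{r,t}\ge 0$ and a measure $l_{r,t}$ on $(0,\infty)$ with $\int_{(0,\infty)}(1\wedge y)\,l_{r,t}(dy)<\infty$ such that $$v_{r,t}(\lambda)=a_{r,t}+h_{r,t}\lambda+\int_{(0,\infty)}(1-e^{-\lambda y})\,l_{r,t}(dy),\qquad \lambda>0 .$$ Moreover, for all $0\le r\le t$ and $x\in[0,\infty]$ there is exactly one probability measure $Q_{r,t}(x,\cdot)$ on $[0,\infty]$ with $$\int_{[0,\infty]}e^{-\lambda y}\,Q_{r,t}(x,dy)=e^{-x v_{r,t}(\lambda)},\qquad \lambda>0,$$ where $e^{-\lambda y}=0$ for $y=\infty$ and $e^{-xv_{r,t}(\lambda)}=0$ for $x=\infty$; and $(Q_{r,t})_{t\ge r\ge 0}$ is a transition semigroup on $[0,\infty]$, that is, a family of Markov kernels with $Q_{t,t}(x,\cdot)=\delta_x$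 and $Q_{r,t}(x,\cdot)=\int_{[0,\infty]} Q_{r,s}(x,dy)\,Q_{s,t}(y,\cdot)$ for $0\le r\le s\le t$. -/

import Mathlib

open MeasureTheory ProbabilityTheory Filter Topology Set
open scoped NNReal ENNReal

/-- A càdlàg function `g` on `[0, ∞)` with locally bounded variation and `g 0 = 0`. -/
structure CadlagBV where
  toFun : ℝ≥0 → ℝ
  zero : toFun 0 = 0
  right_continuous : ∀ t, ContinuousWithinAt toFun (Ici t) t
  left_limits : ∀ t, 0 < t → ∃ l, Tendsto toFun (𝓝[<] t) (𝓝 l)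
  locallyBoundedVariation : LocallyBoundedVariationOn toFun univ

namespace CadlagBV

/-- The jump `Δg(t) = g(t) - g(t-)` (used for `t > 0` only). -/
noncomputable def jump (g : CadlagBV) (t : ℝ≥0) : ℝ :=
  g.toFun t - Function.leftLim g.toFun t

/-- The total variation of `g` on `[0, t]`, as a function of `t`. -/
noncomputable def variation (g : CadlagBV) (t : ℝ≥0) : ℝ :=
  variationOnFromTo g.toFun univ 0 t

theorem variation_mono (g : CadlagBV) : Monotone g.variation :=
  monotoneOn_univ.1 (variationOnFromTo.monotoneOn g.locallyBoundedVariation (mem_univ 0))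

theorem variation_sub_mono (g : CadlagBV) : Monotone (fun t => g.variation t - g.toFun t) :=
  monotoneOn_univ.1 (variationOnFromTo.sub_self_monotoneOn g.locallyBoundedVariation (mem_univ 0))

/-- The Lebesgue–Stieltjes measure of the increasing function `t ↦ ‖g‖(t)`. -/
noncomputable def upperMeasure (g : CadlagBV) : Measure ℝ≥0 :=
  g.variation_mono.stieltjesFunction.measure

/-- The Lebesgue–Stieltjes measure of the increasing function `t ↦ ‖g‖(t) - g(t)`. -/
noncomputable def lowerMeasure (g : CadlagBV) : Measure ℝ≥0 :=
  g.variation_sub_mono.stieltjesFunction.measure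

/-- The Lebesgue–Stieltjes integral `∫_r^t f(s) g(ds)` over the interval `(r, t]`; the signed
measure `g(ds)` is the difference of the measures of `‖g‖` and `‖g‖ - g`. -/
noncomputable def integral (g : CadlagBV) (f : ℝ≥0 → ℝ) (r t : ℝ≥0) : ℝ :=
  (∫ s in Ioc r t, f s ∂g.upperMeasure) - ∫ s in Ioc r t, f s ∂g.lowerMeasure

/-- Normalization: the signed measure `g(ds)` has mass `g(t) - g(r)` on `(r, t]`. -/
theorem integral_one (g : CadlagBV) {r t : ℝ≥0} (h : r ≤ t) :
    g.integral (fun _ => 1) r t = g.toFun t - g.toFun r := by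
  have hne (x : ℝ≥0) : (𝓝[>] x).NeBot := nhdsGT_neBot x
  have key (x : ℝ≥0) : Function.rightLim g.variation x -
      Function.rightLim (fun t => g.variation t - g.toFun t) x = g.toFun x := by
    have h1 := g.variation_mono.tendsto_rightLim x
    have h2 := g.variation_sub_mono.tendsto_rightLim x
    have h3 : Tendsto g.toFun (𝓝[>] x) (𝓝 (g.toFun x)) :=
      (g.right_continuous x).mono_left (nhdsWithin_mono _ Ioi_subset_Ici_self)
    have h4 := h1.sub h2
    simp only [sub_sub_cancel] at h4
    exact tendsto_nhds_unique h4 h3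
  have m1 := g.variation_mono.rightLim h
  have m2 := g.variation_sub_mono.rightLim h
  have k1 := key t
  have k2 := key r
  simp only [integral, upperMeasure, lowerMeasure, integral_const, smul_eq_mul, mul_one,
    measureReal_def, Measure.restrict_apply_univ, StieltjesFunction.measure_Ioc,
    Monotone.stieltjesFunction_eq]
  rw [ENNReal.toReal_ofReal (sub_nonneg.2 m1), ENNReal.toReal_ofReal (sub_nonneg.2 m2)]
  linarith

end CadlagBV

/-- The parameters `(b₁, c, m)`: `b₁` and `c` are càdlàg functions on `[0, ∞)` with locally
bounded variation vanishing at `0`, and `m(ds, dz)` is a σ-finite measure on `(0, ∞)²` with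
`∫_0^t ∫_0^∞ (1 ∧ z²) m(ds, dz) < ∞` for all `t ≥ 0`. -/
structure BranchingParameters where
  b₁ : CadlagBV
  c : CadlagBV
  m : Measure (ℝ≥0 × ℝ)
  m_sigmaFinite : SigmaFinite m
  m_support : m (Ioi 0 ×ˢ Ioi 0)ᶜ = 0
  m_integrable : ∀ t : ℝ≥0,
    ∫⁻ p in Ioc 0 t ×ˢ Ioi 0, ENNReal.ofReal (min 1 (p.2 ^ 2)) ∂m < ∞

namespace BranchingParameters

/-- Weak admissibility: `c` is increasing and continuous, and
`Δb₁(t) + ∫_{(0,1]} z m({t}, dz) ≤ 1` for every `t > 0`. The integral may a priori be infinite,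
so the inequality is stated in the extended reals. -/
structure WeaklyAdmissible (p : BranchingParameters) : Prop where
  c_monotone : Monotone p.c.toFun
  c_continuous : Continuous p.c.toFun
  jump_le : ∀ t : ℝ≥0, 0 < t →
    (p.b₁.jump t : EReal) +
      ((∫⁻ q in {t} ×ˢ Ioc 0 1, ENNReal.ofReal q.2 ∂p.m : ℝ≥0∞) : EReal) ≤ 1

/-- The set of bottlenecks: times `s > 0` with `Δb₁(s) = 1` and `m({s} × (0, ∞)) = 0`. -/
def bottlenecks (p : BranchingParameters) : Set ℝ≥0 :=
  {s | 0 < s ∧ p.b₁.jump s = 1 ∧ p.m ({s} ×ˢ Ioi 0) = 0}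

/-- Admissibility: weakly admissible, and without bottlenecks. -/
structure Admissible (p : BranchingParameters) : Prop where
  weaklyAdmissible : p.WeaklyAdmissible
  no_bottlenecks : p.bottlenecks = ∅

/-- `K₁(lam, z) = e^{-lam z} - 1 + lam z 1_{z ≤ 1}`. -/
noncomputable def K₁ (lam z : ℝ) : ℝ :=
  Real.exp (-lam * z) - 1 + if z ≤ 1 then lam * z else 0

/-- `u` is a bounded and strictly positive (Borel) solution on `[0, t]` to
`u(r) = lam - ∫_r^t u(s) b₁(ds) - ∫_r^t u(s)² c(ds) - ∫_r^t ∫_0^∞ K₁(u(s), z) m(ds, dz)`.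
Only the values of `u` on `[0, t]` matter. -/
structure IsSolution (p : BranchingParameters) (t : ℝ≥0) (lam : ℝ) (u : ℝ≥0 → ℝ) : Prop where
  measurable : Measurable ((Iic t).domRestrict u)
  bounded : ∃ C : ℝ, ∀ r ≤ t, u r ≤ C
  pos : ∀ r ≤ t, 0 < u r
  integrable : IntegrableOn (fun q : ℝ≥0 × ℝ => K₁ (u q.1) q.2) (Ioc 0 t ×ˢ Ioi 0) p.m
  equation : ∀ r ≤ t,
    u r = lam - p.b₁.integral u r t - p.c.integral (fun s => u s ^ 2) r t
      - ∫ q in Ioc r t ×ˢ Ioi 0, K₁ (u q.1) q.2 ∂p.m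

end BranchingParameters

/-- `(v_{r,t})_{t ≥ r ≥ 0}`, written `v r t`, is a cumulant semigroup: a family of maps of
`(0, ∞)` into itself with the semigroup property and the Lévy–Khintchine representation
`v_{r,t}(lam) = a + h lam + ∫_{(0,∞)} (1 - e^{-lam y}) l(dy)`. -/
structure IsCumulantSemigroup (v : ℝ≥0 → ℝ≥0 → ℝ → ℝ) : Prop where
  pos : ∀ r t, r ≤ t → ∀ lam, 0 < lam → 0 < v r t lam
  semigroup : ∀ r s t, r ≤ s → s ≤ t → ∀ lam, 0 < lam → v r t lam = v r s (v s t lam)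
  levyKhintchine : ∀ r t, r ≤ t → ∃ (a h : ℝ) (l : Measure ℝ), 0 ≤ a ∧ 0 ≤ h ∧
    ∫⁻ y in Ioi 0, ENNReal.ofReal (min 1 y) ∂l < ∞ ∧
    ∀ lam, 0 < lam → v r t lam = a + h * lam + ∫ y in Ioi 0, (1 - Real.exp (-lam * y)) ∂l

/-- `e^{-lam y}` for `y ∈ [0, ∞]` and `lam > 0`, with value `0` at `y = ∞`. -/
noncomputable def expNeg (lam : ℝ) (y : ℝ≥0∞) : ℝ :=
  if y = ∞ then 0 else Real.exp (-lam * y.toReal)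

/-- `(Q_{r,t})_{t ≥ r ≥ 0}`, written `Q r t`, is a transition semigroup on `[0, ∞]`: Markov
kernels with `Q_{t,t} = id` satisfying the Chapman–Kolmogorov equations. -/
structure IsTransitionSemigroup (Q : ℝ≥0 → ℝ≥0 → Kernel ℝ≥0∞ ℝ≥0∞) : Prop where
  markov : ∀ r t, r ≤ t → IsMarkovKernel (Q r t)
  refl : ∀ t, Q t t = Kernel.id
  chapmanKolmogorov : ∀ r s t, r ≤ s → s ≤ t → Q r t = Q s t ∘ₖ Q r s

/-!
The equation is read as a backward equation driven by a single locally finite measure on marks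
`(s, z)`: a mark with `z > 0` is a jump of size `z` at time `s`, weighted by `1 ∧ z²`, and three
values `z ≤ 0` are set aside for `c` and for the two increasing parts of `b₁`. In this form it says
`u(r) = lam + ∫ γ(u(s), ω) N(dω)` over the marks `ω` with time `s ∈ (r, t]`, where `γ` is
`branchingField`; see `BranchingParameters.drivingMeasure` and
`BranchingParameters.setIntegral_branchingField`.

**Bernstein functions.** A nonnegative function `w` of `lam` is called Bernstein if every `e^{-y w}`,
`y ≥ 0`, is the Laplace transform of a probability measure on `[0, ∞]`. Since `[0, ∞]` is compact,
this property passes to pointwise limits without any tightness condition, and it is preserved by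
sums, by composition and by `w ↦ ∫ (1 - e^{-w z}) ρ(dz)`. The Lévy–Khintchine representation of a
Bernstein function is a weak limit of the measures representing `n (1 - e^{-w/n})`
(`IsBernstein.levyKhintchine`).

**Existence.** Small jumps are cut off at `2^{-n}`, large ones at `k`, and the diffusion part is
replaced by small jumps. The resulting fields are Lipschitz with finite activity, so Picard
iteration with respect to a weighted norm solves the equation; the weight is a step function that
copes with atoms of arbitrary size. The solution is also a limit of Euler schemes. One Euler step has
the form `x ↦ (1 - β) x + ∫ (1 - e^{-x z}) ρ(dz)`, and the jump condition
`Δb₁ + ∫_{(0,1]} z m({t}, dz) ≤ 1` is exactly what keeps `β ≤ 1` at the atoms, while `β` is small away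
from them. Each step is therefore an increasing Bernstein function, and hence the solutions are
Bernstein in `lam` and monotone in the field
(`IsJumpData.isBernstein_of_solvesBackward`, `IsJumpData.solution_mono`). The approximate solutions
decrease in `n` and increase in `k`, and the limit solves the original equation
(`BranchingParameters.exists_solution`).

**Uniqueness.** `branchingField` is not Lipschitz at the state `0`, because of the large jumps.
Without bottlenecks, however, every exact jump keeps a positive state positive, and a backward
induction shows that solutions are bounded away from `0`
(`BranchingParameters.exists_pos_le_of_solvesBackward`). There the field is Lipschitz, and Grönwall's
inequality applies (`BranchingParameters.eq_of_solvesBackward`).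

**Semigroups.** Uniqueness gives `v_{r,t} = v_{r,s} ∘ v_{s,t}`. The kernels `Q_{r,t}(x, ·)` are the
measures with Laplace transforms `e^{-x v_{r,t}}`. By Stone–Weierstrass, Laplace transforms determine
measures on `[0, ∞]`, which yields the uniqueness of `Q_{r,t}(x, ·)`, its measurability in `x` and
the Chapman–Kolmogorov equations.
-/

/-! ### Laplace transforms of probability measures on `[0, ∞]` -/

@[simp] theorem expNeg_top (lam : ℝ) : expNeg lam ∞ = 0 := by simp [expNeg]

theorem expNeg_of_ne_top (lam : ℝ) {y : ℝ≥0∞} (hy : y ≠ ∞) :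
    expNeg lam y = Real.exp (-lam * y.toReal) := by simp [expNeg, hy]

theorem expNeg_ofReal (lam : ℝ) {y : ℝ} (hy : 0 ≤ y) :
    expNeg lam (ENNReal.ofReal y) = Real.exp (-lam * y) := by
  rw [expNeg_of_ne_top lam ENNReal.ofReal_ne_top, ENNReal.toReal_ofReal hy]

theorem expNeg_nonneg (lam : ℝ) (y : ℝ≥0∞) : 0 ≤ expNeg lam y := by
  unfold expNeg; split_ifs <;> positivity

theorem expNeg_le_one {lam : ℝ} (hlam : 0 ≤ lam) (y : ℝ≥0∞) : expNeg lam y ≤ 1 := by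
  unfold expNeg
  split_ifs
  · exact zero_le_one
  · rw [Real.exp_le_one_iff]
    have : 0 ≤ lam * y.toReal := by positivity
    linarith

theorem abs_expNeg_le_one {lam : ℝ} (hlam : 0 ≤ lam) (y : ℝ≥0∞) : |expNeg lam y| ≤ 1 := by
  rw [abs_of_nonneg (expNeg_nonneg _ _)]; exact expNeg_le_one hlam y

theorem expNeg_add (lam : ℝ) (x y : ℝ≥0∞) : expNeg lam (x + y) = expNeg lam x * expNeg lam y := by
  by_cases hx : x = ∞
  · simp [hx]
  by_cases hy : y = ∞
  · simp [hy]
  rw [expNeg_of_ne_top _ hx, expNeg_of_ne_top _ hy, expNeg_of_ne_top _ (ENNReal.add_ne_top.2 ⟨hx, hy⟩),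
    ENNReal.toReal_add hx hy, ← Real.exp_add]
  ring_nf

theorem expNeg_add_left (a b : ℝ) (x : ℝ≥0∞) : expNeg (a + b) x = expNeg a x * expNeg b x := by
  by_cases hx : x = ∞
  · simp [hx]
  rw [expNeg_of_ne_top _ hx, expNeg_of_ne_top _ hx, expNeg_of_ne_top _ hx, ← Real.exp_add]
  ring_nf

theorem continuous_expNeg {lam : ℝ} (hlam : 0 < lam) : Continuous (expNeg lam) := by
  rw [continuous_iff_continuousAt]
  intro x
  by_cases hx : x = ∞
  · subst hx
    rw [ContinuousAt, expNeg_top, Metric.tendsto_nhds]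
    intro ε hε
    have h1 : Tendsto (fun y : ℝ => Real.exp (-lam * y)) atTop (𝓝 0) :=
      Real.tendsto_exp_atBot.comp (tendsto_id.const_mul_atTop_of_neg (neg_neg_of_pos hlam))
    obtain ⟨K, hK⟩ := ((Metric.tendsto_nhds.1 h1 ε hε).and (eventually_ge_atTop 0)).exists
    have hev : ∀ᶠ y : ℝ≥0∞ in 𝓝 ∞, ENNReal.ofReal K < y :=
      lt_mem_nhds ENNReal.ofReal_lt_top
    filter_upwards [hev] with y hy
    simp only [Real.dist_eq, sub_zero] at hK ⊢
    refine lt_of_le_of_lt ?_ hK.1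
    rw [abs_of_nonneg (expNeg_nonneg _ _), abs_of_pos (Real.exp_pos _)]
    by_cases hyt : y = ∞
    · rw [hyt, expNeg_top]; positivity
    rw [expNeg_of_ne_top _ hyt, Real.exp_le_exp]
    have : K ≤ y.toReal := (ENNReal.ofReal_le_iff_le_toReal hyt).1 hy.le
    nlinarith
  · have hev : ∀ᶠ y : ℝ≥0∞ in 𝓝 x, expNeg lam y = Real.exp (-lam * y.toReal) := by
      filter_upwards [isOpen_ne.mem_nhds hx] with y hy using expNeg_of_ne_top lam hy
    refine ContinuousAt.congr ?_ (hev.mono fun _ h => h.symm)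
    have := ENNReal.continuousAt_toReal hx
    fun_prop

/-- The function `y ↦ e^{-lam y}` as an element of `C([0, ∞], ℝ)`. -/
noncomputable def expNegC (lam : ℝ) (hlam : 0 < lam) : C(ℝ≥0∞, ℝ) :=
  ⟨expNeg lam, continuous_expNeg hlam⟩

theorem measurable_expNeg {lam : ℝ} (hlam : 0 < lam) : Measurable (expNeg lam) :=
  (continuous_expNeg hlam).measurable

theorem integrable_expNeg {lam : ℝ} (hlam : 0 < lam) (μ : Measure ℝ≥0∞) [IsFiniteMeasure μ] :
    Integrable (expNeg lam) μ :=
  Integrable.of_bound (measurable_expNeg hlam).aestronglyMeasurable 1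
    (Eventually.of_forall fun y => abs_expNeg_le_one hlam.le y)

theorem integrable_continuousMap (f : C(ℝ≥0∞, ℝ)) (μ : Measure ℝ≥0∞) [IsFiniteMeasure μ] :
    Integrable f μ :=
  Integrable.of_bound f.continuous.aestronglyMeasurable ‖f‖
    (Eventually.of_forall fun y => f.norm_coe_le_norm y)

theorem tendsto_integral_continuousMap {f : ℕ → C(ℝ≥0∞, ℝ)} {g : C(ℝ≥0∞, ℝ)}
    (h : Tendsto f atTop (𝓝 g)) (μ : Measure ℝ≥0∞) [IsFiniteMeasure μ] :
    Tendsto (fun n => ∫ y, f n y ∂μ) atTop (𝓝 (∫ y, g y ∂μ)) := by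
  obtain ⟨C, hC⟩ := h.norm.bddAbove_range
  refine tendsto_integral_of_dominated_convergence (fun _ => C)
    (fun n => (f n).continuous.aestronglyMeasurable) (integrable_const _) (fun n => ?_) ?_
  · exact Eventually.of_forall fun y => ((f n).norm_coe_le_norm y).trans (hC ⟨n, rfl⟩)
  · exact Eventually.of_forall fun y =>
      ((continuous_eval_const y).tendsto g).comp h

/-- Stone–Weierstrass on the compact space `[0, ∞]`: a property of continuous functions that is
stable under linear combinations and uniform limits holds for all of them as soon as it holds for
the constant `1` and for the exponentials `y ↦ e^{-lam y}`. -/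
theorem continuousMap_induction {P : C(ℝ≥0∞, ℝ) → Prop} (one : P 1)
    (exp : ∀ lam (h : 0 < lam), P (expNegC lam h)) (add : ∀ f g, P f → P g → P (f + g))
    (smul : ∀ (a : ℝ) f, P f → P (a • f))
    (lim : ∀ (f : ℕ → C(ℝ≥0∞, ℝ)) g, (∀ n, P (f n)) → Tendsto f atTop (𝓝 g) → P g)
    (f : C(ℝ≥0∞, ℝ)) : P f := by
  let S : Submonoid C(ℝ≥0∞, ℝ) :=
    { carrier := {f | f = 1 ∨ ∃ lam h, f = expNegC lam h}
      one_mem' := Or.inl rfl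
      mul_mem' := by
        rintro f g (rfl | ⟨a, ha, rfl⟩) (rfl | ⟨b, hb, rfl⟩)
        · simp
        · exact Or.inr ⟨b, hb, by simp⟩
        · exact Or.inr ⟨a, ha, by simp⟩
        · refine Or.inr ⟨a + b, add_pos ha hb, ?_⟩
          ext y
          exact (expNeg_add_left a b y).symm }
  let A : Subalgebra ℝ C(ℝ≥0∞, ℝ) := Algebra.adjoin ℝ (S : Set C(ℝ≥0∞, ℝ))
  have hspan : ∀ g ∈ Submodule.span ℝ (S : Set C(ℝ≥0∞, ℝ)), P g := by
    intro g hg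
    induction hg using Submodule.span_induction with
    | mem x hx =>
      rcases hx with rfl | ⟨a, ha, rfl⟩
      · exact one
      · exact exp a ha
    | zero => simpa using smul 0 1 one
    | add x y _ _ hx hy => exact add x y hx hy
    | smul a x _ hx => exact smul a x hx
  have hA : ∀ g ∈ A, P g := by
    intro g hg
    have h1 : g ∈ Subalgebra.toSubmodule A := hg
    rw [Algebra.adjoin_eq_span, Submonoid.closure_eq] at h1
    exact hspan g h1
  have hsep : A.SeparatesPoints := by
    intro x y hxy
    refine ⟨expNeg 1, ⟨expNegC 1 one_pos, Algebra.subset_adjoin (Or.inr ⟨1, one_pos, rfl⟩), rfl⟩, ?_⟩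
    intro h
    apply hxy
    by_cases hx : x = ∞ <;> by_cases hy : y = ∞
    · rw [hx, hy]
    · rw [hx, expNeg_top, expNeg_of_ne_top _ hy] at h
      exact absurd h.symm (Real.exp_pos _).ne'
    · rw [hy, expNeg_top, expNeg_of_ne_top _ hx] at h
      exact absurd h (Real.exp_pos _).ne'
    · rw [expNeg_of_ne_top _ hx, expNeg_of_ne_top _ hy, Real.exp_eq_exp] at h
      exact (ENNReal.toReal_eq_toReal_iff' hx hy).1 (by linarith)
  have htop := ContinuousMap.subalgebra_topologicalClosure_eq_top_of_separatesPoints A hsep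
  have hf : f ∈ closure (A : Set C(ℝ≥0∞, ℝ)) := by
    rw [← Subalgebra.topologicalClosure_coe, htop]; trivial
  obtain ⟨u, hu, hlim⟩ := mem_closure_iff_seq_limit.1 hf
  exact lim u f (fun n => hA _ (hu n)) hlim

/-- A probability measure on `[0, ∞]` is determined by its Laplace transform on `(0, ∞)`. -/
theorem eq_of_integral_expNeg_eq {μ ν : Measure ℝ≥0∞} [IsProbabilityMeasure μ]
    [IsProbabilityMeasure ν]
    (h : ∀ lam : ℝ, 0 < lam → ∫ y, expNeg lam y ∂μ = ∫ y, expNeg lam y ∂ν) : μ = ν := by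
  have key : ∀ f : C(ℝ≥0∞, ℝ), ∫ y, f y ∂μ = ∫ y, f y ∂ν := by
    refine continuousMap_induction (by simp) (fun lam hlam => h lam hlam) ?_ ?_ ?_
    · intro f g hf hg
      simp only [ContinuousMap.add_apply]
      rw [integral_add (integrable_continuousMap f _) (integrable_continuousMap g _),
        integral_add (integrable_continuousMap f _) (integrable_continuousMap g _), hf, hg]
    · intro a f hf
      simp only [ContinuousMap.smul_apply, integral_smul, hf]
    · intro f g hf hlim
      refine tendsto_nhds_unique (tendsto_integral_continuousMap hlim μ) ?_
      simp only [hf]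
      exact tendsto_integral_continuousMap hlim ν
  exact ext_of_forall_integral_eq_of_IsFiniteMeasure fun f => key f.toContinuousMap

/-- A family of probability measures on `[0, ∞]` is a kernel as soon as its Laplace transforms
depend measurably on the parameter. -/
theorem measurable_of_measurable_integral_expNeg {X : Type*} [MeasurableSpace X]
    {κ : X → Measure ℝ≥0∞} [∀ x, IsProbabilityMeasure (κ x)]
    (h : ∀ lam : ℝ, 0 < lam → Measurable fun x => ∫ y, expNeg lam y ∂(κ x)) : Measurable κ := by
  have key : ∀ f : C(ℝ≥0∞, ℝ), Measurable fun x => ∫ y, f y ∂(κ x) := by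
    refine continuousMap_induction (by simp) (fun lam hlam => h lam hlam) ?_ ?_ ?_
    · intro f g hf hg
      simp only [ContinuousMap.add_apply]
      have : (fun x => ∫ y, f y + g y ∂(κ x)) =
          fun x => ∫ y, f y ∂(κ x) + ∫ y, g y ∂(κ x) := by
        ext x
        exact integral_add (integrable_continuousMap f _) (integrable_continuousMap g _)
      rw [this]
      exact hf.add hg
    · intro a f hf
      simp only [ContinuousMap.smul_apply, integral_smul]
      exact hf.const_smul a
    · intro f g hf hlim
      refine measurable_of_tendsto_metrizable hf (tendsto_pi_nhds.2 fun x => ?_)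
      exact tendsto_integral_continuousMap hlim (κ x)
  refine Measurable.measure_of_isPiSystem_of_isProbabilityMeasure
    (S := {s | IsClosed s}) ?_ isPiSystem_isClosed ?_
  · rw [← borel_eq_generateFrom_isClosed]
    exact BorelSpace.measurable_eq
  · intro F hF
    have hF' : IsClosed F := hF
    refine measurable_of_tendsto_metrizable (f := fun n x => ENNReal.ofReal
      (∫ y, (hF'.apprSeq n y : ℝ) ∂(κ x))) (fun n => ?_) (tendsto_pi_nhds.2 fun x => ?_)
    · exact (key ⟨fun y => (hF'.apprSeq n y : ℝ), by fun_prop⟩).ennreal_ofReal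
    · have := HasOuterApproxClosed.tendsto_lintegral_apprSeq hF' (κ x)
      refine this.congr fun n => ?_
      rw [ofReal_integral_eq_lintegral_ofReal]
      · simp
      · exact integrable_continuousMap ⟨fun y => (hF'.apprSeq n y : ℝ), by fun_prop⟩ _
      · exact Eventually.of_forall fun y => NNReal.coe_nonneg _

/-- `φ` agrees on `(0, ∞)` with the Laplace transform of a probability measure on `[0, ∞]`, the
point `∞` being allowed to carry mass. -/
def IsLaplace (φ : ℝ → ℝ) : Prop :=
  ∃ ν : Measure ℝ≥0∞, IsProbabilityMeasure ν ∧ ∀ lam, 0 < lam → ∫ y, expNeg lam y ∂ν = φ lam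

namespace IsLaplace

theorem congr {φ ψ : ℝ → ℝ} (h : IsLaplace φ) (hφ : ∀ lam, 0 < lam → φ lam = ψ lam) :
    IsLaplace ψ := by
  obtain ⟨ν, hν, h⟩ := h
  exact ⟨ν, hν, fun lam hlam => (h lam hlam).trans (hφ lam hlam)⟩

theorem le_one {φ : ℝ → ℝ} (h : IsLaplace φ) {lam : ℝ} (hlam : 0 < lam) : φ lam ≤ 1 := by
  obtain ⟨ν, hν, h⟩ := h
  rw [← h lam hlam]
  calc ∫ y, expNeg lam y ∂ν ≤ ∫ _, (1 : ℝ) ∂ν :=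
        integral_mono (integrable_expNeg hlam ν) (integrable_const _) (expNeg_le_one hlam.le)
    _ = 1 := by simp

theorem one : IsLaplace fun _ => 1 :=
  ⟨Measure.dirac 0, inferInstance, fun lam hlam => by
    rw [integral_dirac]; simp [expNeg]⟩

theorem mul {φ ψ : ℝ → ℝ} (hφ : IsLaplace φ) (hψ : IsLaplace ψ) :
    IsLaplace fun lam => φ lam * ψ lam := by
  obtain ⟨μ, hμ, h1⟩ := hφ
  obtain ⟨ν, hν, h2⟩ := hψ
  have hm : Measurable fun q : ℝ≥0∞ × ℝ≥0∞ => q.1 + q.2 := measurable_fst.add measurable_snd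
  refine ⟨(μ.prod ν).map fun q => q.1 + q.2, Measure.isProbabilityMeasure_map hm.aemeasurable,
    fun lam hlam => ?_⟩
  rw [integral_map hm.aemeasurable (measurable_expNeg hlam).aestronglyMeasurable]
  simp only [expNeg_add]
  rw [integral_prod_mul, h1 lam hlam, h2 lam hlam]

theorem pow {φ : ℝ → ℝ} (hφ : IsLaplace φ) (n : ℕ) : IsLaplace fun lam => φ lam ^ n := by
  induction n with
  | zero => simpa using one
  | succ n ih => simpa only [pow_succ] using ih.mul hφ

/-- Laplace transforms are stable under pointwise limits, by weak compactness of the set of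
probability measures on the compact space `[0, ∞]`. -/
theorem of_tendsto {φ : ℕ → ℝ → ℝ} {ψ : ℝ → ℝ} (hφ : ∀ n, IsLaplace (φ n))
    (hlim : ∀ lam, 0 < lam → Tendsto (fun n => φ n lam) atTop (𝓝 (ψ lam))) : IsLaplace ψ := by
  choose ν hν h using hφ
  let P : ℕ → ProbabilityMeasure ℝ≥0∞ := fun n => ⟨ν n, hν n⟩
  let U : Ultrafilter ℕ := hyperfilter ℕ
  have hU : (U : Filter ℕ) ≤ atTop := by
    rw [← Nat.cofinite_eq_atTop]; exact hyperfilter_le_cofinite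
  obtain ⟨Q, hQ⟩ : ∃ Q, Tendsto P U (𝓝 Q) := ⟨_, (U.map P).le_nhds_lim⟩
  refine ⟨Q, inferInstance, fun lam hlam => ?_⟩
  have h1 := ProbabilityMeasure.tendsto_iff_forall_integral_tendsto.1 hQ
    (BoundedContinuousFunction.mkOfCompact (expNegC lam hlam))
  refine tendsto_nhds_unique h1 (((hlim lam hlam).mono_left hU).congr fun n => ?_)
  exact (h n lam hlam).symm

/-- A measurable family of Laplace transforms comes from a Markov kernel. -/
theorem exists_kernel {X : Type*} [MeasurableSpace X] {φ : X → ℝ → ℝ}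
    (hφ : ∀ x, IsLaplace (φ x)) (hm : ∀ lam, 0 < lam → Measurable fun x => φ x lam) :
    ∃ κ : Kernel X ℝ≥0∞, IsMarkovKernel κ ∧
      ∀ x lam, 0 < lam → ∫ y, expNeg lam y ∂(κ x) = φ x lam := by
  choose ν hν h using hφ
  refine ⟨⟨ν, measurable_of_measurable_integral_expNeg fun lam hlam => ?_⟩, ⟨hν⟩, h⟩
  simpa only [h _ lam hlam] using hm lam hlam

/-- Mixtures of Laplace transforms are Laplace transforms. -/
theorem mixture {X : Type*} [MeasurableSpace X] (ρ : Measure X) [IsProbabilityMeasure ρ]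
    {φ : X → ℝ → ℝ} (hφ : ∀ x, IsLaplace (φ x))
    (hm : ∀ lam, 0 < lam → Measurable fun x => φ x lam) :
    IsLaplace fun lam => ∫ x, φ x lam ∂ρ := by
  obtain ⟨κ, hκ, h⟩ := exists_kernel hφ hm
  refine ⟨(κ ∘ₖ Kernel.const Unit ρ) (), inferInstance, fun lam hlam => ?_⟩
  rw [Kernel.integral_comp (integrable_expNeg hlam _)]
  simp only [h _ lam hlam, Kernel.const_apply]

theorem convex {φ ψ : ℝ → ℝ} (hφ : IsLaplace φ) (hψ : IsLaplace ψ) {a b : ℝ} (ha : 0 ≤ a)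
    (hb : 0 ≤ b) (hab : a + b = 1) : IsLaplace fun lam => a * φ lam + b * ψ lam := by
  obtain ⟨μ, hμ, h1⟩ := hφ
  obtain ⟨ν, hν, h2⟩ := hψ
  refine ⟨ENNReal.ofReal a • μ + ENNReal.ofReal b • ν, ⟨?_⟩, fun lam hlam => ?_⟩
  · simp [← ENNReal.ofReal_add ha hb, hab]
  · have i1 := (integrable_expNeg hlam μ).smul_measure (ENNReal.ofReal_ne_top (r := a))
    have i2 := (integrable_expNeg hlam ν).smul_measure (ENNReal.ofReal_ne_top (r := b))
    rw [integral_add_measure i1 i2, integral_smul_measure, integral_smul_measure,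
      ENNReal.toReal_ofReal ha, ENNReal.toReal_ofReal hb, h1 lam hlam, h2 lam hlam]
    rfl

theorem continuousOn {φ : ℝ → ℝ} (hφ : IsLaplace φ) : ContinuousOn φ (Ioi 0) := by
  obtain ⟨ν, hν, h⟩ := hφ
  have hc : ContinuousOn (fun lam => ∫ y, expNeg lam y ∂ν) (Ioi 0) := by
    refine continuousOn_of_dominated (bound := fun _ => 1) (fun lam hlam =>
      (measurable_expNeg hlam).aestronglyMeasurable) (fun lam hlam => Eventually.of_forall fun y =>
      abs_expNeg_le_one (le_of_lt hlam) y) (integrable_const _) (Eventually.of_forall fun y => ?_)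
    by_cases hy : y = ∞
    · simp only [hy, expNeg_top]; exact continuousOn_const
    · simp only [expNeg_of_ne_top _ hy]; fun_prop
  exact hc.congr fun lam hlam => (h lam hlam).symm

end IsLaplace

/-! ### Bernstein functions -/

/-- `w` is a Bernstein function on `(0, ∞)`, encoded by the infinitely divisible family it
generates: `lam ↦ e^{-y w(lam)}` is the Laplace transform of a probability measure on `[0, ∞]`
for every `y ≥ 0`. -/
def IsBernstein (w : ℝ → ℝ) : Prop :=
  ∀ y : ℝ, 0 ≤ y → IsLaplace fun lam => Real.exp (-y * w lam)

namespace IsBernstein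

theorem nonneg {w : ℝ → ℝ} (hw : IsBernstein w) {lam : ℝ} (hlam : 0 < lam) : 0 ≤ w lam := by
  have := (hw 1 zero_le_one).le_one hlam
  rw [Real.exp_le_one_iff] at this
  linarith

theorem identity : IsBernstein fun lam => lam := fun y hy =>
  ⟨Measure.dirac (ENNReal.ofReal y), inferInstance, fun lam _ => by
    rw [integral_dirac, expNeg_ofReal _ hy]; ring_nf⟩

theorem add {w₁ w₂ : ℝ → ℝ} (h₁ : IsBernstein w₁) (h₂ : IsBernstein w₂) :
    IsBernstein fun lam => w₁ lam + w₂ lam := fun y hy =>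
  ((h₁ y hy).mul (h₂ y hy)).congr fun lam _ => by rw [← Real.exp_add]; ring_nf

theorem const_mul {w : ℝ → ℝ} (h : IsBernstein w) {a : ℝ} (ha : 0 ≤ a) :
    IsBernstein fun lam => a * w lam := fun y hy =>
  (h (y * a) (mul_nonneg hy ha)).congr fun lam _ => by ring_nf

theorem of_tendsto {w : ℕ → ℝ → ℝ} {v : ℝ → ℝ} (hw : ∀ n, IsBernstein (w n))
    (hlim : ∀ lam, 0 < lam → Tendsto (fun n => w n lam) atTop (𝓝 (v lam))) : IsBernstein v :=
  fun y hy => IsLaplace.of_tendsto (fun n => hw n y hy) fun lam hlam =>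
    (Real.continuous_exp.tendsto _).comp ((hlim lam hlam).const_mul _)

theorem congr {w v : ℝ → ℝ} (hw : IsBernstein w) (h : ∀ lam, 0 < lam → w lam = v lam) :
    IsBernstein v := fun y hy => (hw y hy).congr fun lam hlam => by rw [h lam hlam]

/-- The Laplace exponent `C (1 - φ)` of a compound Poisson law; its exponential is the limit of
the powers `(1 - (y C / n) (1 - φ))^n`, which are powers of convex combinations of `1` and `φ`. -/
theorem const_mul_one_sub {φ : ℝ → ℝ} (hφ : IsLaplace φ) {C : ℝ} (hC : 0 ≤ C) :
    IsBernstein fun lam => C * (1 - φ lam) := by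
  intro y hy
  obtain ⟨N, hN⟩ := exists_nat_ge (y * C)
  have hyC : 0 ≤ y * C := mul_nonneg hy hC
  refine IsLaplace.of_tendsto (φ := fun n lam => (1 + (-y * (C * (1 - φ lam))) / ((n + N + 1 : ℕ) : ℝ))
    ^ (n + N + 1)) (fun n => ?_) (fun lam _ => ?_)
  · have hpos : (0 : ℝ) < ((n + N + 1 : ℕ) : ℝ) := by positivity
    have hle : y * C / ((n + N + 1 : ℕ) : ℝ) ≤ 1 := by
      rw [div_le_one hpos]; push_cast
      have : (0 : ℝ) ≤ n := Nat.cast_nonneg n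
      linarith
    refine ((IsLaplace.one.convex hφ (a := 1 - y * C / ((n + N + 1 : ℕ) : ℝ))
      (b := y * C / ((n + N + 1 : ℕ) : ℝ)) (by linarith) (by positivity) (by ring)).pow
      (n + N + 1)).congr fun lam _ => ?_
    congr 1; ring
  · have h1 := Real.tendsto_one_add_div_pow_exp (-y * (C * (1 - φ lam)))
    have h2 : Tendsto (fun n : ℕ => n + N + 1) atTop atTop :=
      tendsto_atTop_mono (fun n => by simp only [id_eq]; omega) tendsto_id
    exact h1.comp h2

/-- If `w` is Bernstein, then so is `∫ (1 - e^{-w z}) dρ` for a finite measure `ρ`. -/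
theorem integral_one_sub_exp {w : ℝ → ℝ} (hw : IsBernstein w) {Ω : Type*} [MeasurableSpace Ω]
    (ρ : Measure Ω) [IsFiniteMeasure ρ] {z : Ω → ℝ} (hz : Measurable z) (hz0 : ∀ ω, 0 ≤ z ω) :
    IsBernstein fun lam => ∫ ω, (1 - Real.exp (-(w lam) * z ω)) ∂ρ := by
  by_cases hρ : ρ = 0
  · simpa [hρ] using IsBernstein.identity.const_mul le_rfl
  have hne : NeZero ρ := ⟨hρ⟩
  let ρ' : Measure Ω := (ρ univ)⁻¹ • ρ
  have hprob : IsProbabilityMeasure ρ' := inferInstance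
  have h1 : IsLaplace fun lam => ∫ ω, Real.exp (-(z ω) * w lam) ∂ρ' :=
    IsLaplace.mixture ρ' (fun ω => hw (z ω) (hz0 ω)) fun lam _ => by fun_prop
  refine (const_mul_one_sub h1 (C := ρ.real univ) measureReal_nonneg).congr fun lam hlam => ?_
  have hi : Integrable (fun ω => Real.exp (-(w lam) * z ω)) ρ := by
    refine Integrable.of_bound (by fun_prop) 1 (Eventually.of_forall fun ω => ?_)
    rw [Real.norm_eq_abs, Real.abs_exp, Real.exp_le_one_iff]
    have := mul_nonneg (hw.nonneg hlam) (hz0 ω)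
    linarith
  have hpos : 0 < ρ.real univ := measureReal_univ_pos
  rw [integral_sub (integrable_const _) hi, integral_smul_measure]
  simp only [integral_const, smul_eq_mul, mul_one, ENNReal.toReal_inv, ← measureReal_def]
  have : ∀ ω, Real.exp (-(z ω) * w lam) = Real.exp (-(w lam) * z ω) := fun ω => by ring_nf
  simp only [this]
  field_simp

/-- The Markov kernel on `[0, ∞]` with Laplace transforms `e^{-x w(lam)}`. -/
theorem exists_kernel {w : ℝ → ℝ} (hw : IsBernstein w) :
    ∃ κ : Kernel ℝ≥0∞ ℝ≥0∞, IsMarkovKernel κ ∧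
      ∀ x lam, 0 < lam → ∫ y, expNeg lam y ∂(κ x) = expNeg (w lam) x := by
  refine IsLaplace.exists_kernel (φ := fun x lam => expNeg (w lam) x) (fun x => ?_) fun lam hlam => ?_
  · by_cases hx : x = ∞
    · exact ⟨Measure.dirac ∞, inferInstance, fun lam hlam => by
        simp [hx]⟩
    · refine (hw x.toReal ENNReal.toReal_nonneg).congr fun lam _ => ?_
      rw [expNeg_of_ne_top _ hx]; ring_nf
  · unfold expNeg
    exact Measurable.ite (measurableSet_singleton ∞) measurable_const (by fun_prop)

theorem continuousOn {w : ℝ → ℝ} (hw : IsBernstein w) : ContinuousOn w (Ioi 0) := by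
  have h := (hw 1 zero_le_one).continuousOn
  have h2 : ContinuousOn (fun lam => -Real.log (Real.exp (-1 * w lam))) (Ioi 0) :=
    (h.log fun lam _ => (Real.exp_pos _).ne').neg
  exact h2.congr fun lam _ => by simp

end IsBernstein

/-! ### The Lévy–Khintchine representation -/

/-- The function `y ↦ (1 - e^{-lam y}) / (1 - e^{-y})` on `[0, ∞]`, extended by `lam` at `y = 0`. -/
noncomputable def levyRatio (lam : ℝ) (y : ℝ≥0∞) : ℝ :=
  if y = 0 then lam else (1 - expNeg lam y) / (1 - expNeg 1 y)

theorem expNeg_lt_one {lam : ℝ} (hlam : 0 < lam) {y : ℝ≥0∞} (hy : y ≠ 0) : expNeg lam y < 1 := by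
  by_cases hyt : y = ∞
  · simp [hyt]
  rw [expNeg_of_ne_top _ hyt, Real.exp_lt_one_iff]
  have := mul_pos hlam (ENNReal.toReal_pos hy hyt)
  linarith

@[simp] theorem expNeg_zero_right (lam : ℝ) : expNeg lam 0 = 1 := by simp [expNeg]

theorem levyRatio_mul (lam : ℝ) (y : ℝ≥0∞) :
    levyRatio lam y * (1 - expNeg 1 y) = 1 - expNeg lam y := by
  unfold levyRatio
  split_ifs with h
  · simp [h]
  · have := expNeg_lt_one one_pos h
    rw [div_mul_cancel₀]
    linarith

theorem tendsto_one_sub_exp_div {lam : ℝ} :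
    Tendsto (fun t : ℝ => (1 - Real.exp (-lam * t)) / (1 - Real.exp (-t))) (𝓝[≠] 0) (𝓝 lam) := by
  have key : ∀ a : ℝ, Tendsto (fun t : ℝ => (1 - Real.exp (-a * t)) / t) (𝓝[≠] 0) (𝓝 a) := by
    intro a
    have h : HasDerivAt (fun t : ℝ => 1 - Real.exp (-a * t)) a 0 := by
      have h1 : HasDerivAt (fun t : ℝ => -a * t) (-a) 0 := by
        simpa using (hasDerivAt_id (0 : ℝ)).const_mul (-a)
      simpa using h1.exp.const_sub 1
    refine (hasDerivAt_iff_tendsto_slope.1 h).congr fun t => ?_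
    simp [slope_def_field]
  have h := (key lam).div (key 1) one_ne_zero
  rw [div_one] at h
  refine h.congr' ?_
  filter_upwards [self_mem_nhdsWithin] with t ht
  have ht' : t ≠ 0 := ht
  rw [Pi.div_apply, neg_one_mul, div_div_div_cancel_right₀ ht']

theorem continuous_levyRatio {lam : ℝ} (hlam : 0 < lam) : Continuous (levyRatio lam) := by
  rw [continuous_iff_continuousAt]
  intro x
  by_cases hx : x = 0
  · subst hx
    rw [continuousAt_iff_punctured_nhds]
    have h1 : Tendsto ENNReal.toReal (𝓝[≠] 0) (𝓝[≠] 0) := by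
      refine tendsto_nhdsWithin_iff.2 ⟨?_, ?_⟩
      · exact (ENNReal.tendsto_toReal ENNReal.zero_ne_top).mono_left nhdsWithin_le_nhds
      · filter_upwards [self_mem_nhdsWithin,
          mem_nhdsWithin_of_mem_nhds (isOpen_ne.mem_nhds (ENNReal.zero_ne_top))] with y hy hyt
        exact (ENNReal.toReal_pos hy hyt).ne'
    have h2 := (tendsto_one_sub_exp_div (lam := lam)).comp h1
    have h0 : levyRatio lam 0 = lam := by simp [levyRatio]
    rw [h0]
    refine h2.congr' ?_
    filter_upwards [self_mem_nhdsWithin,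
      mem_nhdsWithin_of_mem_nhds (isOpen_ne.mem_nhds (ENNReal.zero_ne_top))] with y hy hyt
    have hy' : y ≠ 0 := hy
    simp [levyRatio, hy', expNeg_of_ne_top _ hyt]
  · have hev : ∀ᶠ y : ℝ≥0∞ in 𝓝 x, levyRatio lam y = (1 - expNeg lam y) / (1 - expNeg 1 y) := by
      filter_upwards [isOpen_ne.mem_nhds hx] with y hy
      exact if_neg hy
    refine ContinuousAt.congr ?_ (hev.mono fun _ h => h.symm)
    have h1 := (continuous_expNeg hlam).continuousAt (x := x)
    have h2 := (continuous_expNeg one_pos).continuousAt (x := x)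
    refine (continuousAt_const.sub h1).div (continuousAt_const.sub h2) ?_
    have := expNeg_lt_one one_pos hx
    linarith

/-- A Bernstein function `w` with `w(1) > 0` is `w(1)` times a mixture of the functions
`lam ↦ (1 - e^{-lam y}) / (1 - e^{-y})`, `y ∈ [0, ∞]`. The mixing measure is a weak limit point of
the laws proportional to `(1 - e^{-y}) ν_n(dy)`, where `ν_n` has the Laplace transform
`e^{-w / n}`. -/
theorem IsBernstein.exists_levyRatio {w : ℝ → ℝ} (hw : IsBernstein w) (h1 : 0 < w 1) :
    ∃ μ : Measure ℝ≥0∞, IsProbabilityMeasure μ ∧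
      ∀ lam, 0 < lam → ∫ y, levyRatio lam y ∂μ = w lam / w 1 := by
  let x : ℕ → ℝ := fun n => 1 / ((n : ℝ) + 1)
  have hx : ∀ n, 0 < x n := fun n => by positivity
  choose ν hν hν' using fun n => hw (x n) (hx n).le
  let m : ℕ → ℝ := fun n => 1 - Real.exp (-x n * w 1)
  have hm : ∀ n, 0 < m n := fun n => by
    have : Real.exp (-x n * w 1) < 1 := by
      rw [Real.exp_lt_one_iff]
      have := mul_pos (hx n) h1
      linarith
    simp only [m]; linarith
  let d : ℕ → ℝ≥0∞ → ℝ≥0 := fun n y => ((1 - expNeg 1 y) / m n).toNNReal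
  have hd0 : ∀ n y, 0 ≤ (1 - expNeg 1 y) / m n := fun n y =>
    div_nonneg (sub_nonneg.2 (expNeg_le_one zero_le_one y)) (hm n).le
  have hd : ∀ n, Measurable (d n) := fun n =>
    (((continuous_const.sub (continuous_expNeg one_pos)).div_const _).measurable).real_toNNReal
  have hint : ∀ n, Integrable (fun y => (1 - expNeg 1 y) / m n) (ν n) := fun n =>
    ((integrable_const 1).sub (integrable_expNeg one_pos _)).div_const _
  have hP : ∀ n, IsProbabilityMeasure ((ν n).withDensity fun y => (d n y : ℝ≥0∞)) := fun n => by
    constructor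
    rw [withDensity_apply _ MeasurableSet.univ, Measure.restrict_univ]
    have h2 := ofReal_integral_eq_lintegral_ofReal (hint n) (Eventually.of_forall (hd0 n))
    have h3 : ∫ y, (1 - expNeg 1 y) / m n ∂(ν n) = 1 := by
      rw [integral_div, integral_sub (integrable_const 1) (integrable_expNeg one_pos _),
        hν' n 1 one_pos]
      simp only [integral_const, probReal_univ, smul_eq_mul, mul_one]
      exact div_self (hm n).ne'
    rw [h3, ENNReal.ofReal_one] at h2
    exact h2.symm
  let P : ℕ → ProbabilityMeasure ℝ≥0∞ := fun n => ⟨_, hP n⟩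
  let U : Ultrafilter ℕ := hyperfilter ℕ
  have hU : (U : Filter ℕ) ≤ atTop := by
    rw [← Nat.cofinite_eq_atTop]; exact hyperfilter_le_cofinite
  obtain ⟨Q, hQ⟩ : ∃ Q, Tendsto P U (𝓝 Q) := ⟨_, (U.map P).le_nhds_lim⟩
  refine ⟨Q, inferInstance, fun lam hlam => ?_⟩
  have h2 := ProbabilityMeasure.tendsto_iff_forall_integral_tendsto.1 hQ
    (BoundedContinuousFunction.mkOfCompact ⟨levyRatio lam, continuous_levyRatio hlam⟩)
  have h3 : ∀ n, ∫ y, levyRatio lam y ∂(P n : Measure ℝ≥0∞) =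
      (1 - Real.exp (-w lam * x n)) / (1 - Real.exp (-w 1 * x n)) := fun n => by
    have e1 : ∫ y, levyRatio lam y ∂(P n : Measure ℝ≥0∞) = ∫ y, d n y • levyRatio lam y ∂(ν n) :=
      integral_withDensity_eq_integral_smul (hd n) _
    have e2 : ∀ y, d n y • levyRatio lam y = (1 - expNeg lam y) / m n := fun y => by
      rw [NNReal.smul_def, Real.coe_toNNReal _ (hd0 n y), smul_eq_mul, ← levyRatio_mul lam y]
      ring
    simp only [e1, e2]
    rw [integral_div, integral_sub (integrable_const 1) (integrable_expNeg hlam _),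
        hν' n lam hlam]
    simp only [integral_const, probReal_univ, smul_eq_mul, mul_one, m]
    ring_nf
  have hx0 : Tendsto (fun n => w 1 * x n) atTop (𝓝[≠] 0) := by
    refine tendsto_nhdsWithin_iff.2 ⟨?_, Eventually.of_forall fun n => ?_⟩
    · simpa [x] using (tendsto_one_div_add_atTop_nhds_zero_nat (𝕜 := ℝ)).const_mul (w 1)
    · exact (mul_pos h1 (hx n)).ne'
  have h4 := (tendsto_one_sub_exp_div (lam := w lam / w 1)).comp hx0
  refine tendsto_nhds_unique h2 ((h4.mono_left hU).congr fun n => ?_)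
  refine Eq.trans ?_ (h3 n).symm
  have e1 : -(w lam / w 1) * (w 1 * x n) = -w lam * x n := by field_simp
  have e2 : -(w 1 * x n) = -w 1 * x n := by ring
  simp only [Function.comp_apply, e1, e2]

/-- The Lévy–Khintchine representation of Bernstein functions. -/
theorem IsBernstein.levyKhintchine {w : ℝ → ℝ} (hw : IsBernstein w) (h1 : 0 < w 1) :
    ∃ (a h : ℝ) (l : Measure ℝ), 0 ≤ a ∧ 0 ≤ h ∧
    ∫⁻ y in Ioi 0, ENNReal.ofReal (min 1 y) ∂l < ∞ ∧
    ∀ lam, 0 < lam → w lam = a + h * lam + ∫ y in Ioi 0, (1 - Real.exp (-lam * y)) ∂l := by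
  obtain ⟨μ, hμ, hμ'⟩ := hw.exists_levyRatio h1
  let d : ℝ≥0∞ → ℝ≥0 := fun y => (w 1 / (1 - expNeg 1 y)).toNNReal
  have hd0 : ∀ y, 0 ≤ w 1 / (1 - expNeg 1 y) := fun y =>
    div_nonneg h1.le (sub_nonneg.2 (expNeg_le_one zero_le_one y))
  have hd : Measurable d :=
    (measurable_const.div (measurable_const.sub (measurable_expNeg one_pos))).real_toNNReal
  let l : Measure ℝ := (μ.withDensity fun y => (d y : ℝ≥0∞)).map ENNReal.toReal
  have hpre : ENNReal.toReal ⁻¹' (Ioi 0) = Ioo 0 ∞ := by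
    ext y
    simp [ENNReal.toReal_pos_iff]
  refine ⟨w 1 * μ.real {∞}, w 1 * μ.real {0}, l, by positivity, by positivity, ?_, ?_⟩
  · rw [setLIntegral_map measurableSet_Ioi (by fun_prop) ENNReal.measurable_toReal, hpre,
      setLIntegral_withDensity_eq_setLIntegral_mul _ (by fun_prop) (by fun_prop)
        measurableSet_Ioo]
    refine lt_of_le_of_lt (setLIntegral_mono (g := fun _ => ENNReal.ofReal (2 * w 1))
      (by fun_prop) fun y hy => ?_) ?_
    · have hyt : y ≠ ∞ := hy.2.ne
      have hpos : 0 < y.toReal := ENNReal.toReal_pos hy.1.ne' hyt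
      have e1 : ((d y : ℝ≥0) : ℝ≥0∞) = ENNReal.ofReal (w 1 / (1 - expNeg 1 y)) := rfl
      simp only [Pi.mul_apply]
      rw [e1, ← ENNReal.ofReal_mul (hd0 y)]
      refine ENNReal.ofReal_le_ofReal ?_
      rw [expNeg_of_ne_top _ hyt]
      set t := y.toReal
      have hexp : Real.exp (-1 * t) ≤ 1 / (1 + t) := by
        rw [neg_one_mul, Real.exp_neg, one_div]
        exact inv_anti₀ (by linarith) (by linarith [Real.add_one_le_exp t])
      have h2 : min 1 t / 2 ≤ t / (1 + t) := by
        rw [div_le_div_iff₀ two_pos (by linarith)]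
        rcases le_total t 1 with h | h
        · rw [min_eq_right h]; nlinarith
        · rw [min_eq_left h]; linarith
      have h3 : t / (1 + t) = 1 - 1 / (1 + t) := by field_simp; ring
      have h4 : min 1 t / 2 ≤ 1 - Real.exp (-1 * t) := by linarith
      have h5 : 0 < min 1 t := lt_min one_pos hpos
      rw [div_mul_eq_mul_div, div_le_iff₀ (by linarith)]
      nlinarith
    · rw [lintegral_const]
      exact ENNReal.mul_lt_top ENNReal.ofReal_lt_top (measure_lt_top _ _)
  · intro lam hlam
    have hi : Integrable (levyRatio lam) μ :=
      integrable_continuousMap ⟨levyRatio lam, continuous_levyRatio hlam⟩ μ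
    have e1 : ∫ y in Ioi 0, (1 - Real.exp (-lam * y)) ∂l =
        w 1 * ∫ y in Ioo 0 ∞, levyRatio lam y ∂μ := by
      rw [setIntegral_map measurableSet_Ioi (by fun_prop) (by fun_prop), hpre,
        setIntegral_withDensity_eq_setIntegral_smul (by fun_prop) _ measurableSet_Ioo,
        ← integral_const_mul]
      refine setIntegral_congr_fun measurableSet_Ioo fun y hy => ?_
      have hlt := expNeg_lt_one one_pos hy.1.ne'
      simp only [levyRatio, if_neg hy.1.ne']
      rw [NNReal.smul_def, Real.coe_toNNReal _ (hd0 y), smul_eq_mul,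
        ← expNeg_of_ne_top _ hy.2.ne]
      ring
    have e2 : ∫ y, levyRatio lam y ∂μ = ∫ y in Ioo 0 ∞, levyRatio lam y ∂μ +
        (μ.real {0} * lam + μ.real {∞}) := by
      rw [← integral_add_compl measurableSet_Ioo hi]
      congr 1
      have : (Ioo 0 ∞ : Set ℝ≥0∞)ᶜ = {0} ∪ {∞} := by
        ext y
        simp only [mem_compl_iff, mem_Ioo, not_and, not_lt, top_le_iff, mem_union,
          mem_singleton_iff, pos_iff_ne_zero]
        tauto
      rw [this, setIntegral_union (by simp) (measurableSet_singleton _) hi.integrableOn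
        hi.integrableOn, integral_singleton, integral_singleton]
      simp [levyRatio]
    have e3 := hμ' lam hlam
    rw [e1]
    rw [e2, eq_div_iff h1.ne'] at e3
    linarith

/-! ### Backward induction along a finite measure -/

theorem exists_measureReal_Ioo_le_left (η : Measure ℝ≥0) [IsFiniteMeasure η] {r s : ℝ≥0}
    (hrs : r < s) {ε : ℝ} (hε : 0 < ε) : ∃ r', r ≤ r' ∧ r' < s ∧ η.real (Ioo r' s) ≤ ε := by
  obtain ⟨u, humono, hu, hlim⟩ := exists_seq_strictMono_tendsto' hrs
  have hempty : ⋂ n, Ioo (u n) s = ∅ := by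
    refine eq_empty_of_forall_notMem fun x hx => ?_
    have hx' := mem_iInter.1 hx
    exact absurd (le_of_tendsto' hlim fun n => (hx' n).1.le) (not_le.2 (hx' 0).2)
  have hanti : Antitone fun n => Ioo (u n) s := fun m n hmn =>
    Ioo_subset_Ioo_left (humono.monotone hmn)
  have h1 := tendsto_measure_iInter_atTop (μ := η)
    (fun n => measurableSet_Ioo.nullMeasurableSet) hanti ⟨0, measure_ne_top _ _⟩
  rw [hempty, measure_empty] at h1
  have h2 := (ENNReal.tendsto_toReal ENNReal.zero_ne_top).comp h1
  obtain ⟨n, hn⟩ := (h2.eventually_lt_const (by simpa using hε)).exists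
  exact ⟨u n, (hu n).1.le, (hu n).2, hn.le⟩

theorem exists_measureReal_Ioo_le_right (η : Measure ℝ≥0) [IsFiniteMeasure η] (r : ℝ≥0)
    {ε : ℝ} (hε : 0 < ε) : ∃ s', r < s' ∧ η.real (Ioo r s') ≤ ε := by
  obtain ⟨u, huanti, hu, hlim⟩ := exists_seq_strictAnti_tendsto r
  have hempty : ⋂ n, Ioo r (u n) = ∅ := by
    refine eq_empty_of_forall_notMem fun x hx => ?_
    have hx' := mem_iInter.1 hx
    exact absurd (ge_of_tendsto' hlim fun n => (hx' n).2.le) (not_le.2 (hx' 0).1)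
  have hanti : Antitone fun n => Ioo r (u n) := fun m n hmn =>
    Ioo_subset_Ioo_right (huanti.antitone hmn)
  have h1 := tendsto_measure_iInter_atTop (μ := η)
    (fun n => measurableSet_Ioo.nullMeasurableSet) hanti ⟨0, measure_ne_top _ _⟩
  rw [hempty, measure_empty] at h1
  have h2 := (ENNReal.tendsto_toReal ENNReal.zero_ne_top).comp h1
  obtain ⟨n, hn⟩ := (h2.eventually_lt_const (by simpa using hε)).exists
  exact ⟨u n, hu n, hn.le⟩

/-- Backward induction on `[0, t]`: a property that holds at `t` and is passed from `s` down to
`r < s` whenever the open interval `(r, s)` has small mass, holds everywhere. No smallness is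
required at the point `s` itself, so arbitrary atoms are allowed. -/
theorem backward_induction (η : Measure ℝ≥0) [IsFiniteMeasure η] {ε : ℝ} (hε : 0 < ε) {t : ℝ≥0}
    {P : ℝ≥0 → Prop} (ht : P t)
    (step : ∀ r s, r < s → s ≤ t → P s → η.real (Ioo r s) ≤ ε → P r) : ∀ r ≤ t, P r := by
  intro r hr
  let S : Set ℝ≥0 := {s | r ≤ s ∧ s ≤ t ∧ P s}
  have hne : S.Nonempty := ⟨t, hr, le_rfl, ht⟩
  have hbdd : BddBelow S := ⟨r, fun s hs => hs.1⟩
  set r₀ := sInf S with hr₀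
  have hrr₀ : r ≤ r₀ := le_csInf hne fun s hs => hs.1
  have hr₀t : r₀ ≤ t := csInf_le hbdd ⟨hr, le_rfl, ht⟩
  have hP₀ : P r₀ := by
    by_contra hcon
    obtain ⟨s', hs', hsmall⟩ := exists_measureReal_Ioo_le_right η r₀ hε
    obtain ⟨s, hs, hlt⟩ := exists_lt_of_csInf_lt hne hs'
    have hle : r₀ ≤ s := csInf_le hbdd hs
    have hlt' : r₀ < s := lt_of_le_of_ne hle fun h => hcon (h ▸ hs.2.2)
    refine hcon (step r₀ s hlt' hs.2.1 hs.2.2 ?_)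
    exact (measureReal_mono (Ioo_subset_Ioo_right hlt.le)).trans hsmall
  rcases hrr₀.eq_or_lt with h | h
  · rwa [h]
  · obtain ⟨r', hr', hlt, hsmall⟩ := exists_measureReal_Ioo_le_left η h hε
    have hmem : r' ∈ S := ⟨hr', hlt.le.trans hr₀t, step r' r₀ hlt hr₀t hP₀ hsmall⟩
    exact absurd (csInf_le hbdd hmem) (not_le.2 hlt)

/-- A bounded weight `w` for which `f ↦ L ∫_{(r, t]} f dη` is a contraction by the factor `1/2` in
the norm `sup |f| / w`. It is a step function, built backwards from `t`. -/
theorem exists_weight (η : Measure ℝ≥0) [IsFiniteMeasure η] (t : ℝ≥0) {L : ℝ} (hL : 0 ≤ L) :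
    ∃ (w : ℝ≥0 → ℝ) (K : ℝ), Measurable w ∧ (∀ x, 1 ≤ w x) ∧ (∀ x, w x ≤ K) ∧
      ∀ r, L * ∫ x in Ioc r t, w x ∂η ≤ w r / 2 := by
  have key : ∀ r ≤ t, ∃ (w : ℝ≥0 → ℝ) (K : ℝ), Measurable w ∧ (∀ x, 1 ≤ w x) ∧ (∀ x, w x ≤ K) ∧
      ∀ r', r ≤ r' → L * ∫ x in Ioc r' t, w x ∂η ≤ w r' / 2 := by
    refine backward_induction η (ε := 1 / (4 * (L + 1))) (by positivity) ?_ ?_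
    · refine ⟨fun _ => 1, 1, measurable_const, fun _ => le_rfl, fun _ => le_rfl, fun r' hr' => ?_⟩
      rw [Ioc_eq_empty (not_lt.2 hr')]
      simp
    · rintro r s hrs hst ⟨w, K, hw, h1, hK, hint⟩ hsmall
      have hK1 : 1 ≤ K := (h1 0).trans (hK 0)
      set H := η.real univ
      have hH : 0 ≤ H := measureReal_nonneg
      set W := K + 4 * (L * (K * H)) with hW
      have hKW : K ≤ W := by have : 0 ≤ L * (K * H) := by positivity
                             linarith
      refine ⟨fun x => if x < s then W else w x, W, ?_, ?_, ?_, ?_⟩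
      · exact Measurable.ite measurableSet_Iio measurable_const hw
      · intro x; dsimp only; split_ifs; exacts [hK1.trans hKW, h1 x]
      · intro x; dsimp only; split_ifs; exacts [le_rfl, (hK x).trans hKW]
      · intro r' hr'
        dsimp only
        rcases lt_or_ge r' s with hlt | hge
        · rw [if_pos hlt]
          have hbound : ∫ x in Ioc r' t, (if x < s then W else w x) ∂η ≤
              ∫ x in Ioc r' t, ((Ioo r' s).indicator (fun _ => W) x + K) ∂η := by
            refine setIntegral_mono_on ?_ ?_ measurableSet_Ioc fun x hx => ?_
            · refine (Integrable.of_bound (C := W)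
                (Measurable.ite measurableSet_Iio measurable_const hw).aestronglyMeasurable
                (Eventually.of_forall fun x => ?_))
              rw [Real.norm_eq_abs, abs_of_nonneg]
              · split_ifs; exacts [le_rfl, (hK x).trans hKW]
              · split_ifs
                · linarith
                · linarith [h1 x]
            · exact (((integrable_const W).indicator measurableSet_Ioo).add
                (integrable_const K)).integrableOn
            · by_cases hxs : x < s
              · rw [if_pos hxs, indicator_of_mem (show x ∈ Ioo r' s from ⟨hx.1, hxs⟩)]
                linarith
              · rw [if_neg hxs, indicator_of_notMem (fun h => hxs h.2)]
                linarith [hK x]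
          have hval : ∫ x in Ioc r' t, ((Ioo r' s).indicator (fun _ => W) x + K) ∂η ≤
              W * η.real (Ioo r' s) + K * H := by
            rw [integral_add ((integrable_const W).indicator measurableSet_Ioo)
              (integrable_const K), setIntegral_indicator measurableSet_Ioo, setIntegral_const,
              setIntegral_const, smul_eq_mul, smul_eq_mul, mul_comm _ W, mul_comm _ K]
            exact add_le_add
              (mul_le_mul_of_nonneg_left (measureReal_mono inter_subset_right) (by linarith))
              (mul_le_mul_of_nonneg_left (measureReal_mono (subset_univ _)) (by linarith))
          have hs2 : η.real (Ioo r' s) ≤ 1 / (4 * (L + 1)) :=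
            (measureReal_mono (Ioo_subset_Ioo_left hr')).trans hsmall
          have hs3 : L * η.real (Ioo r' s) ≤ 1 / 4 := by
            have : η.real (Ioo r' s) * (4 * (L + 1)) ≤ 1 := by
              rwa [le_div_iff₀ (by positivity)] at hs2
            have h0 : 0 ≤ η.real (Ioo r' s) := measureReal_nonneg
            linarith
          calc L * ∫ x in Ioc r' t, (if x < s then W else w x) ∂η
              ≤ L * (W * η.real (Ioo r' s) + K * H) :=
                mul_le_mul_of_nonneg_left (hbound.trans hval) hL
            _ = W * (L * η.real (Ioo r' s)) + L * (K * H) := by ring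
            _ ≤ W * (1 / 4) + L * (K * H) := by
                have : 0 ≤ W := by linarith
                gcongr
            _ ≤ W / 2 := by linarith
        · rw [if_neg (not_lt.2 hge)]
          refine le_trans (le_of_eq ?_) (hint r' hge)
          congr 1
          refine setIntegral_congr_fun measurableSet_Ioc fun x hx => ?_
          exact if_neg (not_lt.2 (hge.trans hx.1.le))
  obtain ⟨w, K, hw, h1, hK, h⟩ := key 0 zero_le
  exact ⟨w, K, hw, h1, hK, fun r => h r zero_le⟩

/-- **Grönwall's lemma** for a finite measure with atoms, with a constant that depends on the
measure and on `L` only. -/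
theorem exists_gronwall_const (η : Measure ℝ≥0) [IsFiniteMeasure η] (t : ℝ≥0) {L : ℝ}
    (hL : 0 ≤ L) :
    ∃ K : ℝ, 0 ≤ K ∧ ∀ (f : ℝ≥0 → ℝ) (a : ℝ), Measurable f → 0 ≤ a → (∀ r, 0 ≤ f r) →
      (∃ B, ∀ r, f r ≤ B) → (∀ r ≤ t, f r ≤ a + L * ∫ x in Ioc r t, f x ∂η) →
      ∀ r ≤ t, f r ≤ K * a := by
  obtain ⟨w, K, hw, h1, hK, h⟩ := exists_weight η t hL
  have hK1 : 1 ≤ K := (h1 0).trans (hK 0)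
  refine ⟨2 * K, by positivity, ?_⟩
  rintro f a hf ha hf0 ⟨B, hB⟩ hineq r hr
  have hwpos : ∀ x, 0 < w x := fun x => one_pos.trans_le (h1 x)
  let g : Iic t → ℝ := fun x => f x / w x
  have hbdd : BddAbove (range g) := by
    refine ⟨B, ?_⟩
    rintro _ ⟨x, rfl⟩
    exact (div_le_self (hf0 x) (h1 x)).trans (hB x)
  have hne : Nonempty (Iic t) := ⟨⟨t, self_mem_Iic⟩⟩
  set S := ⨆ x, g x
  have hS : ∀ x ≤ t, f x ≤ S * w x := fun x hx => by
    have : g ⟨x, hx⟩ ≤ S := le_ciSup hbdd ⟨x, hx⟩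
    rwa [div_le_iff₀ (hwpos x)] at this
  have hSnn : 0 ≤ S := (div_nonneg (hf0 t) (hwpos t).le).trans (le_ciSup hbdd ⟨t, self_mem_Iic⟩)
  have hwint : Integrable w η := Integrable.of_bound hw.aestronglyMeasurable K
    (Eventually.of_forall fun x => by rw [Real.norm_eq_abs, abs_of_pos (hwpos x)]; exact hK x)
  have hfint : Integrable f η := Integrable.of_bound hf.aestronglyMeasurable B
    (Eventually.of_forall fun x => by rw [Real.norm_eq_abs, abs_of_nonneg (hf0 x)]; exact hB x)
  have hSle : S ≤ a + S / 2 := by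
    refine ciSup_le fun x => ?_
    have e1 : ∫ y in Ioc (x : ℝ≥0) t, f y ∂η ≤ ∫ y in Ioc (x : ℝ≥0) t, S * w y ∂η :=
      setIntegral_mono_on hfint.integrableOn (hwint.const_mul S).integrableOn measurableSet_Ioc
        fun y hy => hS y hy.2
    rw [integral_const_mul] at e1
    have e2 : f x ≤ a + S * (w x / 2) := by
      calc f x ≤ a + L * ∫ y in Ioc (x : ℝ≥0) t, f y ∂η := hineq x x.2
        _ ≤ a + L * (S * ∫ y in Ioc (x : ℝ≥0) t, w y ∂η) := by gcongr
        _ = a + S * (L * ∫ y in Ioc (x : ℝ≥0) t, w y ∂η) := by ring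
        _ ≤ a + S * (w x / 2) := by gcongr; exact h x
    change f x / w x ≤ a + S / 2
    rw [div_le_iff₀ (hwpos x)]
    have := mul_le_mul_of_nonneg_left (h1 x) ha
    linarith
  calc f r ≤ S * w r := hS r hr
    _ ≤ (2 * a) * K := by
        have := hK r
        have := (hwpos r).le
        gcongr
        linarith
    _ = 2 * K * a := by ring

/-! ### Backward equations driven by a finite measure -/

/-- `u` solves `u(r) = lam + ∫_{τ(ω) ∈ (r, t]} γ(u(τ(ω)), ω) N(dω)` on `[0, t]`. Here `N` is a
measure on an abstract mark space `Ω`, each mark `ω` acting at the time `τ(ω)` through the field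
`γ(·, ω)`. -/
def SolvesBackward {Ω : Type*} [MeasurableSpace Ω] (N : Measure Ω) (τ : Ω → ℝ≥0)
    (γ : ℝ → Ω → ℝ) (t : ℝ≥0) (lam : ℝ) (u : ℝ≥0 → ℝ) : Prop :=
  ∀ r ≤ t, u r = lam + ∫ ω in τ ⁻¹' Ioc r t, γ (u (τ ω)) ω ∂N

/-- The Euler step `x ↦ x + ∫_{τ(ω) ∈ A} γ(x, ω) N(dω)` over a set `A` of times. For `A = {s}` it is
the exact jump of the solutions at time `s`. -/
noncomputable def eulerStep {Ω : Type*} [MeasurableSpace Ω] (N : Measure Ω) (τ : Ω → ℝ≥0)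
    (γ : ℝ → Ω → ℝ) (A : Set ℝ≥0) (x : ℝ) : ℝ :=
  x + ∫ ω in τ ⁻¹' A, γ x ω ∂N

/-- A field that is measurable, Lipschitz in the state with constant `L` uniformly in the marks,
and vanishes at the state `0`. -/
structure IsLipschitzField {Ω : Type*} [MeasurableSpace Ω] (γ : ℝ → Ω → ℝ) (L : ℝ) : Prop where
  measurable : Measurable fun q : ℝ × Ω => γ q.1 q.2
  nonneg : 0 ≤ L
  lipschitz : ∀ x y ω, |γ x ω - γ y ω| ≤ L * |x - y|
  zero : ∀ ω, γ 0 ω = 0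

section Backward

variable {Ω : Type*} [MeasurableSpace Ω] {N : Measure Ω} {τ : Ω → ℝ≥0}
  {γ : ℝ → Ω → ℝ} {L : ℝ}

theorem SolvesBackward.terminal {t : ℝ≥0} {lam : ℝ} {u : ℝ≥0 → ℝ}
    (hu : SolvesBackward N τ γ t lam u) : u t = lam := by
  simpa using hu t le_rfl

/-- The decomposition `(r, t] = (r, s) ∪ {s} ∪ (s, t]` of an integral over times. -/
theorem setIntegral_preimage_Ioc (hτ : Measurable τ) {f : Ω → ℝ} {r s t : ℝ≥0} (hrs : r < s)
    (hst : s ≤ t) (hf : IntegrableOn f (τ ⁻¹' Ioc r t) N) :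
    ∫ ω in τ ⁻¹' Ioc r t, f ω ∂N = ∫ ω in τ ⁻¹' Ioo r s, f ω ∂N + ∫ ω in τ ⁻¹' {s}, f ω ∂N +
      ∫ ω in τ ⁻¹' Ioc s t, f ω ∂N := by
  have h1 : Ioc r t = (Ioo r s ∪ {s}) ∪ Ioc s t := by
    rw [Ioo_union_right hrs, Ioc_union_Ioc_eq_Ioc hrs.le hst]
  have hs1 : τ ⁻¹' Ioo r s ⊆ τ ⁻¹' Ioc r t :=
    preimage_mono fun x hx => ⟨hx.1, hx.2.le.trans hst⟩
  have hs2 : τ ⁻¹' {s} ⊆ τ ⁻¹' Ioc r t :=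
    preimage_mono fun x hx => by rw [mem_singleton_iff.1 hx]; exact ⟨hrs, hst⟩
  have hs3 : τ ⁻¹' Ioc s t ⊆ τ ⁻¹' Ioc r t :=
    preimage_mono (Ioc_subset_Ioc_left hrs.le)
  rw [h1, preimage_union, preimage_union, setIntegral_union, setIntegral_union]
  · exact Disjoint.preimage _ (disjoint_singleton_right.2 fun h => lt_irrefl _ h.2)
  · exact hτ (measurableSet_singleton s)
  · exact hf.mono_set hs1
  · exact hf.mono_set hs2
  · rw [← preimage_union]
    refine Disjoint.preimage _ (disjoint_left.2 fun x hx hx' => ?_)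
    rcases hx with hx | hx
    · exact lt_asymm hx.2 hx'.1
    · exact hx'.1.ne' (mem_singleton_iff.1 hx)
  · exact hτ measurableSet_Ioc
  · rw [← preimage_union]
    exact hf.mono_set (preimage_mono fun x hx => by
      rcases hx with hx | hx
      · exact ⟨hx.1, hx.2.le.trans hst⟩
      · rw [mem_singleton_iff.1 hx]; exact ⟨hrs, hst⟩)
  · exact hf.mono_set hs3

/-- A solution passes the time `s` by its exact jump and then follows the equation on `(r, s)`. -/
theorem SolvesBackward.eq_eulerStep_add (hτ : Measurable τ) {t : ℝ≥0} {lam : ℝ} {u : ℝ≥0 → ℝ}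
    (hu : SolvesBackward N τ γ t lam u) {r s : ℝ≥0} (hrs : r < s) (hst : s ≤ t)
    (hint : IntegrableOn (fun ω => γ (u (τ ω)) ω) (τ ⁻¹' Ioc r t) N) :
    u r = eulerStep N τ γ {s} (u s) + ∫ ω in τ ⁻¹' Ioo r s, γ (u (τ ω)) ω ∂N := by
  have h1 : ∫ ω in τ ⁻¹' {s}, γ (u (τ ω)) ω ∂N = ∫ ω in τ ⁻¹' {s}, γ (u s) ω ∂N :=
    setIntegral_congr_fun (hτ (measurableSet_singleton s)) fun ω hω => by
      have : τ ω = s := hω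
      simp only [this]
  rw [eulerStep, hu r (hrs.le.trans hst), setIntegral_preimage_Ioc hτ hrs hst hint, h1]
  have := hu s hst
  linarith

namespace IsLipschitzField

theorem abs_le (hγ : IsLipschitzField γ L) (x : ℝ) (ω : Ω) : |γ x ω| ≤ L * |x| := by
  simpa [hγ.zero] using hγ.lipschitz x 0 ω

theorem measurable_comp (hγ : IsLipschitzField γ L) (hτ : Measurable τ) {u : ℝ≥0 → ℝ}
    (hu : Measurable u) : Measurable fun ω => γ (u (τ ω)) ω :=
  hγ.measurable.comp ((hu.comp hτ).prodMk measurable_id)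

theorem integrable_comp [IsFiniteMeasure N] (hγ : IsLipschitzField γ L) (hτ : Measurable τ) {u : ℝ≥0 → ℝ}
    (hu : Measurable u) {B : ℝ} (hB : ∀ r, |u r| ≤ B) : Integrable (fun ω => γ (u (τ ω)) ω) N :=
  Integrable.of_bound (hγ.measurable_comp hτ hu).aestronglyMeasurable (L * B)
    (Eventually.of_forall fun _ => (hγ.abs_le _ _).trans
      (mul_le_mul_of_nonneg_left (hB _) hγ.nonneg))

theorem integrable_const_state [IsFiniteMeasure N] (hγ : IsLipschitzField γ L) (x : ℝ) : Integrable (γ x) N :=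
  Integrable.of_bound (hγ.measurable.comp measurable_prodMk_left).aestronglyMeasurable (L * |x|)
    (Eventually.of_forall fun _ => hγ.abs_le _ _)

end IsLipschitzField
end Backward

/-! ### Picard iteration and the Euler scheme -/

section Backward

variable {Ω : Type*} [MeasurableSpace Ω] {N : Measure Ω} [IsFiniteMeasure N] {τ : Ω → ℝ≥0}
  {γ : ℝ → Ω → ℝ} {L : ℝ}

theorem abs_setIntegral_le {f : Ω → ℝ} {A : Set Ω} {C : ℝ} (h : ∀ ω ∈ A, |f ω| ≤ C) :
    |∫ ω in A, f ω ∂N| ≤ C * N.real A :=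
  norm_setIntegral_le_of_norm_le_const (f := f) (measure_lt_top _ _) h

theorem measurable_setIntegral_preimage_Ioc (hτ : Measurable τ) (t : ℝ≥0) {f : Ω → ℝ}
    (hf : Measurable f) : Measurable fun r => ∫ ω in τ ⁻¹' Ioc r t, f ω ∂N := by
  have h1 : ∀ r, ∫ ω in τ ⁻¹' Ioc r t, f ω ∂N =
      ∫ ω, {q : ℝ≥0 × Ω | q.1 < τ q.2 ∧ τ q.2 ≤ t}.indicator (fun q => f q.2) (r, ω) ∂N := by
    intro r
    rw [← integral_indicator (hτ measurableSet_Ioc)]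
    rfl
  simp only [h1]
  have hτ' : Measurable fun q : ℝ≥0 × Ω => τ q.2 := hτ.comp measurable_snd
  have hm : MeasurableSet {q : ℝ≥0 × Ω | q.1 < τ q.2 ∧ τ q.2 ≤ t} :=
    (measurableSet_lt measurable_fst hτ').inter (hτ' measurableSet_Iic)
  exact ((hf.comp measurable_snd).indicator hm).stronglyMeasurable.integral_prod_right'.measurable

/-- Picard iteration: an equation with a Lipschitz field has a bounded solution. -/
theorem IsLipschitzField.exists_solvesBackward (hγ : IsLipschitzField γ L) (hτ : Measurable τ)
    (t : ℝ≥0) (lam : ℝ) :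
    ∃ u : ℝ≥0 → ℝ, Measurable u ∧ (∃ B, ∀ r, |u r| ≤ B) ∧ SolvesBackward N τ γ t lam u := by
  obtain ⟨w, K, hw, h1, hK, hwint⟩ := exists_weight (N.map τ) t hγ.nonneg
  have hwpos : ∀ x, 0 < w x := fun x => one_pos.trans_le (h1 x)
  have hwint' : ∀ r, L * ∫ ω in τ ⁻¹' Ioc r t, w (τ ω) ∂N ≤ w r / 2 := fun r => by
    rw [← setIntegral_map measurableSet_Ioc hw.aestronglyMeasurable hτ.aemeasurable]
    exact hwint r
  have hwi : Integrable (fun ω => w (τ ω)) N :=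
    Integrable.of_bound (hw.comp hτ).aestronglyMeasurable K
    (Eventually.of_forall fun x => by rw [Real.norm_eq_abs, abs_of_pos (hwpos _)]; exact hK _)
  let T : (ℝ≥0 → ℝ) → ℝ≥0 → ℝ := fun u r => lam + ∫ ω in τ ⁻¹' Ioc r t, γ (u (τ ω)) ω ∂N
  have hTm : ∀ u, Measurable u → Measurable (T u) := fun u hu =>
    (measurable_setIntegral_preimage_Ioc hτ t (hγ.measurable_comp hτ hu)).const_add lam
  have hTb : ∀ u B, (∀ r, |u r| ≤ B) → ∀ r, |T u r| ≤ |lam| + L * B * N.real univ := by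
    intro u B hB r
    refine (abs_add_le _ _).trans (add_le_add le_rfl ?_)
    have hLB : 0 ≤ L * B := mul_nonneg hγ.nonneg ((abs_nonneg _).trans (hB 0))
    calc |∫ ω in τ ⁻¹' Ioc r t, γ (u (τ ω)) ω ∂N| ≤ L * B * N.real (τ ⁻¹' Ioc r t) :=
          abs_setIntegral_le fun ω _ =>
            (hγ.abs_le _ _).trans (mul_le_mul_of_nonneg_left (hB _) hγ.nonneg)
      _ ≤ L * B * N.real univ := mul_le_mul_of_nonneg_left (measureReal_mono (subset_univ _)) hLB
  let v : ℕ → ℝ≥0 → ℝ := fun k => T^[k] fun _ => lam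
  have hvs : ∀ k, v (k + 1) = T (v k) := fun k => Function.iterate_succ_apply' T k _
  have hvm : ∀ k, Measurable (v k) := fun k => by
    induction k with
    | zero => exact measurable_const
    | succ k ih => rw [hvs]; exact hTm _ ih
  have hvb : ∀ k, ∃ B, ∀ r, |v k r| ≤ B := fun k => by
    induction k with
    | zero => exact ⟨|lam|, fun r => le_rfl⟩
    | succ k ih =>
      obtain ⟨B, hB⟩ := ih
      rw [hvs]
      exact ⟨_, hTb _ B hB⟩
  have hvi : ∀ k, Integrable (fun ω => γ (v k (τ ω)) ω) N := fun k => by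
    obtain ⟨B, hB⟩ := hvb k
    exact hγ.integrable_comp hτ (hvm k) hB
  obtain ⟨C, hC0, hC⟩ : ∃ C, 0 ≤ C ∧ ∀ r, |v 1 r - v 0 r| ≤ C := by
    obtain ⟨B, hB⟩ := hvb 1
    refine ⟨B + |lam|, add_nonneg ((abs_nonneg _).trans (hB 0)) (abs_nonneg _), fun r => ?_⟩
    exact (abs_sub _ _).trans (add_le_add (hB r) le_rfl)
  have hdiff : ∀ k r, |v (k + 1) r - v k r| ≤ C * (1 / 2) ^ k * w r := by
    intro k
    induction k with
    | zero => exact fun r => (hC r).trans (by simpa using le_mul_of_one_le_right hC0 (h1 r))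
    | succ k ih =>
      intro r
      have e1 : v (k + 1 + 1) r - v (k + 1) r =
          ∫ ω in τ ⁻¹' Ioc r t, (γ (v (k + 1) (τ ω)) ω - γ (v k (τ ω)) ω) ∂N := by
        rw [integral_sub (hvi _).integrableOn (hvi _).integrableOn, hvs (k + 1), hvs k]
        simp only [T]
        ring
      rw [e1]
      calc |∫ ω in τ ⁻¹' Ioc r t, (γ (v (k + 1) (τ ω)) ω - γ (v k (τ ω)) ω) ∂N|
          ≤ ∫ ω in τ ⁻¹' Ioc r t, L * (C * (1 / 2) ^ k * w (τ ω)) ∂N := by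
            rw [← Real.norm_eq_abs]
            refine norm_integral_le_of_norm_le ((hwi.const_mul _).const_mul _).integrableOn
              (Eventually.of_forall fun ω => ?_)
            exact (hγ.lipschitz _ _ _).trans (mul_le_mul_of_nonneg_left (ih _) hγ.nonneg)
        _ = C * (1 / 2) ^ k * (L * ∫ ω in τ ⁻¹' Ioc r t, w (τ ω) ∂N) := by
            rw [integral_const_mul, integral_const_mul]; ring
        _ ≤ C * (1 / 2) ^ k * (w r / 2) := by
            have := hwint' r
            gcongr
        _ = C * (1 / 2) ^ (k + 1) * w r := by ring
  have hdist : ∀ r k, dist (v k r) (v (k + 1) r) ≤ C * K * (1 / 2) ^ k := fun r k => by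
    rw [dist_comm, Real.dist_eq]
    calc _ ≤ C * (1 / 2) ^ k * w r := hdiff k r
      _ ≤ C * (1 / 2) ^ k * K := by have := hK r; gcongr
      _ = _ := by ring
  have hlim : ∀ r, ∃ l, Tendsto (fun k => v k r) atTop (𝓝 l) := fun r =>
    cauchySeq_tendsto_of_complete
      (cauchySeq_of_le_geometric (1 / 2) (C * K) (by norm_num) (hdist r))
  choose u hu using hlim
  have hum : Measurable u := measurable_of_tendsto_metrizable hvm (tendsto_pi_nhds.2 hu)
  have hdist2 : ∀ r k, |v k r - u r| ≤ C * K * 2 := fun r k => by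
    have h2 := dist_le_of_le_geometric_of_tendsto (1 / 2) (C * K) (by norm_num) (hdist r) (hu r) k
    rw [Real.dist_eq] at h2
    refine h2.trans ?_
    have hCK : 0 ≤ C * K := mul_nonneg hC0 (zero_le_one.trans ((h1 0).trans (hK 0)))
    have hp : (1 / 2 : ℝ) ^ k ≤ 1 := pow_le_one₀ (by norm_num) (by norm_num)
    have := mul_le_mul_of_nonneg_left hp hCK
    norm_num at this ⊢
    linarith
  have hub : ∀ r, |u r| ≤ |lam| + C * K * 2 := fun r => by
    have h2 := hdist2 r 0
    have h3 : v 0 r = lam := rfl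
    rw [h3] at h2
    have h4 : |u r| = |lam - (lam - u r)| := by ring_nf
    rw [h4]
    exact (abs_sub _ _).trans (add_le_add le_rfl h2)
  have hvb' : ∀ k r, |v k r| ≤ |lam| + C * K * 2 + C * K * 2 := fun k r => by
    have h4 : |v k r| = |u r + (v k r - u r)| := by ring_nf
    rw [h4]
    exact (abs_add_le _ _).trans (add_le_add (hub r) (hdist2 r k))
  refine ⟨u, hum, ⟨_, hub⟩, fun r _ => ?_⟩
  refine tendsto_nhds_unique ((hu r).comp (tendsto_add_atTop_nat 1)) ?_
  have e1 : ((fun k => v k r) ∘ fun k => k + 1) =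
      fun k => lam + ∫ ω in τ ⁻¹' Ioc r t, γ (v k (τ ω)) ω ∂N := by
    ext k
    simp only [Function.comp_apply, hvs, T]
  rw [e1]
  refine tendsto_const_nhds.add ?_
  refine tendsto_integral_of_dominated_convergence
    (fun _ => L * (|lam| + C * K * 2 + C * K * 2))
    (fun k => (hvi k).aestronglyMeasurable.restrict) (integrable_const _)
    (fun k => Eventually.of_forall fun ω => ?_) (Eventually.of_forall fun ω => ?_)
  · exact (hγ.abs_le _ _).trans (mul_le_mul_of_nonneg_left (hvb' _ _) hγ.nonneg)
  · rw [tendsto_iff_dist_tendsto_zero]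
    have h2 : Tendsto (fun k => L * dist (v k (τ ω)) (u (τ ω))) atTop (𝓝 0) := by
      simpa using (tendsto_iff_dist_tendsto_zero.1 (hu (τ ω))).const_mul L
    exact squeeze_zero (fun _ => dist_nonneg) (fun k => hγ.lipschitz _ _ _) h2

theorem IsLipschitzField.abs_eulerStep_sub_le (hγ : IsLipschitzField γ L) (A : Set ℝ≥0) (x y : ℝ) :
    |eulerStep N τ γ A x - eulerStep N τ γ A y| ≤ (1 + L * N.real (τ ⁻¹' A)) * |x - y| := by
  have e1 : eulerStep N τ γ A x - eulerStep N τ γ A y =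
      (x - y) + ∫ ω in τ ⁻¹' A, (γ x ω - γ y ω) ∂N := by
    rw [integral_sub (hγ.integrable_const_state x).integrableOn
      (hγ.integrable_const_state y).integrableOn, eulerStep, eulerStep]
    ring
  rw [e1]
  refine (abs_add_le _ _).trans ?_
  have e2 : |∫ ω in τ ⁻¹' A, (γ x ω - γ y ω) ∂N| ≤ L * |x - y| * N.real (τ ⁻¹' A) :=
    abs_setIntegral_le fun ω _ => hγ.lipschitz _ _ _
  linarith

/-- The local error of one backward Euler step from `s` to `r`: an exact jump at `s`, followed by
a frozen step over `(r, s)`. -/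
theorem IsLipschitzField.abs_eulerStep_eulerStep_sub_le (hγ : IsLipschitzField γ L)
    (hτ : Measurable τ) {t : ℝ≥0} {lam : ℝ} {u : ℝ≥0 → ℝ} (hu : SolvesBackward N τ γ t lam u)
    (hum : Measurable u) {B : ℝ} (hB : ∀ r, |u r| ≤ B) {r s : ℝ≥0} (hrs : r < s) (hst : s ≤ t)
    (x : ℝ) :
    |eulerStep N τ γ (Ioo r s) (eulerStep N τ γ {s} x) - u r| ≤
      (1 + L * N.real (τ ⁻¹' Ioo r s)) * ((1 + L * N.real (τ ⁻¹' {s})) * |x - u s|) +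
        L * N.real (τ ⁻¹' Ioo r s) * (L * B * N.real (τ ⁻¹' Ioo r s)) := by
  set a := N.real (τ ⁻¹' Ioo r s) with ha
  have ha0 : 0 ≤ a := measureReal_nonneg
  have hL := hγ.nonneg
  have hB0 : 0 ≤ B := (abs_nonneg _).trans (hB 0)
  set p := eulerStep N τ γ {s} (u s) with hp
  have hint := hγ.integrable_comp (N := N) hτ hum hB
  have hloc : ∀ q, r ≤ q → q < s → u q - p = ∫ ω in τ ⁻¹' Ioo q s, γ (u (τ ω)) ω ∂N :=
    fun q _ hqs => by
      rw [hu.eq_eulerStep_add hτ hqs hst hint.integrableOn]; ring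
  have hloc' : ∀ q, r ≤ q → q < s → |u q - p| ≤ L * B * a := fun q hrq hqs => by
    rw [hloc q hrq hqs]
    calc |∫ ω in τ ⁻¹' Ioo q s, γ (u (τ ω)) ω ∂N| ≤ L * B * N.real (τ ⁻¹' Ioo q s) :=
          abs_setIntegral_le fun ω _ =>
            (hγ.abs_le _ _).trans (mul_le_mul_of_nonneg_left (hB _) hL)
      _ ≤ L * B * a := mul_le_mul_of_nonneg_left
          (measureReal_mono (preimage_mono (Ioo_subset_Ioo_left hrq))) (by positivity)
  have e1 : |eulerStep N τ γ (Ioo r s) p - u r| ≤ L * a * (L * B * a) := by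
    have e2 : eulerStep N τ γ (Ioo r s) p - u r =
        ∫ ω in τ ⁻¹' Ioo r s, (γ p ω - γ (u (τ ω)) ω) ∂N := by
      rw [integral_sub (hγ.integrable_const_state p).integrableOn hint.integrableOn,
        ← hloc r le_rfl hrs, eulerStep]
      ring
    rw [e2]
    calc |∫ ω in τ ⁻¹' Ioo r s, (γ p ω - γ (u (τ ω)) ω) ∂N| ≤ L * (L * B * a) * a := by
          refine abs_setIntegral_le fun ω hω => ?_
          refine (hγ.lipschitz _ _ _).trans (mul_le_mul_of_nonneg_left ?_ hL)
          rw [abs_sub_comm]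
          exact hloc' _ hω.1.le hω.2
      _ = _ := by ring
  have e3 : |eulerStep N τ γ (Ioo r s) (eulerStep N τ γ {s} x) - eulerStep N τ γ (Ioo r s) p| ≤
      (1 + L * a) * ((1 + L * N.real (τ ⁻¹' {s})) * |x - u s|) :=
    (hγ.abs_eulerStep_sub_le _ _ _).trans
      (mul_le_mul_of_nonneg_left (hγ.abs_eulerStep_sub_le _ _ _) (by positivity))
  calc _ = |(eulerStep N τ γ (Ioo r s) (eulerStep N τ γ {s} x) - eulerStep N τ γ (Ioo r s) p) +
        (eulerStep N τ γ (Ioo r s) p - u r)| := by ring_nf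
    _ ≤ _ := (abs_add_le _ _).trans (add_le_add e3 e1)

/-- Convergence of the backward Euler scheme, as an induction principle: a sequentially closed
property of (families of) states that holds for the terminal states and is preserved by the jumps
and by all sufficiently short Euler steps holds for the solutions at every time. -/
theorem eulerStep_induction {I : Type*} {γ : I → ℝ → Ω → ℝ} {L lam : I → ℝ} {u : I → ℝ≥0 → ℝ}
    {t : ℝ≥0} (hτ : Measurable τ) (hγ : ∀ i, IsLipschitzField (γ i) (L i))
    (hum : ∀ i, Measurable (u i)) (hub : ∀ i, ∃ B, ∀ r, |u i r| ≤ B)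
    (hu : ∀ i, SolvesBackward N τ (γ i) t (lam i) (u i)) {Good : (I → ℝ) → Prop}
    (terminal : Good lam)
    (jump : ∀ s ≤ t, 0 < s → ∀ x, Good x → Good fun i => eulerStep N τ (γ i) {s} (x i))
    (short : ∃ δ > 0, ∀ r s, r < s → s ≤ t → N.real (τ ⁻¹' Ioo r s) ≤ δ →
      ∀ x, Good x → Good fun i => eulerStep N τ (γ i) (Ioo r s) (x i))
    (closed : ∀ (x : ℕ → I → ℝ) y, (∀ n, Good (x n)) →
      (∀ i, Tendsto (fun n => x n i) atTop (𝓝 (y i))) → Good y) :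
    ∀ r ≤ t, Good fun i => u i r := by
  obtain ⟨δ, hδ, short⟩ := short
  choose B hB using hub
  have hη : ∀ A, MeasurableSet A → (N.map τ).real A = N.real (τ ⁻¹' A) := fun A hA =>
    map_measureReal_apply hτ hA
  have key : ∀ ε > 0, ∀ r ≤ t, ∃ x, Good x ∧ ∀ i, |x i - u i r| ≤
      L i * B i * ε * (L i * N.real (τ ⁻¹' Ioc r t) * Real.exp (L i * N.real (τ ⁻¹' Ioc r t))) := by
    intro ε hε
    refine backward_induction (N.map τ) (ε := min δ ε) (lt_min hδ hε) ?_ ?_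
    · refine ⟨lam, terminal, fun i => ?_⟩
      rw [(hu i).terminal]
      simp
    · rintro r s hrs hst ⟨x, hx, hxu⟩ hsmall
      rw [hη _ measurableSet_Ioo] at hsmall
      have hs0 : 0 < s := zero_le.trans_lt hrs
      refine ⟨_, short r s hrs hst (hsmall.trans (min_le_left _ _)) _ (jump s hst hs0 x hx),
        fun i => ?_⟩
      refine ((hγ i).abs_eulerStep_eulerStep_sub_le hτ (hu i) (hum i) (hB i) hrs hst _).trans ?_
      have hL := (hγ i).nonneg
      have hB0 : 0 ≤ B i := (abs_nonneg _).trans (hB i 0)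
      have hsplit : N.real (τ ⁻¹' Ioc r t) =
          N.real (τ ⁻¹' Ioo r s) + N.real (τ ⁻¹' {s}) + N.real (τ ⁻¹' Ioc s t) := by
        have := setIntegral_preimage_Ioc (N := N) hτ (f := fun _ => (1 : ℝ)) hrs hst
          (integrable_const _).integrableOn
        simpa using this
      rw [hsplit]
      have hae : N.real (τ ⁻¹' Ioo r s) ≤ ε := hsmall.trans (min_le_right _ _)
      have ha0 : 0 ≤ N.real (τ ⁻¹' Ioo r s) := measureReal_nonneg
      have hb0 : 0 ≤ N.real (τ ⁻¹' {s}) := measureReal_nonneg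
      have hh0 : 0 ≤ N.real (τ ⁻¹' Ioc s t) := measureReal_nonneg
      have hxu' := hxu i
      generalize N.real (τ ⁻¹' Ioo r s) = a at *
      generalize N.real (τ ⁻¹' {s}) = b at *
      generalize N.real (τ ⁻¹' Ioc s t) = h at *
      generalize L i = L at *
      generalize B i = B at *
      have hea : 1 + L * a ≤ Real.exp (L * a) := by linarith [Real.add_one_le_exp (L * a)]
      have heb : 1 + L * b ≤ Real.exp (L * b) := by linarith [Real.add_one_le_exp (L * b)]
      have hexp : Real.exp (L * (a + b + h)) =
          Real.exp (L * a) * (Real.exp (L * b) * Real.exp (L * h)) := by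
        rw [← Real.exp_add, ← Real.exp_add]; ring_nf
      have hexp1 : 1 ≤ Real.exp (L * (a + b + h)) := Real.one_le_exp (by positivity)
      calc (1 + L * a) * ((1 + L * b) * |x i - u i s|) + L * a * (L * B * a)
          ≤ Real.exp (L * a) * (Real.exp (L * b) *
              (L * B * ε * (L * h * Real.exp (L * h)))) +
              L * a * (L * B * ε) * Real.exp (L * (a + b + h)) := by
            have e1 : L * a * (L * B * a) ≤ L * a * (L * B * ε) := by gcongr
            have e2 : L * a * (L * B * ε) * 1 ≤
                L * a * (L * B * ε) * Real.exp (L * (a + b + h)) := by gcongr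
            rw [mul_one] at e2
            refine add_le_add ?_ (e1.trans e2)
            gcongr
        _ = L * B * ε * (L * (a + h) * Real.exp (L * (a + b + h))) := by rw [hexp]; ring
        _ ≤ _ := by gcongr; linarith
  intro r hr
  choose x hx hxu using fun n : ℕ => key (1 / ((n : ℝ) + 1)) (by positivity) r hr
  refine closed x _ hx fun i => ?_
  rw [tendsto_iff_dist_tendsto_zero]
  refine squeeze_zero (fun _ => dist_nonneg) (fun n => hxu n i) ?_
  have h1 := ((tendsto_one_div_add_atTop_nhds_zero_nat (𝕜 := ℝ)).const_mul (L i * B i)).mul_const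
    (L i * N.real (τ ⁻¹' Ioc r t) * Real.exp (L i * N.real (τ ⁻¹' Ioc r t)))
  simpa using h1

end Backward

/-! ### Fields generated by a drift and jumps of bounded rate and size -/

/-- The field `-β x + κ (1 - e^{-x ζ})`, constant in the exponential for negative states. -/
noncomputable def jumpField {Ω : Type*} (β κ ζ : Ω → ℝ) (x : ℝ) (ω : Ω) : ℝ :=
  -β ω * x + κ ω * (1 - Real.exp (-(max x 0) * ζ ω))

/-- Bounded measurable coefficients `β`, `κ ≥ 0`, `ζ ≥ 0` for a `jumpField`. -/
structure IsJumpData {Ω : Type*} [MeasurableSpace Ω] (β κ ζ : Ω → ℝ) (C : ℝ) : Prop where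
  measurable_drift : Measurable β
  measurable_rate : Measurable κ
  measurable_size : Measurable ζ
  abs_drift_le : ∀ ω, |β ω| ≤ C
  rate_nonneg : ∀ ω, 0 ≤ κ ω
  rate_le : ∀ ω, κ ω ≤ C
  size_nonneg : ∀ ω, 0 ≤ ζ ω
  size_le : ∀ ω, ζ ω ≤ C

theorem abs_exp_neg_sub_exp_neg_le {x y : ℝ} (hx : 0 ≤ x) (hy : 0 ≤ y) :
    |Real.exp (-x) - Real.exp (-y)| ≤ |x - y| := by
  wlog hxy : x ≤ y generalizing x y
  · rw [abs_sub_comm, abs_sub_comm x]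
    exact this hy hx (le_of_not_ge hxy)
  have h1 : Real.exp (-y) = Real.exp (-x) * Real.exp (-(y - x)) := by
    rw [← Real.exp_add]; ring_nf
  have h2 : 1 - (y - x) ≤ Real.exp (-(y - x)) := by linarith [Real.add_one_le_exp (-(y - x))]
  have h3 : Real.exp (-x) ≤ 1 := Real.exp_le_one_iff.2 (by linarith)
  have h4 : Real.exp (-y) ≤ Real.exp (-x) := Real.exp_le_exp.2 (by linarith)
  rw [abs_of_nonneg (by linarith), abs_sub_comm, abs_of_nonneg (by linarith), h1]
  nlinarith [Real.exp_pos (-x)]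

namespace IsJumpData

variable {Ω : Type*} [MeasurableSpace Ω] {N : Measure Ω} [IsFiniteMeasure N] {τ : Ω → ℝ≥0}
  {β κ ζ : Ω → ℝ} {C : ℝ}

theorem isLipschitzField (h : IsJumpData β κ ζ C) (hC : 0 ≤ C) :
    IsLipschitzField (jumpField β κ ζ) (C + C * C) where
  measurable := by
    have h1 := h.measurable_drift
    have h2 := h.measurable_rate
    have h3 := h.measurable_size
    unfold jumpField
    fun_prop
  nonneg := by positivity
  zero ω := by simp [jumpField]
  lipschitz x y ω := by
    have e1 : jumpField β κ ζ x ω - jumpField β κ ζ y ω = -β ω * (x - y) +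
        κ ω * (Real.exp (-(max y 0 * ζ ω)) - Real.exp (-(max x 0 * ζ ω))) := by
      simp only [jumpField, neg_mul]; ring
    have hζ := h.size_nonneg ω
    have e2 : |Real.exp (-(max y 0 * ζ ω)) - Real.exp (-(max x 0 * ζ ω))| ≤ C * |x - y| := by
      refine (abs_exp_neg_sub_exp_neg_le (by positivity) (by positivity)).trans ?_
      rw [← sub_mul, abs_mul, abs_of_nonneg hζ, mul_comm, abs_sub_comm]
      have := abs_max_sub_max_le_abs x y 0
      have := h.size_le ω
      gcongr
    rw [e1]
    refine (abs_add_le _ _).trans ?_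
    rw [abs_mul, abs_mul, abs_neg, abs_of_nonneg (h.rate_nonneg ω), add_mul]
    have h1 := h.abs_drift_le ω
    have h2 := h.rate_le ω
    refine add_le_add (by gcongr) ?_
    rw [mul_assoc]
    gcongr

theorem integrable_drift (h : IsJumpData β κ ζ C) : Integrable β N :=
  Integrable.of_bound h.measurable_drift.aestronglyMeasurable C
    (Eventually.of_forall h.abs_drift_le)

theorem integrable_rate_mul (h : IsJumpData β κ ζ C) {x : ℝ} (hx : 0 ≤ x) :
    Integrable (fun ω => κ ω * (1 - Real.exp (-x * ζ ω))) N := by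
  have h2 := h.measurable_rate
  have h3 := h.measurable_size
  refine Integrable.of_bound (by fun_prop) C (Eventually.of_forall fun ω => ?_)
  have h4 : 0 ≤ x * ζ ω := mul_nonneg hx (h.size_nonneg ω)
  have h5 : Real.exp (-x * ζ ω) ≤ 1 := Real.exp_le_one_iff.2 (by linarith)
  have h6 := Real.exp_pos (-x * ζ ω)
  have h7 := h.rate_nonneg ω
  have h8 := h.rate_le ω
  rw [Real.norm_eq_abs, abs_of_nonneg (mul_nonneg h7 (by linarith))]
  nlinarith

theorem eulerStep_eq (h : IsJumpData β κ ζ C) (A : Set ℝ≥0) {x : ℝ} (hx : 0 ≤ x) :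
    eulerStep N τ (jumpField β κ ζ) A x = (1 - ∫ ω in τ ⁻¹' A, β ω ∂N) * x +
      ∫ ω in τ ⁻¹' A, κ ω * (1 - Real.exp (-x * ζ ω)) ∂N := by
  simp only [eulerStep, jumpField, max_eq_left hx]
  have hi : Integrable (fun ω => -β ω * x) N := h.integrable_drift.neg.mul_const x
  rw [integral_add hi.integrableOn
    (h.integrable_rate_mul hx).integrableOn, integral_mul_const, integral_neg]
  ring

theorem eulerStep_nonneg (h : IsJumpData β κ ζ C) {A : Set ℝ≥0}
    (hA : ∫ ω in τ ⁻¹' A, β ω ∂N ≤ 1) {x : ℝ} (hx : 0 ≤ x) :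
    0 ≤ eulerStep N τ (jumpField β κ ζ) A x := by
  rw [h.eulerStep_eq A hx]
  refine add_nonneg (mul_nonneg (by linarith) hx) (integral_nonneg fun ω => ?_)
  have h4 : 0 ≤ x * ζ ω := mul_nonneg hx (h.size_nonneg ω)
  exact mul_nonneg (h.rate_nonneg ω) (sub_nonneg.2 (Real.exp_le_one_iff.2 (by linarith)))

theorem eulerStep_mono (h : IsJumpData β κ ζ C) {A : Set ℝ≥0}
    (hA : ∫ ω in τ ⁻¹' A, β ω ∂N ≤ 1) {x y : ℝ} (hx : 0 ≤ x) (hxy : x ≤ y) :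
    eulerStep N τ (jumpField β κ ζ) A x ≤ eulerStep N τ (jumpField β κ ζ) A y := by
  rw [h.eulerStep_eq A hx, h.eulerStep_eq A (hx.trans hxy)]
  refine add_le_add (mul_le_mul_of_nonneg_left hxy (by linarith)) ?_
  refine integral_mono (h.integrable_rate_mul hx).integrableOn
    (h.integrable_rate_mul (hx.trans hxy)).integrableOn fun ω => ?_
  refine mul_le_mul_of_nonneg_left (sub_le_sub_left (Real.exp_le_exp.2 ?_) _) (h.rate_nonneg ω)
  exact mul_le_mul_of_nonneg_right (by linarith) (h.size_nonneg ω)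

theorem isBernstein_eulerStep (h : IsJumpData β κ ζ C) {A : Set ℝ≥0}
    (hA : ∫ ω in τ ⁻¹' A, β ω ∂N ≤ 1) {w : ℝ → ℝ} (hw : IsBernstein w) :
    IsBernstein fun lam => eulerStep N τ (jumpField β κ ζ) A (w lam) := by
  let d : Ω → ℝ≥0 := fun ω => (κ ω).toNNReal
  have hd : Measurable d := h.measurable_rate.real_toNNReal
  let ρ : Measure Ω := (N.restrict (τ ⁻¹' A)).withDensity fun ω => (d ω : ℝ≥0∞)
  have hρ : IsFiniteMeasure ρ := by
    refine isFiniteMeasure_withDensity ?_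
    refine ne_top_of_le_ne_top ?_ (lintegral_mono (g := fun _ => ENNReal.ofReal C) fun ω => ?_)
    · rw [lintegral_const]
      exact ENNReal.mul_ne_top ENNReal.ofReal_ne_top (measure_ne_top _ _)
    · exact ENNReal.ofReal_le_ofReal (h.rate_le ω)
  refine ((hw.const_mul (a := 1 - ∫ ω in τ ⁻¹' A, β ω ∂N) (by linarith)).add
    (hw.integral_one_sub_exp ρ h.measurable_size h.size_nonneg)).congr fun lam hlam => ?_
  rw [h.eulerStep_eq A (hw.nonneg hlam)]
  congr 1
  rw [integral_withDensity_eq_integral_smul hd]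
  refine integral_congr_ae (Eventually.of_forall fun ω => ?_)
  simp only [NNReal.smul_def, smul_eq_mul, d]
  rw [Real.coe_toNNReal _ (h.rate_nonneg ω)]

theorem setIntegral_drift_le_one (h : IsJumpData β κ ζ C) (hC : 0 ≤ C) {A : Set ℝ≥0}
    (hA : N.real (τ ⁻¹' A) ≤ 1 / (C + 1)) : ∫ ω in τ ⁻¹' A, β ω ∂N ≤ 1 := by
  have h1 := abs_setIntegral_le (N := N) (A := τ ⁻¹' A) fun ω _ => h.abs_drift_le ω
  rw [le_div_iff₀ (by positivity)] at hA
  have h2 : 0 ≤ N.real (τ ⁻¹' A) := measureReal_nonneg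
  have := le_abs_self (∫ ω in τ ⁻¹' A, β ω ∂N)
  linarith

/-- If no atom of the drift exceeds `1`, the solutions are Bernstein functions of the terminal
state. -/
theorem isBernstein_of_solvesBackward (h : IsJumpData β κ ζ C) (hC : 0 ≤ C) (hτ : Measurable τ)
    {t : ℝ≥0} (hjump : ∀ s ≤ t, 0 < s → ∫ ω in τ ⁻¹' {s}, β ω ∂N ≤ 1) {u : ℝ → ℝ≥0 → ℝ}
    (hum : ∀ lam, Measurable (u lam)) (hub : ∀ lam, ∃ B, ∀ r, |u lam r| ≤ B)
    (hu : ∀ lam, SolvesBackward N τ (jumpField β κ ζ) t lam (u lam)) :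
    ∀ r ≤ t, IsBernstein fun lam => u lam r :=
  eulerStep_induction (Good := IsBernstein) (lam := fun lam => lam) hτ
    (fun _ => h.isLipschitzField hC) hum hub hu IsBernstein.identity
    (fun s hst hs _ hx => h.isBernstein_eulerStep (hjump s hst hs) hx)
    ⟨1 / (C + 1), by positivity, fun _ _ _ _ hsmall _ hx =>
      h.isBernstein_eulerStep (h.setIntegral_drift_le_one hC hsmall) hx⟩
    fun _ _ hx hlim => IsBernstein.of_tendsto hx fun lam _ => hlim lam

/-- Comparison of the solutions for two ordered fields. -/
theorem solution_mono (h : IsJumpData β κ ζ C) (hC : 0 ≤ C) {β' κ' ζ' : Ω → ℝ} {C' : ℝ}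
    (h' : IsJumpData β' κ' ζ' C') (hC' : 0 ≤ C') (hτ : Measurable τ) {t : ℝ≥0}
    (hjump : ∀ s ≤ t, 0 < s → ∫ ω in τ ⁻¹' {s}, β ω ∂N ≤ 1)
    (hjump' : ∀ s ≤ t, 0 < s → ∫ ω in τ ⁻¹' {s}, β' ω ∂N ≤ 1)
    (hle : ∀ x, 0 ≤ x → ∀ ω, jumpField β κ ζ x ω ≤ jumpField β' κ' ζ' x ω)
    {lam : ℝ} (hlam : 0 ≤ lam) {u u' : ℝ≥0 → ℝ}
    (hum : Measurable u) (hub : ∃ B, ∀ r, |u r| ≤ B)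
    (hu : SolvesBackward N τ (jumpField β κ ζ) t lam u)
    (hum' : Measurable u') (hub' : ∃ B, ∀ r, |u' r| ≤ B)
    (hu' : SolvesBackward N τ (jumpField β' κ' ζ') t lam u') :
    ∀ r ≤ t, 0 ≤ u r ∧ u r ≤ u' r := by
  let γ : Bool → ℝ → Ω → ℝ := fun i => cond i (jumpField β' κ' ζ') (jumpField β κ ζ)
  have hstep : ∀ A, ∫ ω in τ ⁻¹' A, β ω ∂N ≤ 1 → ∫ ω in τ ⁻¹' A, β' ω ∂N ≤ 1 →
      ∀ x : Bool → ℝ, (0 ≤ x false ∧ x false ≤ x true) →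
      (0 ≤ eulerStep N τ (γ false) A (x false) ∧
        eulerStep N τ (γ false) A (x false) ≤ eulerStep N τ (γ true) A (x true)) := by
    rintro A hA hA' x ⟨h0, h1⟩
    refine ⟨h.eulerStep_nonneg hA h0, ?_⟩
    refine le_trans ?_ (h'.eulerStep_mono hA' h0 h1)
    refine add_le_add le_rfl (integral_mono ?_ ?_ fun ω => hle _ h0 ω)
    · exact ((h.isLipschitzField hC).integrable_const_state _).integrableOn
    · exact ((h'.isLipschitzField hC').integrable_const_state _).integrableOn
  refine eulerStep_induction (N := N) (I := Bool) (γ := γ) (lam := fun _ => lam)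
    (L := fun i => cond i (C' + C' * C') (C + C * C))
    (u := fun i => cond i u' u) (Good := fun x => 0 ≤ x false ∧ x false ≤ x true) hτ ?_ ?_ ?_ ?_
    ⟨hlam, le_rfl⟩ (fun s hst hs x hx => hstep _ (hjump s hst hs) (hjump' s hst hs) x hx)
    ⟨min (1 / (C + 1)) (1 / (C' + 1)), lt_min (by positivity) (by positivity),
      fun r s _ _ hsmall x hx => hstep _
        (h.setIntegral_drift_le_one hC (hsmall.trans (min_le_left _ _)))
        (h'.setIntegral_drift_le_one hC' (hsmall.trans (min_le_right _ _))) x hx⟩ ?_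
  · rintro (_ | _)
    exacts [h.isLipschitzField hC, h'.isLipschitzField hC']
  · rintro (_ | _)
    exacts [hum, hum']
  · rintro (_ | _)
    exacts [hub, hub']
  · rintro (_ | _)
    exacts [hu, hu']
  · exact fun x y hx hlim => ⟨ge_of_tendsto' (hlim false) fun n => (hx n).1,
      le_of_tendsto_of_tendsto' (hlim false) (hlim true) fun n => (hx n).2⟩

end IsJumpData

/-! ### The branching field and its truncations -/

/-- The remainder `e^{-y} - 1 + y`. -/
noncomputable def expRemainder (y : ℝ) : ℝ := Real.exp (-y) - 1 + y

theorem expRemainder_nonneg (y : ℝ) : 0 ≤ expRemainder y := by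
  have := Real.add_one_le_exp (-y)
  unfold expRemainder; linarith

theorem expRemainder_le_sq {y : ℝ} (hy : 0 ≤ y) : expRemainder y ≤ y ^ 2 := by
  unfold expRemainder
  rcases le_total y 1 with h | h
  · have h1 := Real.abs_exp_sub_one_sub_id_le (x := -y) (by rwa [abs_neg, abs_of_nonneg hy])
    have h2 := le_abs_self (Real.exp (-y) - 1 - -y)
    nlinarith
  · have h1 : Real.exp (-y) ≤ 1 := Real.exp_le_one_iff.2 (by linarith)
    nlinarith

theorem expRemainder_two_mul_le {y : ℝ} (hy : 0 ≤ y) :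
    expRemainder (2 * y) ≤ 4 * expRemainder y := by
  let f : ℝ → ℝ := fun y => 4 * expRemainder y - expRemainder (2 * y)
  have hderiv : ∀ y, HasDerivAt f (2 * (1 - Real.exp (-y)) ^ 2) y := by
    intro y
    have h1 : HasDerivAt (fun y : ℝ => Real.exp (-y)) (-Real.exp (-y)) y := by
      simpa using (hasDerivAt_neg y).exp
    have h2 : HasDerivAt (fun y : ℝ => Real.exp (-(2 * y))) (-2 * Real.exp (-(2 * y))) y := by
      have h3 : HasDerivAt (fun y : ℝ => -(2 * y)) (-2) y := by
        simpa using (hasDerivAt_id' y).const_mul (-2 : ℝ)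
      simpa [mul_comm] using h3.exp
    have h4 : HasDerivAt (fun y : ℝ => 4 * (Real.exp (-y) - 1 + y) -
        (Real.exp (-(2 * y)) - 1 + 2 * y)) (4 * (-Real.exp (-y) + 1) -
        (-2 * Real.exp (-(2 * y)) + 2 * 1)) y :=
      (((h1.sub_const 1).add (hasDerivAt_id y)).const_mul 4).sub
        ((h2.sub_const 1).add ((hasDerivAt_id y).const_mul 2))
    refine h4.congr_deriv ?_
    have : Real.exp (-(2 * y)) = Real.exp (-y) ^ 2 := by rw [← Real.exp_nat_mul]; ring_nf
    rw [this]; ring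
  have hmono : Monotone f := monotone_of_deriv_nonneg (fun y => (hderiv y).differentiableAt)
    fun y => by rw [(hderiv y).deriv]; positivity
  have h0 : f 0 = 0 := by simp [f, expRemainder]
  have := hmono hy
  rw [h0] at this
  simp only [f] at this
  linarith

theorem abs_expRemainder_sub_le {y : ℝ} (hy : |y| ≤ 1) :
    |expRemainder y - y ^ 2 / 2| ≤ |y| ^ 3 := by
  have h := Real.exp_bound (x := -y) (by rwa [abs_neg]) (n := 3) (by norm_num)
  have e : Real.exp (-y) - ∑ m ∈ Finset.range 3, (-y) ^ m / (m.factorial : ℝ) =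
      expRemainder y - y ^ 2 / 2 := by
    simp [Finset.sum_range_succ, expRemainder, Nat.factorial]; ring
  rw [e, abs_neg] at h
  refine h.trans (mul_le_of_le_one_right (by positivity) ?_)
  norm_num [Nat.factorial]

theorem continuous_expRemainder : Continuous expRemainder := by
  unfold expRemainder; fun_prop

/-- The field of the backward equation. The mark `(s, z)` with `z > 0` stands for a jump of size `z`
at time `s`, relative to the measure `(1 ∧ z²) m(ds, dz)`; the marks `(s, 0)`, `(s, -1)`, `(s, -2)`
carry the measures of `c` and of the two increasing parts of `b₁`. -/
noncomputable def branchingField (x : ℝ) (ω : ℝ≥0 × ℝ) : ℝ :=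
  if 1 < ω.2 then 1 - Real.exp (-x * ω.2)
  else if 0 < ω.2 then -(expRemainder (x * ω.2) / ω.2 ^ 2)
  else if ω.2 = 0 then -x ^ 2
  else if ω.2 = -1 then -x
  else if ω.2 = -2 then x
  else 0

/-- The branching field without the jumps of size larger than `k ≥ 1`. -/
noncomputable def truncatedField (k : ℕ) (x : ℝ) (ω : ℝ≥0 × ℝ) : ℝ :=
  if 1 < ω.2 ∧ (k : ℝ) < ω.2 then 0 else branchingField x ω

/-- Drift coefficient of the approximation at level `n`: the jumps of size at most `δ = 2^{-n}` are
removed and the diffusion is replaced by jumps of size `δ` at the rate `2 / δ²`, both compensated. -/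
noncomputable def driftCoeff (n : ℕ) (ω : ℝ≥0 × ℝ) : ℝ :=
  if 1 < ω.2 then 0
  else if 0 < ω.2 then if (1 / 2) ^ n < ω.2 then 1 / ω.2 else 0
  else if ω.2 = 0 then 2 * 2 ^ n
  else if ω.2 = -1 then 1
  else if ω.2 = -2 then -1
  else 0

/-- Jump rate of the approximation at level `n`, without the jumps larger than `k`. -/
noncomputable def rateCoeff (n k : ℕ) (ω : ℝ≥0 × ℝ) : ℝ :=
  if 1 < ω.2 then if ω.2 ≤ k then 1 else 0
  else if 0 < ω.2 then if (1 / 2) ^ n < ω.2 then 1 / ω.2 ^ 2 else 0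
  else if ω.2 = 0 then 2 * 4 ^ n
  else 0

/-- Jump size of the approximation at level `n`, without the jumps larger than `k`. -/
noncomputable def sizeCoeff (n k : ℕ) (ω : ℝ≥0 × ℝ) : ℝ :=
  if 1 < ω.2 then if ω.2 ≤ k then ω.2 else 0
  else if 0 < ω.2 then ω.2
  else if ω.2 = 0 then (1 / 2) ^ n
  else 0

/-- The Lipschitz approximation of the branching field with cutoffs `2^{-n}` and `k`. -/
noncomputable def approxField (n k : ℕ) : ℝ → ℝ≥0 × ℝ → ℝ :=
  jumpField (driftCoeff n) (rateCoeff n k) (sizeCoeff n k)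

theorem isJumpData_approx (n k : ℕ) :
    IsJumpData (driftCoeff n) (rateCoeff n k) (sizeCoeff n k) (2 * 4 ^ n + k) := by
  have h1 : ∀ {z : ℝ}, (1 / 2) ^ n < z → 1 / z ≤ 2 ^ n := fun {z} hz => by
    have : (0 : ℝ) < (1 / 2) ^ n := by positivity
    rw [div_le_iff₀ (this.trans hz)]
    calc (1 : ℝ) = 2 ^ n * (1 / 2) ^ n := by rw [← mul_pow]; norm_num
      _ ≤ _ := by gcongr
  have h24 : (2 : ℝ) ^ n ≤ 4 ^ n := pow_le_pow_left₀ (by norm_num) (by norm_num) n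
  have h14 : (1 : ℝ) ≤ 4 ^ n := one_le_pow₀ (by norm_num)
  have hk : (0 : ℝ) ≤ k := Nat.cast_nonneg k
  have hsets : ∀ a : ℝ, MeasurableSet {ω : ℝ≥0 × ℝ | a < ω.2} ∧
      MeasurableSet {ω : ℝ≥0 × ℝ | ω.2 ≤ a} ∧ MeasurableSet {ω : ℝ≥0 × ℝ | ω.2 = a} := fun a =>
    ⟨measurable_snd measurableSet_Ioi, measurable_snd measurableSet_Iic,
      measurable_snd (measurableSet_singleton a)⟩
  constructor
  · unfold driftCoeff
    refine Measurable.ite (hsets 1).1 measurable_const (Measurable.ite (hsets 0).1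
      (Measurable.ite (hsets _).1 (by fun_prop) measurable_const)
      (Measurable.ite (hsets 0).2.2 measurable_const (Measurable.ite (hsets (-1)).2.2
      measurable_const (Measurable.ite (hsets (-2)).2.2 measurable_const measurable_const))))
  · unfold rateCoeff
    refine Measurable.ite (hsets 1).1 (Measurable.ite (hsets k).2.1 measurable_const
      measurable_const) (Measurable.ite (hsets 0).1
      (Measurable.ite (hsets _).1 (by fun_prop) measurable_const)
      (Measurable.ite (hsets 0).2.2 measurable_const measurable_const))
  · unfold sizeCoeff
    refine Measurable.ite (hsets 1).1 (Measurable.ite (hsets k).2.1 measurable_snd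
      measurable_const) (Measurable.ite (hsets 0).1 measurable_snd
      (Measurable.ite (hsets 0).2.2 measurable_const measurable_const))
  · intro ω
    unfold driftCoeff
    split_ifs with a b c
    · rw [abs_zero]; positivity
    · rw [abs_of_nonneg (by positivity)]
      have := h1 c
      linarith
    · rw [abs_zero]; positivity
    · rw [abs_of_nonneg (by positivity)]; linarith
    · rw [abs_one]; linarith
    · rw [abs_neg, abs_one]; linarith
    · rw [abs_zero]; positivity
  · intro ω
    unfold rateCoeff
    split_ifs <;> positivity
  · intro ω
    unfold rateCoeff
    split_ifs with a b c d
    · linarith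
    · positivity
    · have h2 := h1 d
      have h3 : 1 / ω.2 ^ 2 = (1 / ω.2) ^ 2 := by rw [div_pow, one_pow]
      have h4 : ((2 : ℝ) ^ n) ^ 2 = 4 ^ n := by rw [← pow_mul, mul_comm, pow_mul]; norm_num
      have h5 : (1 / ω.2) ^ 2 ≤ ((2 : ℝ) ^ n) ^ 2 := pow_le_pow_left₀ (by positivity) h2 2
      rw [h3]; linarith
    · positivity
    · linarith
    · positivity
  · intro ω
    unfold sizeCoeff
    split_ifs <;> positivity
  · intro ω
    unfold sizeCoeff
    split_ifs with a b c
    · linarith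
    · positivity
    · linarith
    · have : ((1 : ℝ) / 2) ^ n ≤ 1 := pow_le_one₀ (by norm_num) (by norm_num)
      linarith
    · positivity

theorem approxField_eq (n k : ℕ) {x : ℝ} (hx : 0 ≤ x) (ω : ℝ≥0 × ℝ) :
    approxField n k x ω =
      if 1 < ω.2 then if ω.2 ≤ k then 1 - Real.exp (-x * ω.2) else 0
      else if 0 < ω.2 then if (1 / 2) ^ n < ω.2 then -(expRemainder (x * ω.2) / ω.2 ^ 2) else 0
      else if ω.2 = 0 then -(2 * 4 ^ n * expRemainder (x * (1 / 2) ^ n))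
      else if ω.2 = -1 then -x
      else if ω.2 = -2 then x
      else 0 := by
  have h24 : (4 : ℝ) ^ n * (1 / 2) ^ n = 2 ^ n := by rw [← mul_pow]; norm_num
  simp only [approxField, jumpField, driftCoeff, rateCoeff, sizeCoeff, max_eq_left hx,
    expRemainder]
  split_ifs with a b c d e
  · simp
  · simp
  · rw [neg_mul]
    field_simp
    ring
  · simp
  · rw [neg_mul x, ← h24]
    ring
  · simp
  · simp
  · simp

theorem approxField_succ_le (n k : ℕ) {x : ℝ} (hx : 0 ≤ x) (ω : ℝ≥0 × ℝ) :
    approxField (n + 1) k x ω ≤ approxField n k x ω := by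
  rw [approxField_eq _ _ hx, approxField_eq _ _ hx]
  have hhalf : ((1 : ℝ) / 2) ^ (n + 1) ≤ (1 / 2) ^ n :=
    pow_le_pow_of_le_one (by norm_num) (by norm_num) (Nat.le_succ n)
  have hE := expRemainder_nonneg (x * ω.2)
  split_ifs with a b c d e f
  · exact le_rfl
  · exact le_rfl
  · exact le_rfl
  · exact neg_nonpos.2 (by positivity)
  · linarith
  · exact le_rfl
  · have h1 := expRemainder_two_mul_le (y := x * (1 / 2) ^ (n + 1)) (by positivity)
    have h2 : 2 * (x * (1 / 2) ^ (n + 1)) = x * (1 / 2) ^ n := by rw [pow_succ]; ring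
    rw [h2] at h1
    have h4 : (0 : ℝ) < 4 ^ n := by positivity
    rw [pow_succ 4]
    nlinarith
  all_goals exact le_rfl

theorem approxField_le_succ (n k : ℕ) {x : ℝ} (hx : 0 ≤ x) (ω : ℝ≥0 × ℝ) :
    approxField n k x ω ≤ approxField n (k + 1) x ω := by
  rw [approxField_eq _ _ hx, approxField_eq _ _ hx]
  split_ifs with a b c
  · exact le_rfl
  · exact absurd (b.trans (by push_cast; linarith)) c
  · have : 0 ≤ x * ω.2 := by have := zero_lt_one.trans a; positivity
    exact sub_nonneg.2 (Real.exp_le_one_iff.2 (by linarith))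
  all_goals exact le_rfl

theorem expRemainder_div_sq_le {x z : ℝ} (hx : 0 ≤ x) (hz : 0 < z) :
    expRemainder (x * z) / z ^ 2 ≤ x ^ 2 := by
  rw [div_le_iff₀ (by positivity), ← mul_pow]
  exact expRemainder_le_sq (by positivity)

theorem abs_approxField_le (n k : ℕ) {x : ℝ} (hx : 0 ≤ x) (ω : ℝ≥0 × ℝ) :
    |approxField n k x ω| ≤ 1 + x + 2 * x ^ 2 := by
  rw [approxField_eq _ _ hx]
  split_ifs with a b c d e
  · have h1 : 0 ≤ x * ω.2 := by have := zero_lt_one.trans a; positivity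
    have h2 : Real.exp (-x * ω.2) ≤ 1 := Real.exp_le_one_iff.2 (by linarith)
    have h3 := Real.exp_pos (-x * ω.2)
    rw [abs_of_nonneg (by linarith)]
    nlinarith
  · rw [abs_zero]; positivity
  · rw [abs_neg, abs_of_nonneg (div_nonneg (expRemainder_nonneg _) (by positivity))]
    have := expRemainder_div_sq_le hx c
    nlinarith
  · rw [abs_zero]; positivity
  · rw [abs_neg, abs_of_nonneg (mul_nonneg (by positivity) (expRemainder_nonneg _))]
    have h1 := expRemainder_le_sq (y := x * (1 / 2) ^ n) (by positivity)
    have h2 : (4 : ℝ) ^ n * (x * (1 / 2) ^ n) ^ 2 = x ^ 2 := by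
      have : (4 : ℝ) ^ n * ((1 / 2) ^ n) ^ 2 = 1 := by
        rw [← pow_mul, mul_comm n 2, pow_mul, ← mul_pow]; norm_num
      rw [mul_pow]
      linear_combination x ^ 2 * this
    have h3 : (0 : ℝ) < 4 ^ n := by positivity
    nlinarith
  · rw [abs_neg, abs_of_nonneg hx]; nlinarith
  · rw [abs_of_nonneg hx]; nlinarith
  · rw [abs_zero]; positivity

theorem approxField_le (n k : ℕ) {x : ℝ} (hx : 0 ≤ x) (ω : ℝ≥0 × ℝ) :
    approxField n k x ω ≤ 1 + x := by
  rw [approxField_eq _ _ hx]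
  have := expRemainder_nonneg (x * ω.2)
  have h5 := expRemainder_nonneg (x * (1 / 2) ^ n)
  split_ifs with a b c d e
  · linarith [Real.exp_pos (-x * ω.2)]
  · linarith
  · exact le_trans (neg_nonpos.2 (by positivity)) (by linarith)
  · linarith
  · exact le_trans (neg_nonpos.2 (by positivity)) (by linarith)
  all_goals linarith

theorem continuous_branchingField (ω : ℝ≥0 × ℝ) : Continuous fun x => branchingField x ω := by
  unfold branchingField
  have := continuous_expRemainder
  split_ifs <;> fun_prop

theorem measurable_branchingField : Measurable fun q : ℝ × (ℝ≥0 × ℝ) => branchingField q.1 q.2 := by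
  have h1 : ∀ a : ℝ, MeasurableSet {q : ℝ × (ℝ≥0 × ℝ) | a < q.2.2} := fun a =>
    (measurable_snd.comp measurable_snd) measurableSet_Ioi
  have h2 : ∀ a : ℝ, MeasurableSet {q : ℝ × (ℝ≥0 × ℝ) | q.2.2 = a} := fun a =>
    (measurable_snd.comp measurable_snd) (measurableSet_singleton a)
  have h3 := continuous_expRemainder.measurable
  unfold branchingField
  exact Measurable.ite (h1 1) (by fun_prop) (Measurable.ite (h1 0) (by fun_prop)
    (Measurable.ite (h2 0) (by fun_prop) (Measurable.ite (h2 (-1)) (by fun_prop)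
    (Measurable.ite (h2 (-2)) (by fun_prop) measurable_const))))

theorem measurable_truncatedField (k : ℕ) :
    Measurable fun q : ℝ × (ℝ≥0 × ℝ) => truncatedField k q.1 q.2 := by
  have h1 : ∀ a : ℝ, MeasurableSet {q : ℝ × (ℝ≥0 × ℝ) | a < q.2.2} := fun a =>
    (measurable_snd.comp measurable_snd) measurableSet_Ioi
  unfold truncatedField
  exact Measurable.ite ((h1 1).inter (h1 k)) measurable_const measurable_branchingField

theorem abs_branchingField_le {x : ℝ} (hx : 0 ≤ x) (ω : ℝ≥0 × ℝ) :
    |branchingField x ω| ≤ 1 + x + 2 * x ^ 2 := by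
  unfold branchingField
  split_ifs with a b c d e
  · have h1 : 0 ≤ x * ω.2 := by have := zero_lt_one.trans a; positivity
    have h2 : Real.exp (-x * ω.2) ≤ 1 := Real.exp_le_one_iff.2 (by linarith)
    have h3 := Real.exp_pos (-x * ω.2)
    rw [abs_of_nonneg (by linarith)]
    nlinarith
  · rw [abs_neg, abs_of_nonneg (div_nonneg (expRemainder_nonneg _) (by positivity))]
    have := expRemainder_div_sq_le hx b
    nlinarith
  · rw [abs_neg, abs_of_nonneg (by positivity)]; nlinarith
  · rw [abs_neg, abs_of_nonneg hx]; nlinarith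
  · rw [abs_of_nonneg hx]; nlinarith
  · rw [abs_zero]; positivity

theorem abs_truncatedField_le (k : ℕ) {x : ℝ} (hx : 0 ≤ x) (ω : ℝ≥0 × ℝ) :
    |truncatedField k x ω| ≤ 1 + x + 2 * x ^ 2 := by
  unfold truncatedField
  split_ifs
  · rw [abs_zero]; positivity
  · exact abs_branchingField_le hx ω

theorem tendsto_approxField (k : ℕ) (ω : ℝ≥0 × ℝ) {x : ℕ → ℝ} {y : ℝ} (hx : ∀ n, 0 ≤ x n)
    (hlim : Tendsto x atTop (𝓝 y)) :
    Tendsto (fun n => approxField n k (x n) ω) atTop (𝓝 (truncatedField k y ω)) := by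
  have hhalf : Tendsto (fun n : ℕ => ((1 : ℝ) / 2) ^ n) atTop (𝓝 0) :=
    tendsto_pow_atTop_nhds_zero_of_lt_one (by norm_num) (by norm_num)
  have hbr := ((continuous_branchingField ω).tendsto y).comp hlim
  simp only [approxField_eq _ _ (hx _), truncatedField]
  by_cases h1 : 1 < ω.2
  · simp only [h1, true_and, if_true]
    by_cases hk : (k : ℝ) < ω.2
    · simp [hk, not_le.2 hk]
    · simp only [hk, not_lt.1 hk, if_true, if_false]
      refine hbr.congr fun n => ?_
      simp [branchingField, h1]
  simp only [h1, false_and, if_false]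
  by_cases h2 : 0 < ω.2
  · simp only [h2, if_true]
    refine hbr.congr' ?_
    filter_upwards [hhalf.eventually_lt_const h2] with n hn
    simp only [Function.comp_apply, branchingField, h1, h2, hn, if_true, if_false]
  simp only [h2, if_false]
  by_cases h3 : ω.2 = 0
  · simp only [branchingField, h3, if_true, lt_irrefl, not_lt.2 zero_le_one, if_false]
    have hy0 : Tendsto (fun n => x n * (1 / 2) ^ n) atTop (𝓝 0) := by
      simpa using hlim.mul hhalf
    have hmain : Tendsto (fun n => 2 * 4 ^ n * expRemainder (x n * (1 / 2) ^ n)) atTop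
        (𝓝 (y ^ 2)) := by
      have hsq : Tendsto (fun n => x n ^ 2) atTop (𝓝 (y ^ 2)) := hlim.pow 2
      have herr : Tendsto (fun n => 2 * 4 ^ n * expRemainder (x n * (1 / 2) ^ n) - x n ^ 2) atTop
          (𝓝 0) := by
        have hbound : Tendsto (fun n => 2 * x n ^ 3 * (1 / 2) ^ n) atTop (𝓝 0) := by
          simpa using ((hlim.pow 3).const_mul 2).mul hhalf
        refine squeeze_zero_norm' ?_ hbound
        filter_upwards [hy0.eventually_lt_const zero_lt_one] with n hn
        have hpos : 0 ≤ x n * (1 / 2) ^ n := mul_nonneg (hx n) (by positivity)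
        have h5 := abs_expRemainder_sub_le (y := x n * (1 / 2) ^ n)
          (by rw [abs_of_nonneg hpos]; exact hn.le)
        have h6 : (4 : ℝ) ^ n * ((1 / 2) ^ n) ^ 2 = 1 := by
          rw [← pow_mul, mul_comm n 2, pow_mul, ← mul_pow]; norm_num
        have h7 : 2 * 4 ^ n * expRemainder (x n * (1 / 2) ^ n) - x n ^ 2 =
            2 * 4 ^ n * (expRemainder (x n * (1 / 2) ^ n) - (x n * (1 / 2) ^ n) ^ 2 / 2) := by
          linear_combination x n ^ 2 * h6
        rw [h7, Real.norm_eq_abs, abs_mul, abs_of_nonneg (by positivity : (0 : ℝ) ≤ 2 * 4 ^ n)]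
        rw [abs_of_nonneg hpos] at h5
        calc _ ≤ 2 * 4 ^ n * (x n * (1 / 2) ^ n) ^ 3 := by gcongr
          _ = _ := by linear_combination 2 * x n ^ 3 * (1 / 2) ^ n * h6
      simpa using herr.add hsq
    exact hmain.neg
  simp only [h3, if_false]
  refine hbr.congr fun n => ?_
  simp [branchingField, h1, h2, h3]

theorem tendsto_truncatedField (ω : ℝ≥0 × ℝ) {x : ℕ → ℝ} {y : ℝ}
    (hlim : Tendsto x atTop (𝓝 y)) :
    Tendsto (fun k => truncatedField k (x k) ω) atTop (𝓝 (branchingField y ω)) := by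
  refine (((continuous_branchingField ω).tendsto y).comp hlim).congr' ?_
  obtain ⟨K, hK⟩ := exists_nat_ge ω.2
  filter_upwards [eventually_ge_atTop K] with k hk
  have : ω.2 ≤ k := hK.trans (by exact_mod_cast hk)
  simp [truncatedField, not_lt.2 this]

/-! ### The driving measure of the branching equation -/

namespace CadlagBV

theorem upperMeasure_Ioc_ne_top (g : CadlagBV) (r t : ℝ≥0) : g.upperMeasure (Ioc r t) ≠ ∞ := by
  simp [upperMeasure, StieltjesFunction.measure_Ioc]

theorem lowerMeasure_Ioc_ne_top (g : CadlagBV) (r t : ℝ≥0) : g.lowerMeasure (Ioc r t) ≠ ∞ := by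
  simp [lowerMeasure, StieltjesFunction.measure_Ioc]

theorem upperMeasure_sub_lowerMeasure_Ioc (g : CadlagBV) {r t : ℝ≥0} (h : r ≤ t) :
    g.upperMeasure.real (Ioc r t) - g.lowerMeasure.real (Ioc r t) = g.toFun t - g.toFun r := by
  simpa [integral] using g.integral_one h

theorem upperMeasure_sub_lowerMeasure_singleton (g : CadlagBV) {t : ℝ≥0} (ht : 0 < t) :
    g.upperMeasure.real {t} - g.lowerMeasure.real {t} = g.jump t := by
  obtain ⟨u, humono, hu, hlim⟩ := exists_seq_strictMono_tendsto' ht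
  have hinter : ⋂ n, Ioc (u n) t = {t} := by
    ext x
    simp only [mem_iInter, mem_Ioc, mem_singleton_iff]
    refine ⟨fun h => le_antisymm (h 0).2 (le_of_tendsto' hlim fun n => (h n).1.le), ?_⟩
    rintro rfl n
    exact ⟨(hu n).2, le_rfl⟩
  have hanti : Antitone fun n => Ioc (u n) t := fun m n hmn =>
    Ioc_subset_Ioc_left (humono.monotone hmn)
  have key : ∀ μ : Measure ℝ≥0, (∀ r, μ (Ioc r t) ≠ ∞) →
      Tendsto (fun n => μ.real (Ioc (u n) t)) atTop (𝓝 (μ.real {t})) := fun μ hμ => by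
    have h1 := tendsto_measure_iInter_atTop (μ := μ)
      (fun n => measurableSet_Ioc.nullMeasurableSet) hanti ⟨0, hμ _⟩
    rw [hinter] at h1
    have hne : μ {t} ≠ ∞ := ne_top_of_le_ne_top (hμ 0)
      (measure_mono (singleton_subset_iff.2 ⟨ht, le_rfl⟩))
    exact (ENNReal.tendsto_toReal hne).comp h1
  have h1 := (key _ fun r => g.upperMeasure_Ioc_ne_top r t).sub
    (key _ fun r => g.lowerMeasure_Ioc_ne_top r t)
  have hne : (𝓝[<] t).NeBot := nhdsLT_neBot_of_exists_lt ⟨0, ht⟩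
  obtain ⟨l, hl⟩ := g.left_limits t ht
  have hu' : Tendsto u atTop (𝓝[<] t) :=
    tendsto_nhdsWithin_iff.2 ⟨hlim, Eventually.of_forall fun n => (hu n).2⟩
  rw [jump, leftLim_eq_of_tendsto hl]
  refine tendsto_nhds_unique h1 ?_
  simp only [g.upperMeasure_sub_lowerMeasure_Ioc (hu _).2.le]
  exact tendsto_const_nhds.sub (hl.comp hu')

theorem lowerMeasure_Ioc_eq_zero (g : CadlagBV) (hg : Monotone g.toFun) (r t : ℝ≥0) :
    g.lowerMeasure (Ioc r t) = 0 := by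
  have hvar : ∀ t, g.variation t - g.toFun t = 0 := fun t => by
    have h1 : (fun t => g.variation t - g.toFun t) 0 ≤ (fun t => g.variation t - g.toFun t) t :=
      g.variation_sub_mono zero_le
    have h0 : g.variation 0 = 0 := variationOnFromTo.self _ _ _
    have h2 : g.variation t ≤ g.toFun t := by
      rw [variation, variationOnFromTo.eq_of_le _ _ zero_le]
      have h3 := ((hg.monotoneOn univ).eVariationOn_eq (mem_univ 0) (mem_univ t)).le
      have h4 := ENNReal.toReal_mono ENNReal.ofReal_ne_top h3
      rwa [g.zero, sub_zero, ENNReal.toReal_ofReal (g.zero ▸ hg zero_le)] at h4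
    simp only [h0, g.zero, sub_zero] at h1
    linarith
  rw [lowerMeasure, StieltjesFunction.measure_Ioc, Monotone.stieltjesFunction_eq,
    Monotone.stieltjesFunction_eq]
  have hconst : (fun t => g.variation t - g.toFun t) = fun _ => 0 := funext hvar
  have hr : ∀ x : ℝ≥0, Function.rightLim (fun _ : ℝ≥0 => (0 : ℝ)) x = 0 := fun x =>
    have := nhdsGT_neBot x
    rightLim_eq_of_tendsto tendsto_const_nhds
  simp [hconst, hr]

theorem integral_congr (g : CadlagBV) {f f' : ℝ≥0 → ℝ} {r t : ℝ≥0}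
    (h : ∀ s ∈ Ioc r t, f s = f' s) : g.integral f r t = g.integral f' r t := by
  rw [integral, integral, setIntegral_congr_fun measurableSet_Ioc h,
    setIntegral_congr_fun measurableSet_Ioc h]

theorem integral_eq_of_monotone (g : CadlagBV) (hg : Monotone g.toFun) (f : ℝ≥0 → ℝ) (r t : ℝ≥0) :
    g.integral f r t = ∫ s in Ioc r t, f s ∂g.upperMeasure := by
  rw [integral, Measure.restrict_eq_zero.2 (g.lowerMeasure_Ioc_eq_zero hg r t),
    integral_zero_measure, sub_zero]

theorem upperMeasure_singleton_eq_zero (g : CadlagBV) (hg : Monotone g.toFun)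
    (hc : Continuous g.toFun) {t : ℝ≥0} (ht : 0 < t) : g.upperMeasure {t} = 0 := by
  have h1 := g.upperMeasure_sub_lowerMeasure_singleton ht
  have h2 : g.lowerMeasure {t} = 0 := measure_mono_null
    (singleton_subset_iff.2 (⟨ht, le_rfl⟩ : t ∈ Ioc 0 t)) (g.lowerMeasure_Ioc_eq_zero hg 0 t)
  have hne : (𝓝[<] t).NeBot := nhdsLT_neBot_of_exists_lt ⟨0, ht⟩
  have h3 : g.jump t = 0 := by
    rw [jump, leftLim_eq_of_tendsto ((hc.tendsto t).mono_left nhdsWithin_le_nhds), sub_self]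
  have h4 : g.lowerMeasure.real {t} = 0 := by rw [measureReal_def, h2, ENNReal.toReal_zero]
  rw [h4, h3, sub_zero] at h1
  have h5 : g.upperMeasure {t} ≠ ∞ := ne_top_of_le_ne_top (g.upperMeasure_Ioc_ne_top 0 t)
    (measure_mono (singleton_subset_iff.2 ⟨ht, le_rfl⟩))
  exact (measureReal_eq_zero_iff h5).1 h1

end CadlagBV

/-- The weight `1 ∧ z²` that turns `m(ds, dz)` into a locally finite measure. -/
noncomputable def sqWeight (q : ℝ≥0 × ℝ) : ℝ≥0 := (min 1 (q.2 ^ 2)).toNNReal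

theorem coe_sqWeight (q : ℝ≥0 × ℝ) : (sqWeight q : ℝ) = min 1 (q.2 ^ 2) :=
  Real.coe_toNNReal _ (le_min zero_le_one (sq_nonneg _))

theorem measurable_sqWeight : Measurable sqWeight := by
  unfold sqWeight; fun_prop

theorem sqWeight_mul_branchingField (x : ℝ) {q : ℝ≥0 × ℝ} (hq : 0 < q.2) :
    (sqWeight q : ℝ) * branchingField x q = -BranchingParameters.K₁ x q.2 := by
  rw [coe_sqWeight, branchingField, BranchingParameters.K₁]
  split_ifs with h1 h2 h2
  · linarith
  · rw [min_eq_left (by nlinarith)]; ring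
  · rw [min_eq_right (by nlinarith), expRemainder, neg_mul]
    field_simp
  · linarith

namespace BranchingParameters

/-- The measure that drives the backward equation through `branchingField`: the four parts are
`(1 ∧ z²) m(ds, dz)`, `c(ds)` and the two increasing parts of `b₁(ds)`, the last three at the marks
`0`, `-1` and `-2`. -/
noncomputable def drivingMeasure (p : BranchingParameters) : Measure (ℝ≥0 × ℝ) :=
  p.m.withDensity (fun q => (sqWeight q : ℝ≥0∞)) + p.c.upperMeasure.map (fun s => (s, 0)) +
    p.b₁.upperMeasure.map (fun s => (s, -1)) + p.b₁.lowerMeasure.map (fun s => (s, -2))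

variable (p : BranchingParameters)

theorem ae_mem_support : ∀ᵐ q ∂p.m, q ∈ (Ioi 0 ×ˢ Ioi 0 : Set (ℝ≥0 × ℝ)) := p.m_support

theorem preimage_ae_eq (A : Set ℝ≥0) :
    (Prod.fst ⁻¹' A : Set (ℝ≥0 × ℝ)) =ᵐ[p.m] (A ×ˢ Ioi 0 : Set (ℝ≥0 × ℝ)) := by
  filter_upwards [p.ae_mem_support] with q hq
  refine propext ⟨fun h => ⟨h, hq.2⟩, fun h => h.1⟩

theorem drivingMeasure_Ioc_lt_top (t : ℝ≥0) :
    p.drivingMeasure (Prod.fst ⁻¹' Ioc 0 t) < ∞ := by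
  have hA : MeasurableSet (Prod.fst ⁻¹' Ioc 0 t : Set (ℝ≥0 × ℝ)) :=
    measurable_fst measurableSet_Ioc
  have hm : ∀ a : ℝ, Measurable fun s : ℝ≥0 => (s, a) := fun a => by fun_prop
  simp only [drivingMeasure, Measure.coe_add, Pi.add_apply, ENNReal.add_lt_top]
  refine ⟨⟨⟨?_, ?_⟩, ?_⟩, ?_⟩
  · rw [withDensity_apply _ hA, setLIntegral_congr (p.preimage_ae_eq _)]
    exact p.m_integrable t
  · rw [Measure.map_apply (hm _) hA]
    exact (p.c.upperMeasure_Ioc_ne_top 0 t).lt_top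
  · rw [Measure.map_apply (hm _) hA]
    exact (p.b₁.upperMeasure_Ioc_ne_top 0 t).lt_top
  · rw [Measure.map_apply (hm _) hA]
    exact (p.b₁.lowerMeasure_Ioc_ne_top 0 t).lt_top

theorem setIntegral_drivingMeasure {f : ℝ≥0 × ℝ → ℝ} (hf : Measurable f) {A : Set ℝ≥0}
    (hA : MeasurableSet A) (hi : IntegrableOn f (Prod.fst ⁻¹' A) p.drivingMeasure) :
    ∫ q in Prod.fst ⁻¹' A, f q ∂p.drivingMeasure =
      ∫ q in A ×ˢ Ioi 0, sqWeight q * f q ∂p.m + ∫ s in A, f (s, 0) ∂p.c.upperMeasure +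
      ∫ s in A, f (s, -1) ∂p.b₁.upperMeasure + ∫ s in A, f (s, -2) ∂p.b₁.lowerMeasure := by
  have hA' : MeasurableSet (Prod.fst ⁻¹' A : Set (ℝ≥0 × ℝ)) := measurable_fst hA
  have hm : ∀ a : ℝ, Measurable fun s : ℝ≥0 => (s, a) := fun a => by fun_prop
  unfold IntegrableOn drivingMeasure at hi
  simp only [Measure.restrict_add, integrable_add_measure] at hi
  obtain ⟨⟨⟨h1, h2⟩, h3⟩, h4⟩ := hi
  unfold drivingMeasure
  rw [Measure.restrict_add, Measure.restrict_add, Measure.restrict_add,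
    integral_add_measure ((h1.add_measure h2).add_measure h3) h4,
    integral_add_measure (h1.add_measure h2) h3, integral_add_measure h1 h2,
    setIntegral_map hA' hf.aestronglyMeasurable (hm _).aemeasurable,
    setIntegral_map hA' hf.aestronglyMeasurable (hm _).aemeasurable,
    setIntegral_map hA' hf.aestronglyMeasurable (hm _).aemeasurable,
    setIntegral_withDensity_eq_setIntegral_smul measurable_sqWeight _ hA',
    setIntegral_congr_set (p.preimage_ae_eq A)]
  rfl

theorem integrableOn_K₁ {u : ℝ≥0 → ℝ} {A : Set ℝ≥0} (hA : MeasurableSet A)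
    (hi : IntegrableOn (fun q => branchingField (u q.1) q) (Prod.fst ⁻¹' A) p.drivingMeasure) :
    IntegrableOn (fun q : ℝ≥0 × ℝ => K₁ (u q.1) q.2) (A ×ˢ Ioi 0) p.m := by
  have hA' : MeasurableSet (Prod.fst ⁻¹' A : Set (ℝ≥0 × ℝ)) := measurable_fst hA
  unfold IntegrableOn drivingMeasure at hi
  simp only [Measure.restrict_add, integrable_add_measure] at hi
  obtain ⟨⟨⟨h1, -⟩, -⟩, -⟩ := hi
  rw [restrict_withDensity hA', integrable_withDensity_iff_integrable_smul measurable_sqWeight] at h1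
  have h2 : IntegrableOn (fun q => sqWeight q • branchingField (u q.1) q) (A ×ˢ Ioi 0) p.m :=
    (integrableOn_congr_set_ae (p.preimage_ae_eq A)).1 h1
  refine (h2.neg).congr_fun (fun q hq => ?_) (hA.prod measurableSet_Ioi)
  have := sqWeight_mul_branchingField (u q.1) hq.2
  simp only [Pi.neg_apply, NNReal.smul_def, smul_eq_mul, this, neg_neg]

theorem integrableOn_branchingField {u : ℝ≥0 → ℝ} (hu : Measurable u) {B : ℝ}
    (hB : ∀ r, 0 ≤ u r ∧ u r ≤ B) (t : ℝ≥0) :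
    IntegrableOn (fun q => branchingField (u q.1) q) (Prod.fst ⁻¹' Ioc 0 t) p.drivingMeasure := by
  have hm : Measurable fun q : ℝ≥0 × ℝ => branchingField (u q.1) q :=
    measurable_branchingField.comp ((hu.comp measurable_fst).prodMk measurable_id)
  refine Measure.integrableOn_of_bounded (M := 1 + B + 2 * B ^ 2)
    (p.drivingMeasure_Ioc_lt_top t).ne hm.aestronglyMeasurable (Eventually.of_forall fun q => ?_)
  refine (abs_branchingField_le (hB q.1).1 q).trans ?_
  have h1 := hB q.1
  have := pow_le_pow_left₀ h1.1 h1.2 2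
  linarith

/-- The drift of the backward equation in terms of the driving measure. -/
theorem setIntegral_branchingField (hc : Monotone p.c.toFun) {u : ℝ≥0 → ℝ} (hu : Measurable u)
    {B : ℝ} (hB : ∀ r, 0 ≤ u r ∧ u r ≤ B) (r t : ℝ≥0) :
    ∫ q in Prod.fst ⁻¹' Ioc r t, branchingField (u q.1) q ∂p.drivingMeasure =
      -p.b₁.integral u r t - p.c.integral (fun s => u s ^ 2) r t -
        ∫ q in Ioc r t ×ˢ Ioi 0, K₁ (u q.1) q.2 ∂p.m := by
  have hm : Measurable fun q : ℝ≥0 × ℝ => branchingField (u q.1) q :=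
    measurable_branchingField.comp ((hu.comp measurable_fst).prodMk measurable_id)
  have hi := (p.integrableOn_branchingField hu hB t).mono_set
    (preimage_mono (f := (Prod.fst : ℝ≥0 × ℝ → ℝ≥0)) (Ioc_subset_Ioc_left (zero_le (a := r))))
  rw [p.setIntegral_drivingMeasure hm measurableSet_Ioc hi, p.c.integral_eq_of_monotone hc,
    CadlagBV.integral]
  have e1 : ∫ q in Ioc r t ×ˢ Ioi 0, sqWeight q * branchingField (u q.1) q ∂p.m =
      -∫ q in Ioc r t ×ˢ Ioi 0, K₁ (u q.1) q.2 ∂p.m := by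
    rw [← integral_neg]
    exact setIntegral_congr_fun (measurableSet_Ioc.prod measurableSet_Ioi) fun q hq =>
      sqWeight_mul_branchingField _ hq.2
  have e2 : ∀ s, branchingField (u s) (s, 0) = -u s ^ 2 := fun s => by simp [branchingField]
  have e3 : ∀ s, branchingField (u s) (s, -1) = -u s := fun s => by
    norm_num [branchingField]
  have e4 : ∀ s, branchingField (u s) (s, -2) = u s := fun s => by
    norm_num [branchingField]
  simp only [e1, e2, e3, e4, integral_neg]
  ring

end BranchingParameters

/-! ### The jump condition -/

section Backward

variable {Ω : Type*} [MeasurableSpace Ω] {N : Measure Ω} {τ : Ω → ℝ≥0} {γ : ℝ → Ω → ℝ}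

theorem SolvesBackward.congr {t : ℝ≥0} {lam : ℝ} {u u' : ℝ≥0 → ℝ} (hτ : Measurable τ)
    (hu : SolvesBackward N τ γ t lam u) (h : ∀ r ≤ t, u r = u' r) :
    SolvesBackward N τ γ t lam u' := fun r hr => by
  rw [← h r hr, hu r hr]
  congr 1
  refine setIntegral_congr_fun (hτ measurableSet_Ioc) fun ω hω => ?_
  have : τ ω ≤ t := hω.2
  simp only [h _ this]

theorem setIntegral_restrict_preimage {f : Ω → ℝ} {t : ℝ≥0} {A : Set ℝ≥0} (hA : A ⊆ Ioc 0 t) :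
    ∫ ω in τ ⁻¹' A, f ω ∂(N.restrict (τ ⁻¹' Ioc 0 t)) = ∫ ω in τ ⁻¹' A, f ω ∂N := by
  rw [Measure.restrict_restrict_of_subset (preimage_mono hA)]

theorem solvesBackward_restrict_iff {t : ℝ≥0} {lam : ℝ} {u : ℝ≥0 → ℝ} :
    SolvesBackward (N.restrict (τ ⁻¹' Ioc 0 t)) τ γ t lam u ↔ SolvesBackward N τ γ t lam u := by
  unfold SolvesBackward
  refine forall₂_congr fun r hr => ?_
  rw [setIntegral_restrict_preimage (Ioc_subset_Ioc_left zero_le)]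

theorem SolvesBackward.of_tendsto [IsFiniteMeasure N] {γ : ℕ → ℝ → Ω → ℝ} {γ' : ℝ → Ω → ℝ}
    {t : ℝ≥0} {lam : ℝ} {u : ℕ → ℝ≥0 → ℝ} {u' : ℝ≥0 → ℝ} {D : ℝ}
    (hu : ∀ n, SolvesBackward N τ (γ n) t lam (u n))
    (hm : ∀ n, Measurable fun ω => γ n (u n (τ ω)) ω)
    (hb : ∀ n ω, |γ n (u n (τ ω)) ω| ≤ D)
    (hlim : ∀ r, Tendsto (fun n => u n r) atTop (𝓝 (u' r)))
    (hγ : ∀ ω, Tendsto (fun n => γ n (u n (τ ω)) ω) atTop (𝓝 (γ' (u' (τ ω)) ω))) :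
    SolvesBackward N τ γ' t lam u' := fun r hr => by
  refine tendsto_nhds_unique (hlim r) ?_
  simp only [hu _ r hr]
  refine tendsto_const_nhds.add (tendsto_integral_of_dominated_convergence (fun _ => D)
    (fun n => (hm n).aestronglyMeasurable) (integrable_const _)
    (fun n => Eventually.of_forall (hb n)) (Eventually.of_forall hγ))

end Backward

namespace BranchingParameters

variable (p : BranchingParameters)

theorem jump_add_integral_le (hp : p.WeaklyAdmissible) {s : ℝ≥0} (hs : 0 < s) :
    IntegrableOn (fun q : ℝ≥0 × ℝ => if q.2 ≤ 1 then q.2 else 0) ({s} ×ˢ Ioi 0) p.m ∧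
      p.b₁.jump s + ∫ q in {s} ×ˢ Ioi 0, (if q.2 ≤ 1 then q.2 else 0) ∂p.m ≤ 1 := by
  have h := hp.jump_le s hs
  set I := ∫⁻ q in {s} ×ˢ Ioc 0 1, ENNReal.ofReal q.2 ∂p.m with hI
  have hIne : I ≠ ∞ := by
    intro htop
    rw [htop, EReal.coe_ennreal_top, EReal.coe_add_top, top_le_iff] at h
    exact absurd h (by decide)
  have hm : Measurable fun q : ℝ≥0 × ℝ => if q.2 ≤ 1 then q.2 else 0 :=
    Measurable.ite (measurable_snd measurableSet_Iic) measurable_snd measurable_const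
  have hset : MeasurableSet ({s} ×ˢ Ioi 0 : Set (ℝ≥0 × ℝ)) :=
    (measurableSet_singleton s).prod measurableSet_Ioi
  have hset1 : MeasurableSet ({q | q.2 ≤ 1} : Set (ℝ≥0 × ℝ)) := measurable_snd measurableSet_Iic
  have e1 : ∫⁻ q in {s} ×ˢ Ioi 0, ENNReal.ofReal (if q.2 ≤ 1 then q.2 else 0) ∂p.m = I := by
    have e2 : ∀ q : ℝ≥0 × ℝ, ENNReal.ofReal (if q.2 ≤ 1 then q.2 else 0) =
        ({q | q.2 ≤ 1} : Set (ℝ≥0 × ℝ)).indicator (fun q => ENNReal.ofReal q.2) q := fun q => by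
      by_cases h : q.2 ≤ 1
      · rw [if_pos h, indicator_of_mem (by exact h)]
      · rw [if_neg h, indicator_of_notMem (by exact h), ENNReal.ofReal_zero]
    simp only [e2]
    rw [lintegral_indicator hset1, Measure.restrict_restrict hset1, hI]
    congr 2
    ext q
    simp only [mem_inter_iff, mem_ofPred_eq, mem_prod, mem_singleton_iff, mem_Ioi, mem_Ioc]
    tauto
  have hnn : 0 ≤ᵐ[p.m.restrict ({s} ×ˢ Ioi 0)] fun q => if q.2 ≤ 1 then q.2 else 0 := by
    filter_upwards [ae_restrict_mem hset] with q hq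
    have : 0 < q.2 := hq.2
    simp only [Pi.zero_apply]
    split_ifs <;> linarith
  refine ⟨⟨hm.aestronglyMeasurable, ?_⟩, ?_⟩
  · rw [hasFiniteIntegral_iff_ofReal hnn, e1]
    exact hIne.lt_top
  · rw [integral_eq_lintegral_of_nonneg_ae hnn hm.aestronglyMeasurable, e1]
    rw [← ENNReal.ofReal_toReal hIne, EReal.coe_ennreal_ofReal,
      max_eq_left ENNReal.toReal_nonneg] at h
    exact_mod_cast h

theorem drivingMeasure_preimage_singleton_lt_top {s : ℝ≥0} (hs : 0 < s) :
    p.drivingMeasure (Prod.fst ⁻¹' {s}) < ∞ := by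
  have hmem : s ∈ Ioc 0 s := ⟨hs, le_rfl⟩
  exact (measure_mono (preimage_mono (singleton_subset_iff.2 hmem))).trans_lt
    (p.drivingMeasure_Ioc_lt_top s)

/-- The approximating drifts satisfy the jump condition: cutting the small jumps only lowers the
atoms of the drift, and `c` has no atoms. -/
theorem setIntegral_driftCoeff_le (hp : p.WeaklyAdmissible) (n : ℕ) {s : ℝ≥0} (hs : 0 < s) :
    ∫ q in Prod.fst ⁻¹' {s}, driftCoeff n q ∂p.drivingMeasure ≤ 1 := by
  have hdata := isJumpData_approx n 0
  have hi : IntegrableOn (driftCoeff n) (Prod.fst ⁻¹' {s}) p.drivingMeasure :=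
    Measure.integrableOn_of_bounded (p.drivingMeasure_preimage_singleton_lt_top hs).ne
      hdata.measurable_drift.aestronglyMeasurable (Eventually.of_forall hdata.abs_drift_le)
  obtain ⟨hint, hle⟩ := p.jump_add_integral_le hp hs
  rw [p.setIntegral_drivingMeasure hdata.measurable_drift (measurableSet_singleton s) hi]
  have e0 : ∫ s in {s}, driftCoeff n (s, 0) ∂p.c.upperMeasure = 0 := by
    rw [Measure.restrict_eq_zero.2 (p.c.upperMeasure_singleton_eq_zero hp.c_monotone
      hp.c_continuous hs), integral_zero_measure]
  have e1 : ∀ s, driftCoeff n (s, -1) = 1 := fun s => by norm_num [driftCoeff]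
  have e2 : ∀ s, driftCoeff n (s, -2) = -1 := fun s => by norm_num [driftCoeff]
  have e3 := p.b₁.upperMeasure_sub_lowerMeasure_singleton hs
  have e4 : ∫ q in {s} ×ˢ Ioi 0, sqWeight q * driftCoeff n q ∂p.m ≤
      ∫ q in {s} ×ˢ Ioi 0, (if q.2 ≤ 1 then q.2 else 0) ∂p.m := by
    refine integral_mono_of_nonneg ?_ hint ?_
    · refine (ae_restrict_mem ((measurableSet_singleton s).prod measurableSet_Ioi)).mono
        fun q hq => mul_nonneg (sqWeight q).2 ?_
      have : 0 < q.2 := hq.2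
      simp only [driftCoeff, this, if_true]
      split_ifs <;> positivity
    · refine (ae_restrict_mem ((measurableSet_singleton s).prod measurableSet_Ioi)).mono
        fun q hq => ?_
      have h0 : 0 < q.2 := hq.2
      simp only [driftCoeff, h0, if_true, coe_sqWeight]
      split_ifs with a b c d
      · linarith
      · simp
      · have : min 1 (q.2 ^ 2) ≤ q.2 ^ 2 := min_le_right _ _
        calc min 1 (q.2 ^ 2) * (1 / q.2) ≤ q.2 ^ 2 * (1 / q.2) := by gcongr
          _ = q.2 := by field_simp
      · exact absurd (not_lt.1 a) d
      · simpa using h0.le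
      · simp
  simp only [e0, e1, e2, integral_const, smul_eq_mul, measureReal_restrict_apply_univ]
  linarith

/-- The exact jump of the solutions at time `s` keeps positive states positive; this is where the
absence of bottlenecks enters. -/
theorem eulerStep_branchingField_pos (hp : p.Admissible) {s : ℝ≥0} (hs : 0 < s) {x : ℝ}
    (hx : 0 < x) : 0 < eulerStep p.drivingMeasure Prod.fst branchingField {s} x := by
  have hm : Measurable (branchingField x) := measurable_branchingField.comp measurable_prodMk_left
  have hset : MeasurableSet ({s} ×ˢ Ioi 0 : Set (ℝ≥0 × ℝ)) :=
    (measurableSet_singleton s).prod measurableSet_Ioi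
  have hi : IntegrableOn (branchingField x) (Prod.fst ⁻¹' {s}) p.drivingMeasure :=
    Measure.integrableOn_of_bounded (p.drivingMeasure_preimage_singleton_lt_top hs).ne
      hm.aestronglyMeasurable (Eventually.of_forall fun q => abs_branchingField_le hx.le q)
  have hK := p.integrableOn_K₁ (u := fun _ => x) (measurableSet_singleton s) hi
  obtain ⟨hint, hle⟩ := p.jump_add_integral_le hp.weaklyAdmissible hs
  set J := ∫ q in {s} ×ˢ Ioi 0, (if q.2 ≤ 1 then q.2 else 0) ∂p.m with hJ
  have hexp : IntegrableOn (fun q : ℝ≥0 × ℝ => 1 - Real.exp (-x * q.2)) ({s} ×ˢ Ioi 0) p.m := by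
    have h2 : IntegrableOn (fun q : ℝ≥0 × ℝ => x * (if q.2 ≤ 1 then q.2 else 0) - K₁ x q.2)
        ({s} ×ˢ Ioi 0) p.m := (hint.const_mul x).sub hK
    refine h2.congr_fun (fun q _ => ?_) hset
    simp only [K₁]
    split_ifs <;> ring
  have e0 : ∫ q in {s} ×ˢ Ioi 0, sqWeight q * branchingField x q ∂p.m =
      ∫ q in {s} ×ˢ Ioi 0, (1 - Real.exp (-x * q.2)) ∂p.m - x * J := by
    rw [hJ, ← integral_const_mul, ← integral_sub hexp (hint.const_mul x)]
    refine setIntegral_congr_fun hset fun q hq => ?_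
    simp only [sqWeight_mul_branchingField x hq.2, K₁]
    split_ifs <;> ring
  have e1 : ∫ s in {s}, branchingField x (s, 0) ∂p.c.upperMeasure = 0 := by
    rw [Measure.restrict_eq_zero.2 (p.c.upperMeasure_singleton_eq_zero
      hp.weaklyAdmissible.c_monotone hp.weaklyAdmissible.c_continuous hs), integral_zero_measure]
  have e2 : ∀ s, branchingField x (s, -1) = -x := fun s => by norm_num [branchingField]
  have e3 : ∀ s, branchingField x (s, -2) = x := fun s => by norm_num [branchingField]
  have e4 := p.b₁.upperMeasure_sub_lowerMeasure_singleton hs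
  have key : eulerStep p.drivingMeasure Prod.fst branchingField {s} x =
      x * (1 - p.b₁.jump s - J) + ∫ q in {s} ×ˢ Ioi 0, (1 - Real.exp (-x * q.2)) ∂p.m := by
    rw [eulerStep, p.setIntegral_drivingMeasure hm (measurableSet_singleton s) hi]
    simp only [e0, e1, e2, e3, integral_const, smul_eq_mul, measureReal_restrict_apply_univ]
    rw [← e4]
    ring
  have hpos : ∀ q ∈ ({s} ×ˢ Ioi 0 : Set (ℝ≥0 × ℝ)), 0 < 1 - Real.exp (-x * q.2) := fun q hq => by
    have : 0 < x * q.2 := mul_pos hx hq.2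
    exact sub_pos.2 (Real.exp_lt_one_iff.2 (by linarith))
  have hnn : 0 ≤ ∫ q in {s} ×ˢ Ioi 0, (1 - Real.exp (-x * q.2)) ∂p.m :=
    setIntegral_nonneg hset fun q hq => (hpos q hq).le
  rw [key]
  by_cases hm0 : p.m ({s} ×ˢ Ioi 0) = 0
  · have hJ0 : J = 0 := by rw [hJ, Measure.restrict_eq_zero.2 hm0, integral_zero_measure]
    have hne : p.b₁.jump s ≠ 1 := fun h => by
      have : s ∈ p.bottlenecks := ⟨hs, h, hm0⟩
      rw [hp.no_bottlenecks] at this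
      exact this
    have hlt : p.b₁.jump s < 1 := lt_of_le_of_ne (by linarith) hne
    have : 0 < x * (1 - p.b₁.jump s - J) := mul_pos hx (by linarith)
    linarith
  · have h1 : 0 < ∫ q in {s} ×ˢ Ioi 0, (1 - Real.exp (-x * q.2)) ∂p.m := by
      rw [setIntegral_pos_iff_support_of_nonneg_ae
        ((ae_restrict_mem hset).mono fun q hq => (hpos q hq).le) hexp]
      refine pos_iff_ne_zero.2 fun h => hm0 (measure_mono_null ?_ h)
      exact fun q hq => ⟨(hpos q hq).ne', hq⟩
    have : 0 ≤ x * (1 - p.b₁.jump s - J) := mul_nonneg hx.le (by linarith)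
    linarith

end BranchingParameters

/-! ### Lower bounds and uniqueness -/

theorem abs_expRemainder_sub_expRemainder_le {a b B : ℝ} (ha : 0 ≤ a) (hb : 0 ≤ b) (haB : a ≤ B)
    (hbB : b ≤ B) : |expRemainder a - expRemainder b| ≤ B * |a - b| := by
  wlog hab : a ≤ b generalizing a b
  · rw [abs_sub_comm, abs_sub_comm a]
    exact this hb ha hbB haB (le_of_not_ge hab)
  rw [abs_sub_comm, abs_sub_comm a, abs_of_nonneg (sub_nonneg.2 hab)]
  have e1 : Real.exp (-b) = Real.exp (-a) * Real.exp (-(b - a)) := by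
    rw [← Real.exp_add]; ring_nf
  have h2 : 1 - (b - a) ≤ Real.exp (-(b - a)) := by linarith [Real.add_one_le_exp (-(b - a))]
  have h3 : Real.exp (-a) ≤ 1 := Real.exp_le_one_iff.2 (by linarith)
  have h4 : 1 - b ≤ Real.exp (-b) := by linarith [Real.add_one_le_exp (-b)]
  have h6 : (b - a) * Real.exp (-(b - a)) ≤ 1 - Real.exp (-(b - a)) := by
    have h7 := Real.add_one_le_exp (b - a)
    have h8 : Real.exp (b - a) * Real.exp (-(b - a)) = 1 := by
      rw [← Real.exp_add]; simp
    nlinarith [Real.exp_pos (-(b - a))]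
  have hea := Real.exp_pos (-a)
  have h9 : Real.exp (-a) * ((b - a) * Real.exp (-(b - a))) ≤
      Real.exp (-a) * (1 - Real.exp (-(b - a))) := by gcongr
  have h10 : Real.exp (-a) * ((b - a) * Real.exp (-(b - a))) = (b - a) * Real.exp (-b) := by
    rw [e1]; ring
  have h11 : (b - a) * (1 - b) ≤ (b - a) * Real.exp (-b) :=
    mul_le_mul_of_nonneg_left h4 (by linarith)
  have h12 : b * (b - a) ≤ B * (b - a) := mul_le_mul_of_nonneg_right hbB (by linarith)
  have h13 : Real.exp (-a) * (1 - Real.exp (-(b - a))) ≤ b - a := by nlinarith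
  unfold expRemainder
  rw [abs_le]
  constructor <;> nlinarith

/-- The branching field is Lipschitz on `[l, B]` for `0 < l`; the constant blows up as `l → 0`
because of the large jumps. -/
theorem abs_branchingField_sub_le {l B x y : ℝ} (hl : 0 < l) (hlx : l ≤ x) (hly : l ≤ y)
    (hxB : x ≤ B) (hyB : y ≤ B) (ω : ℝ≥0 × ℝ) :
    |branchingField x ω - branchingField y ω| ≤ (1 / l + 2 * B + 1) * |x - y| := by
  have hx : 0 < x := hl.trans_le hlx
  have hy : 0 < y := hl.trans_le hly
  have hB : 0 < B := hx.trans_le hxB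
  have hxy := abs_nonneg (x - y)
  have hl' : 0 < 1 / l := by positivity
  unfold branchingField
  split_ifs with h1 h2 h3 h4 h5
  · have hz : 0 < ω.2 := zero_lt_one.trans h1
    have e1 : 1 - Real.exp (-x * ω.2) - (1 - Real.exp (-y * ω.2)) =
        -(Real.exp (-(l * ω.2)) *
          (Real.exp (-((x - l) * ω.2)) - Real.exp (-((y - l) * ω.2)))) := by
      rw [mul_sub, ← Real.exp_add, ← Real.exp_add]; ring_nf
    have e2 := abs_exp_neg_sub_exp_neg_le (x := (x - l) * ω.2) (y := (y - l) * ω.2)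
      (mul_nonneg (by linarith) hz.le) (mul_nonneg (by linarith) hz.le)
    have e3 : (x - l) * ω.2 - (y - l) * ω.2 = ω.2 * (x - y) := by ring
    rw [e3, abs_mul, abs_of_pos hz] at e2
    have e4 : Real.exp (-(l * ω.2)) * ω.2 ≤ 1 / l := by
      rw [le_div_iff₀ hl, Real.exp_neg, inv_mul_eq_div, div_mul_eq_mul_div,
        div_le_one (Real.exp_pos _)]
      linarith [Real.add_one_le_exp (l * ω.2)]
    rw [e1, abs_neg, abs_mul, abs_of_pos (Real.exp_pos _)]
    calc _ ≤ Real.exp (-(l * ω.2)) * (ω.2 * |x - y|) := by gcongr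
      _ = Real.exp (-(l * ω.2)) * ω.2 * |x - y| := by ring
      _ ≤ 1 / l * |x - y| := by gcongr
      _ ≤ _ := by gcongr; linarith
  · have hz1 : ω.2 ≤ 1 := not_lt.1 h1
    have e1 := abs_expRemainder_sub_expRemainder_le (a := x * ω.2) (b := y * ω.2) (B := B * ω.2)
      (by positivity) (by positivity) (by gcongr) (by gcongr)
    have e2 : -(expRemainder (x * ω.2) / ω.2 ^ 2) - -(expRemainder (y * ω.2) / ω.2 ^ 2) =
        -((expRemainder (x * ω.2) - expRemainder (y * ω.2)) / ω.2 ^ 2) := by ring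
    rw [← sub_mul, abs_mul, abs_of_pos h2] at e1
    rw [e2, abs_neg, abs_div, abs_of_pos (by positivity : 0 < ω.2 ^ 2), div_le_iff₀ (by positivity)]
    calc _ ≤ B * ω.2 * (|x - y| * ω.2) := e1
      _ = B * |x - y| * ω.2 ^ 2 := by ring
      _ ≤ _ := by gcongr; linarith
  · have e1 : -x ^ 2 - -y ^ 2 = -((x + y) * (x - y)) := by ring
    rw [e1, abs_neg, abs_mul, abs_of_pos (by linarith)]
    exact mul_le_mul_of_nonneg_right (by linarith) hxy
  · have e1 : -x - -y = -(x - y) := by ring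
    rw [e1, abs_neg]
    nlinarith
  · nlinarith
  · rw [sub_zero, abs_zero]; positivity

theorem neg_mul_le_branchingField {B x : ℝ} (hx : 0 ≤ x) (hxB : x ≤ B) (ω : ℝ≥0 × ℝ) :
    -((1 + B) * x) ≤ branchingField x ω := by
  have hB : 0 ≤ B := hx.trans hxB
  unfold branchingField
  split_ifs with h1 h2
  · have h3 : 0 ≤ x * ω.2 := by have := zero_lt_one.trans h1; positivity
    have h4 : Real.exp (-x * ω.2) ≤ 1 := Real.exp_le_one_iff.2 (by linarith)
    nlinarith
  · have := expRemainder_div_sq_le hx h2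
    nlinarith
  all_goals nlinarith

namespace BranchingParameters

variable (p : BranchingParameters)

theorem isFiniteMeasure_restrict_Ioc (t : ℝ≥0) :
    IsFiniteMeasure (p.drivingMeasure.restrict (Prod.fst ⁻¹' Ioc 0 t)) :=
  isFiniteMeasure_restrict.2 (p.drivingMeasure_Ioc_lt_top t).ne

/-- Nonnegative solutions with a positive terminal value are bounded away from zero. On an interval
`(r, s)` of small mass the field is at least `-(1 + B) u`, which cannot push the solution below
half of its left limit at `s`; that limit is positive by `eulerStep_branchingField_pos`. -/
theorem exists_pos_le_of_solvesBackward (hp : p.Admissible) {t : ℝ≥0} {lam : ℝ} (hlam : 0 < lam)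
    {u : ℝ≥0 → ℝ} (hum : Measurable u) {B : ℝ} (hB : ∀ r, 0 ≤ u r ∧ u r ≤ B)
    (hu : SolvesBackward p.drivingMeasure Prod.fst branchingField t lam u) :
    ∃ l > 0, ∀ r ≤ t, l ≤ u r := by
  have hB0 : 0 ≤ B := (hB 0).1.trans (hB 0).2
  have hfin := p.isFiniteMeasure_restrict_Ioc t
  set N := p.drivingMeasure.restrict (Prod.fst ⁻¹' Ioc 0 t) with hN
  have hint : Integrable (fun q => branchingField (u q.1) q) N :=
    p.integrableOn_branchingField hum hB t
  rw [← solvesBackward_restrict_iff, ← hN] at hu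
  have hlow : ∀ (A : Set ℝ≥0) (M : ℝ), MeasurableSet A → (∀ q ∈ A, u q ≤ M) →
      -((1 + B) * M * N.real (Prod.fst ⁻¹' A)) ≤
        ∫ q in Prod.fst ⁻¹' A, branchingField (u q.1) q ∂N := by
    intro A M hA hM
    have hA' : MeasurableSet (Prod.fst ⁻¹' A : Set (ℝ≥0 × ℝ)) := measurable_fst hA
    have h1 : ∫ q in Prod.fst ⁻¹' A, -((1 + B) * M) ∂N ≤
        ∫ q in Prod.fst ⁻¹' A, branchingField (u q.1) q ∂N := by
      refine setIntegral_mono_on (integrable_const _) hint.integrableOn hA' fun q hq => ?_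
      refine le_trans ?_ (neg_mul_le_branchingField (hB q.1).1 (hB q.1).2 q)
      have := hM q.1 hq
      gcongr
    rw [setIntegral_const, smul_eq_mul] at h1
    linarith
  have key : ∀ s ≤ t, ∃ l > 0, ∀ r, s ≤ r → r ≤ t → l ≤ u r := by
    refine backward_induction (N.map Prod.fst) (ε := 1 / (2 * (1 + B))) (by positivity) ?_ ?_
    · refine ⟨lam, hlam, fun r h1 h2 => ?_⟩
      rw [le_antisymm h2 h1, hu.terminal]
    · rintro r s hrs hst ⟨l, hl, hls⟩ hsmall
      rw [map_measureReal_apply measurable_fst measurableSet_Ioo] at hsmall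
      have hs0 : 0 < s := zero_le.trans_lt hrs
      have hp0 : 0 < eulerStep N Prod.fst branchingField {s} (u s) := by
        have h1 : {s} ⊆ Ioc 0 t := singleton_subset_iff.2 ⟨hs0, hst⟩
        rw [eulerStep, hN, setIntegral_restrict_preimage h1]
        exact p.eulerStep_branchingField_pos hp hs0 (hl.trans_le (hls s le_rfl hst))
      set P := eulerStep N Prod.fst branchingField {s} (u s)
      refine ⟨min l (P / 2), lt_min hl (half_pos hp0), fun q hrq hqt => ?_⟩
      rcases le_or_gt s q with hsq | hqs
      · exact (min_le_left _ _).trans (hls q hsq hqt)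
      refine (min_le_right _ _).trans ?_
      let v : Ico q s → ℝ := fun x => u x
      have hne : Nonempty (Ico q s) := ⟨⟨q, le_rfl, hqs⟩⟩
      have hbdd : BddAbove (range v) := ⟨B, by rintro _ ⟨x, rfl⟩; exact (hB x).2⟩
      set S := ⨆ x, v x
      have hS : ∀ x, q ≤ x → x < s → u x ≤ S := fun x h1 h2 => le_ciSup hbdd ⟨x, h1, h2⟩
      have hS0 : 0 ≤ S := (hB q).1.trans (hS q le_rfl hqs)
      have hmass : ∀ A ⊆ Ioo q s, (1 + B) * S * N.real (Prod.fst ⁻¹' A) ≤ S / 2 := fun A hA => by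
        have h1 : N.real (Prod.fst ⁻¹' A) ≤ 1 / (2 * (1 + B)) :=
          (measureReal_mono (preimage_mono (hA.trans (Ioo_subset_Ioo_left hrq)))).trans hsmall
        calc (1 + B) * S * N.real (Prod.fst ⁻¹' A) ≤ (1 + B) * S * (1 / (2 * (1 + B))) := by gcongr
          _ = S / 2 := by field_simp
      have h1 : P - S / 2 ≤ u q := by
        rw [hu.eq_eulerStep_add measurable_fst hqs hst hint.integrableOn]
        have h2 := hlow (Ioo q s) S measurableSet_Ioo fun x hx => hS x hx.1.le hx.2
        have h3 := hmass (Ioo q s) Subset.rfl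
        linarith
      have h2 : S ≤ u q + S / 2 := by
        refine ciSup_le fun x => ?_
        have hxs : (x : ℝ≥0) < s := x.2.2
        have hqx : q ≤ x := x.2.1
        have h3 := hlow (Ioc q x) S measurableSet_Ioc fun y hy => hS y hy.1.le (hy.2.trans_lt hxs)
        have h4 := hmass (Ioc q x) fun y hy => ⟨hy.1, hy.2.trans_lt hxs⟩
        have h5 : u q = u x + ∫ y in Prod.fst ⁻¹' Ioc q x, branchingField (u y.1) y ∂N := by
          rw [hu q hqt, hu x (hxs.le.trans hst), ← Ioc_union_Ioc_eq_Ioc hqx (hxs.le.trans hst),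
            preimage_union, setIntegral_union]
          · ring
          · exact Disjoint.preimage _ (disjoint_left.2 fun y hy hy' => not_le.2 hy'.1 hy.2)
          · exact measurable_fst measurableSet_Ioc
          · exact hint.integrableOn
          · exact hint.integrableOn
        change u x ≤ _
        linarith
      linarith
  obtain ⟨l, hl, h⟩ := key 0 zero_le
  exact ⟨l, hl, fun r hr => h r zero_le hr⟩

theorem eq_of_solvesBackward (hp : p.Admissible) {t : ℝ≥0} {lam : ℝ} (hlam : 0 < lam)
    {u₁ u₂ : ℝ≥0 → ℝ} (hm₁ : Measurable u₁) (hm₂ : Measurable u₂) {B₁ B₂ : ℝ}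
    (hB₁ : ∀ r, 0 ≤ u₁ r ∧ u₁ r ≤ B₁) (hB₂ : ∀ r, 0 ≤ u₂ r ∧ u₂ r ≤ B₂)
    (h₁ : SolvesBackward p.drivingMeasure Prod.fst branchingField t lam u₁)
    (h₂ : SolvesBackward p.drivingMeasure Prod.fst branchingField t lam u₂) :
    ∀ r ≤ t, u₁ r = u₂ r := by
  obtain ⟨l₁, hl₁, hlu₁⟩ := p.exists_pos_le_of_solvesBackward hp hlam hm₁ hB₁ h₁
  obtain ⟨l₂, hl₂, hlu₂⟩ := p.exists_pos_le_of_solvesBackward hp hlam hm₂ hB₂ h₂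
  have hfin := p.isFiniteMeasure_restrict_Ioc t
  have hi₁ : Integrable (fun q => branchingField (u₁ q.1) q)
      (p.drivingMeasure.restrict (Prod.fst ⁻¹' Ioc 0 t)) :=
    p.integrableOn_branchingField hm₁ hB₁ t
  have hi₂ : Integrable (fun q => branchingField (u₂ q.1) q)
      (p.drivingMeasure.restrict (Prod.fst ⁻¹' Ioc 0 t)) :=
    p.integrableOn_branchingField hm₂ hB₂ t
  rw [← solvesBackward_restrict_iff] at h₁ h₂
  set N := p.drivingMeasure.restrict (Prod.fst ⁻¹' Ioc 0 t) with hN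
  set l := min l₁ l₂
  have hl : 0 < l := lt_min hl₁ hl₂
  set B := max B₁ B₂
  have hB : 0 ≤ B := ((hB₁ 0).1.trans (hB₁ 0).2).trans (le_max_left _ _)
  set L := 1 / l + 2 * B + 1
  have hL : 0 ≤ L := by positivity
  have hfm : Measurable fun r => |u₁ r - u₂ r| := (hm₁.sub hm₂).abs
  have hfB : ∀ r, |u₁ r - u₂ r| ≤ B₁ + B₂ := fun r => by
    have := hB₁ r
    have := hB₂ r
    rw [abs_le]
    constructor <;> linarith
  have hfi : Integrable (fun q : ℝ≥0 × ℝ => L * |u₁ q.1 - u₂ q.1|) N :=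
    (Integrable.of_bound (hfm.comp measurable_fst).aestronglyMeasurable (B₁ + B₂)
      (Eventually.of_forall fun q => by
        rw [Real.norm_eq_abs, Function.comp_apply, abs_abs]; exact hfB q.1)).const_mul L
  obtain ⟨K, -, hK⟩ := exists_gronwall_const (N.map Prod.fst) t hL
  intro r hr
  have h := hK (fun r => |u₁ r - u₂ r|) 0 hfm le_rfl (fun r => abs_nonneg _) ⟨_, hfB⟩ ?_ r hr
  · rw [mul_zero] at h
    exact sub_eq_zero.1 (abs_eq_zero.1 (le_antisymm h (abs_nonneg _)))
  intro r hr
  rw [setIntegral_map measurableSet_Ioc hfm.aestronglyMeasurable measurable_fst.aemeasurable,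
    zero_add, ← integral_const_mul, h₁ r hr, h₂ r hr, add_sub_add_left_eq_sub,
    ← integral_sub hi₁.integrableOn hi₂.integrableOn, ← Real.norm_eq_abs]
  refine norm_integral_le_of_norm_le hfi.integrableOn
    ((ae_restrict_mem (measurable_fst measurableSet_Ioc)).mono fun q hq => ?_)
  have hq' : q.1 ≤ t := hq.2
  exact abs_branchingField_sub_le hl ((min_le_left _ _).trans (hlu₁ _ hq'))
    ((min_le_right _ _).trans (hlu₂ _ hq')) ((hB₁ _).2.trans (le_max_left _ _))
    ((hB₂ _).2.trans (le_max_right _ _)) q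

end BranchingParameters

/-! ### Existence -/

namespace BranchingParameters

variable (p : BranchingParameters)

/-- A solution of the approximate equation, constant after time `t`. -/
theorem exists_approxSolution (n k : ℕ) (t : ℝ≥0) (lam : ℝ) :
    ∃ u : ℝ≥0 → ℝ, Measurable u ∧ (∃ B, ∀ r, |u r| ≤ B) ∧
      SolvesBackward (p.drivingMeasure.restrict (Prod.fst ⁻¹' Ioc 0 t)) Prod.fst
        (approxField n k) t lam u ∧ ∀ r, u (min r t) = u r := by
  have hfin := p.isFiniteMeasure_restrict_Ioc t
  have hγ := (isJumpData_approx n k).isLipschitzField (by positivity)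
  obtain ⟨u, hum, ⟨B, hB⟩, hu⟩ := hγ.exists_solvesBackward
    (N := p.drivingMeasure.restrict (Prod.fst ⁻¹' Ioc 0 t)) measurable_fst t lam
  refine ⟨fun r => u (min r t), hum.comp (measurable_id.min measurable_const), ⟨B, fun r => hB _⟩,
    SolvesBackward.congr measurable_fst hu fun r hr => by rw [min_eq_left hr], fun r => ?_⟩
  simp only [min_assoc, min_self]

/-- The solution is the limit of the approximations, which decrease in the lower cutoff `n` and
increase in the upper cutoff `k`; the bound is uniform since the fields are at most `1 + x`. -/
theorem exists_solution (hp : p.WeaklyAdmissible) (t : ℝ≥0) :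
    ∃ V : ℝ → ℝ≥0 → ℝ, (∀ lam, 0 < lam → Measurable (V lam) ∧
      (∃ B, ∀ r, 0 ≤ V lam r ∧ V lam r ≤ B) ∧
      SolvesBackward p.drivingMeasure Prod.fst branchingField t lam (V lam)) ∧
      ∀ r ≤ t, IsBernstein fun lam => V lam r := by
  have hfin := p.isFiniteMeasure_restrict_Ioc t
  choose U hUm hUB hU hUmin using fun n k lam => p.exists_approxSolution n k t lam
  set N := p.drivingMeasure.restrict (Prod.fst ⁻¹' Ioc 0 t) with hN
  have hC : ∀ n k : ℕ, (0 : ℝ) ≤ 2 * 4 ^ n + k := fun n k => by positivity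
  have hjump : ∀ n, ∀ s ≤ t, 0 < s → ∫ q in Prod.fst ⁻¹' {s}, driftCoeff n q ∂N ≤ 1 :=
    fun n s hst hs => by
      have h1 : {s} ⊆ Ioc 0 t := singleton_subset_iff.2 ⟨hs, hst⟩
      rw [hN, setIntegral_restrict_preimage h1]
      exact p.setIntegral_driftCoeff_le hp n hs
  have hanti : ∀ n k lam, 0 < lam → ∀ r, 0 ≤ U (n + 1) k lam r ∧
      U (n + 1) k lam r ≤ U n k lam r := fun n k lam hlam r => by
    rw [← hUmin (n + 1), ← hUmin n]
    exact (isJumpData_approx (n + 1) k).solution_mono (hC _ _) (isJumpData_approx n k) (hC _ _)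
      measurable_fst (hjump _) (hjump _) (fun x hx => approxField_succ_le n k hx) hlam.le
      (hUm _ _ _) (hUB _ _ _) (hU _ _ _) (hUm _ _ _) (hUB _ _ _) (hU _ _ _) _ (min_le_right _ _)
  have hmono : ∀ n k lam, 0 < lam → ∀ r, 0 ≤ U n k lam r ∧ U n k lam r ≤ U n (k + 1) lam r :=
    fun n k lam hlam r => by
      rw [← hUmin n k, ← hUmin n (k + 1)]
      exact (isJumpData_approx n k).solution_mono (hC _ _) (isJumpData_approx n (k + 1)) (hC _ _)
        measurable_fst (hjump _) (hjump _) (fun x hx => approxField_le_succ n k hx) hlam.le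
        (hUm _ _ _) (hUB _ _ _) (hU _ _ _) (hUm _ _ _) (hUB _ _ _) (hU _ _ _) _ (min_le_right _ _)
  have hbound : ∀ lam, 0 < lam → ∃ B, ∀ n k r, U n k lam r ≤ B := by
    intro lam hlam
    obtain ⟨K, hK0, hK⟩ := exists_gronwall_const (N.map Prod.fst) t zero_le_one
    refine ⟨K * (lam + N.real univ), fun n k r => ?_⟩
    rw [← hUmin]
    have h0 : ∀ r, 0 ≤ U n k lam r := fun r => (hmono n k lam hlam r).1
    obtain ⟨B, hB⟩ := hUB n k lam
    refine hK (U n k lam) (lam + N.real univ) (hUm _ _ _)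
      (add_nonneg hlam.le measureReal_nonneg) h0 ⟨B, fun r => (le_abs_self _).trans (hB r)⟩ ?_ _
      (min_le_right _ _)
    intro r hr
    have hUi : Integrable (fun q : ℝ≥0 × ℝ => U n k lam q.1) N :=
      Integrable.of_bound ((hUm n k lam).comp measurable_fst).aestronglyMeasurable B
        (Eventually.of_forall fun q => hB q.1)
    rw [hU n k lam r hr, one_mul, add_assoc,
      setIntegral_map measurableSet_Ioc (hUm _ _ _).aestronglyMeasurable measurable_fst.aemeasurable]
    refine add_le_add le_rfl ?_
    calc ∫ q in Prod.fst ⁻¹' Ioc r t, approxField n k (U n k lam q.1) q ∂N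
        ≤ ∫ q in Prod.fst ⁻¹' Ioc r t, (1 + U n k lam q.1) ∂N := by
          refine integral_mono ?_ ((integrable_const 1).add hUi).integrableOn fun q =>
            approxField_le n k (h0 _) q
          exact (((isJumpData_approx n k).isLipschitzField (hC n k)).integrable_comp
            measurable_fst (hUm _ _ _) hB).integrableOn
      _ = N.real (Prod.fst ⁻¹' Ioc r t) + ∫ q in Prod.fst ⁻¹' Ioc r t, U n k lam q.1 ∂N := by
          rw [integral_add (integrable_const 1) hUi.integrableOn]
          simp
      _ ≤ _ := add_le_add (measureReal_mono (subset_univ _)) le_rfl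
  let W : ℕ → ℝ → ℝ≥0 → ℝ := fun k lam r => ⨅ n, U n k lam r
  let V : ℝ → ℝ≥0 → ℝ := fun lam r => ⨆ k, W k lam r
  have hWlim : ∀ k lam, 0 < lam → ∀ r, Tendsto (fun n => U n k lam r) atTop (𝓝 (W k lam r)) :=
    fun k lam hlam r => tendsto_atTop_ciInf (antitone_nat_of_succ_le fun n => (hanti n k lam hlam r).2)
      ⟨0, by rintro _ ⟨n, rfl⟩; exact (hmono n k lam hlam r).1⟩
  have hW0 : ∀ k lam, 0 < lam → ∀ r, 0 ≤ W k lam r := fun k lam hlam r =>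
    ge_of_tendsto' (hWlim k lam hlam r) fun n => (hmono n k lam hlam r).1
  have hVlim : ∀ lam, 0 < lam → ∀ r, Tendsto (fun k => W k lam r) atTop (𝓝 (V lam r)) := by
    intro lam hlam r
    obtain ⟨B, hB⟩ := hbound lam hlam
    refine tendsto_atTop_ciSup (monotone_nat_of_le_succ fun k => ?_) ⟨B, ?_⟩
    · exact le_of_tendsto_of_tendsto' (hWlim k lam hlam r) (hWlim (k + 1) lam hlam r) fun n =>
        (hmono n k lam hlam r).2
    · rintro _ ⟨k, rfl⟩
      exact le_of_tendsto' (hWlim k lam hlam r) fun n => hB n k r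
  refine ⟨V, fun lam hlam => ?_, fun r hr => ?_⟩
  · obtain ⟨B, hB⟩ := hbound lam hlam
    have hWB : ∀ k r, W k lam r ≤ B := fun k r =>
      le_of_tendsto' (hWlim k lam hlam r) fun n => hB n k r
    have hWm : ∀ k, Measurable (W k lam) := fun k =>
      measurable_of_tendsto_metrizable (fun n => hUm n k lam)
        (tendsto_pi_nhds.2 (hWlim k lam hlam))
    have hV0 : ∀ r, 0 ≤ V lam r := fun r =>
      ge_of_tendsto' (hVlim lam hlam r) fun k => hW0 k lam hlam r
    have hVB : ∀ r, V lam r ≤ B := fun r =>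
      le_of_tendsto' (hVlim lam hlam r) fun k => hWB k r
    have hD : ∀ x, 0 ≤ x → x ≤ B → 1 + x + 2 * x ^ 2 ≤ 1 + B + 2 * B ^ 2 := fun x h0 h1 => by
      have := pow_le_pow_left₀ h0 h1 2
      linarith
    have hWsol : ∀ k, SolvesBackward N Prod.fst (truncatedField k) t lam (W k lam) := fun k =>
      SolvesBackward.of_tendsto (hU · k lam)
        (fun n => ((isJumpData_approx n k).isLipschitzField (hC n k)).measurable_comp
          measurable_fst (hUm _ _ _))
        (fun n q => (abs_approxField_le n k (hmono n k lam hlam _).1 q).trans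
          (hD _ (hmono n k lam hlam _).1 (hB n k _)))
        (hWlim k lam hlam)
        fun q => tendsto_approxField k q (fun n => (hmono n k lam hlam _).1) (hWlim k lam hlam _)
    refine ⟨measurable_of_tendsto_metrizable hWm (tendsto_pi_nhds.2 (hVlim lam hlam)),
      ⟨B, fun r => ⟨hV0 r, hVB r⟩⟩, ?_⟩
    rw [← solvesBackward_restrict_iff]
    exact SolvesBackward.of_tendsto hWsol
      (fun k => (measurable_truncatedField k).comp
        (((hWm k).comp measurable_fst).prodMk measurable_id))
      (fun k q => (abs_truncatedField_le k (hW0 k lam hlam _) q).trans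
        (hD _ (hW0 k lam hlam _) (hWB k _)))
      (hVlim lam hlam) fun q => tendsto_truncatedField q (hVlim lam hlam _)
  · have hUb : ∀ n k, IsBernstein fun lam => U n k lam r := fun n k =>
      (isJumpData_approx n k).isBernstein_of_solvesBackward (hC n k) measurable_fst (hjump n)
        (hUm n k) (hUB n k) (hU n k) r hr
    exact IsBernstein.of_tendsto (fun k => IsBernstein.of_tendsto (hUb · k)
      fun lam hlam => hWlim k lam hlam r) fun lam hlam => hVlim lam hlam r

end BranchingParameters

/-! ### The cumulant semigroup and its transition semigroup -/

namespace BranchingParameters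

variable {p : BranchingParameters}

theorem isSolution_of_solvesBackward (hp : p.Admissible) {t : ℝ≥0} {lam : ℝ} (hlam : 0 < lam)
    {u : ℝ≥0 → ℝ} (hum : Measurable u) {B : ℝ} (hB : ∀ r, 0 ≤ u r ∧ u r ≤ B)
    (hu : SolvesBackward p.drivingMeasure Prod.fst branchingField t lam u) :
    p.IsSolution t lam u where
  measurable := hum.comp measurable_subtype_coe
  bounded := ⟨B, fun r _ => (hB r).2⟩
  pos := by
    obtain ⟨l, hl, h⟩ := p.exists_pos_le_of_solvesBackward hp hlam hum hB hu
    exact fun r hr => hl.trans_le (h r hr)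
  integrable := p.integrableOn_K₁ measurableSet_Ioc (p.integrableOn_branchingField hum hB t)
  equation r hr := by
    rw [hu r hr, p.setIntegral_branchingField hp.weaklyAdmissible.c_monotone hum hB]
    ring

/-- A solution on `[0, t]`, stopped at time `t` to be defined everywhere, solves the equation
driven by `drivingMeasure`. -/
theorem IsSolution.solvesBackward (hp : p.Admissible) {t : ℝ≥0} {lam : ℝ} {u : ℝ≥0 → ℝ}
    (hu : p.IsSolution t lam u) :
    Measurable (fun r => u (min r t)) ∧ (∃ B, ∀ r, 0 ≤ u (min r t) ∧ u (min r t) ≤ B) ∧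
      SolvesBackward p.drivingMeasure Prod.fst branchingField t lam fun r => u (min r t) := by
  have hm : Measurable fun r => u (min r t) :=
    hu.measurable.comp (g := (Iic t).domRestrict u) (f := fun r => ⟨min r t, min_le_right r t⟩)
      (Measurable.subtype_mk (measurable_id.min measurable_const))
  obtain ⟨B, hB⟩ := hu.bounded
  have hB' : ∀ r, 0 ≤ u (min r t) ∧ u (min r t) ≤ B := fun r =>
    ⟨(hu.pos _ (min_le_right _ _)).le, hB _ (min_le_right _ _)⟩
  refine ⟨hm, ⟨B, hB'⟩, fun r hr => ?_⟩
  rw [p.setIntegral_branchingField hp.weaklyAdmissible.c_monotone hm hB']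
  have e1 : p.b₁.integral (fun r => u (min r t)) r t = p.b₁.integral u r t :=
    p.b₁.integral_congr fun s hs => by rw [min_eq_left hs.2]
  have e2 : p.c.integral (fun r => u (min r t) ^ 2) r t = p.c.integral (fun r => u r ^ 2) r t :=
    p.c.integral_congr fun s hs => by rw [min_eq_left hs.2]
  have e3 : ∫ q in Ioc r t ×ˢ Ioi 0, K₁ (u (min q.1 t)) q.2 ∂p.m =
      ∫ q in Ioc r t ×ˢ Ioi 0, K₁ (u q.1) q.2 ∂p.m :=
    setIntegral_congr_fun (measurableSet_Ioc.prod measurableSet_Ioi) fun q hq => by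
      have : q.1 ≤ t := hq.1.2
      simp only [min_eq_left this]
  have e4 : u (min r t) = u r := by rw [min_eq_left hr]
  rw [e1, e2, e3]
  change u (min r t) = _
  rw [e4, hu.equation r hr]
  ring

end BranchingParameters

/-- A solution on `[0, t]` restricts to a solution on `[0, s]` with terminal value `u(s)`. -/
theorem SolvesBackward.restrict_time {Ω : Type*} [MeasurableSpace Ω] {N : Measure Ω}
    {τ : Ω → ℝ≥0} {γ : ℝ → Ω → ℝ} (hτ : Measurable τ) {t : ℝ≥0} {lam : ℝ} {u : ℝ≥0 → ℝ}
    (hu : SolvesBackward N τ γ t lam u)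
    (hint : IntegrableOn (fun ω => γ (u (τ ω)) ω) (τ ⁻¹' Ioc 0 t) N) {s : ℝ≥0} (hst : s ≤ t) :
    SolvesBackward N τ γ s (u s) u := fun r hr => by
  rw [hu r (hr.trans hst), hu s hst, ← Ioc_union_Ioc_eq_Ioc hr hst, preimage_union,
    setIntegral_union]
  · ring
  · exact Disjoint.preimage _ (disjoint_left.2 fun y hy hy' => not_le.2 hy'.1 hy.2)
  · exact hτ measurableSet_Ioc
  · exact hint.mono_set (preimage_mono (Ioc_subset_Ioc zero_le hst))
  · exact hint.mono_set (preimage_mono (Ioc_subset_Ioc_left zero_le))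

/-- A cumulant semigroup of Bernstein functions determines a transition semigroup on `[0, ∞]`: the
Chapman–Kolmogorov equations hold since both sides have the same Laplace transforms. -/
theorem exists_transitionSemigroup {v : ℝ≥0 → ℝ≥0 → ℝ → ℝ}
    (hB : ∀ r t, r ≤ t → IsBernstein (v r t)) (hpos : ∀ r t, r ≤ t → ∀ lam, 0 < lam → 0 < v r t lam)
    (hrefl : ∀ t lam, 0 < lam → v t t lam = lam)
    (hsemi : ∀ r s t, r ≤ s → s ≤ t → ∀ lam, 0 < lam → v r t lam = v r s (v s t lam)) :
    ∃ Q : ℝ≥0 → ℝ≥0 → Kernel ℝ≥0∞ ℝ≥0∞, IsTransitionSemigroup Q ∧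
      ∀ r t, r ≤ t → ∀ (x : ℝ≥0∞) (lam : ℝ), 0 < lam →
        ∫ y, expNeg lam y ∂(Q r t x) = expNeg (v r t lam) x := by
  have hex : ∀ r t, ∃ κ : Kernel ℝ≥0∞ ℝ≥0∞, r ≤ t → IsMarkovKernel κ ∧
      ∀ x lam, 0 < lam → ∫ y, expNeg lam y ∂(κ x) = expNeg (v r t lam) x := fun r t => by
    by_cases h : r ≤ t
    · obtain ⟨κ, hκ⟩ := (hB r t h).exists_kernel
      exact ⟨κ, fun _ => hκ⟩
    · exact ⟨0, fun h' => absurd h' h⟩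
  choose Q hQ using hex
  refine ⟨Q, ⟨fun r t h => (hQ r t h).1, fun t => ?_, fun r s t hrs hst => ?_⟩,
    fun r t h => (hQ r t h).2⟩
  · have := (hQ t t le_rfl).1
    refine Kernel.ext fun x => eq_of_integral_expNeg_eq fun lam hlam => ?_
    rw [(hQ t t le_rfl).2 x lam hlam, hrefl t lam hlam, Kernel.id_apply, integral_dirac]
  · have h1 := (hQ r s hrs).1
    have h2 := (hQ s t hst).1
    have h3 := (hQ r t (hrs.trans hst)).1
    refine Kernel.ext fun x => eq_of_integral_expNeg_eq fun lam hlam => ?_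
    rw [(hQ r t (hrs.trans hst)).2 x lam hlam, Kernel.integral_comp (integrable_expNeg hlam _),
      hsemi r s t hrs hst lam hlam, ← (hQ r s hrs).2 x _ (hpos s t hst lam hlam)]
    simp only [(hQ s t hst).2 _ lam hlam]

theorem theorem1p1 (p : BranchingParameters) (hp : p.Admissible) :
    ∃ v : ℝ≥0 → ℝ≥0 → ℝ → ℝ,
      -- `r ↦ v r t lam` is the unique bounded strictly positive solution on `[0, t]`
      (∀ (t : ℝ≥0) (lam : ℝ), 0 < lam →
        p.IsSolution t lam (fun r => v r t lam) ∧
        ∀ u : ℝ≥0 → ℝ, p.IsSolution t lam u → ∀ r ≤ t, u r = v r t lam) ∧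
      -- `v` is a cumulant semigroup of continuous maps
      IsCumulantSemigroup v ∧
      (∀ r t, r ≤ t → ContinuousOn (v r t) (Ioi 0)) ∧
      -- the Laplace transform formula defines a transition semigroup on `[0, ∞]`
      ∃ Q : ℝ≥0 → ℝ≥0 → Kernel ℝ≥0∞ ℝ≥0∞,
        IsTransitionSemigroup Q ∧
        (∀ r t, r ≤ t → ∀ (x : ℝ≥0∞) (lam : ℝ), 0 < lam →
          ∫ y, expNeg lam y ∂(Q r t x) = expNeg (v r t lam) x) ∧
        ∀ r t, r ≤ t → ∀ (x : ℝ≥0∞) (μ : Measure ℝ≥0∞), IsProbabilityMeasure μ →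
          (∀ lam : ℝ, 0 < lam → ∫ y, expNeg lam y ∂μ = expNeg (v r t lam) x) →
          μ = Q r t x := by
  choose V hV hVB using fun t => p.exists_solution hp.weaklyAdmissible t
  have hsol : ∀ t lam, 0 < lam → p.IsSolution t lam (V t lam) := fun t lam hlam => by
    obtain ⟨hm, ⟨B, hB⟩, hs⟩ := hV t lam hlam
    exact BranchingParameters.isSolution_of_solvesBackward hp hlam hm hB hs
  have huniq : ∀ t lam, 0 < lam → ∀ u, p.IsSolution t lam u → ∀ r ≤ t, u r = V t lam r := by
    intro t lam hlam u hu r hr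
    obtain ⟨hm, ⟨B, hB⟩, hs⟩ := hV t lam hlam
    obtain ⟨hm', ⟨B', hB'⟩, hs'⟩ := hu.solvesBackward hp
    have := p.eq_of_solvesBackward hp hlam hm' hm hB' hB hs' hs r hr
    rwa [min_eq_left hr] at this
  have hpos : ∀ r t, r ≤ t → ∀ lam, 0 < lam → 0 < V t lam r := fun r t hrt lam hlam =>
    (hsol t lam hlam).pos r hrt
  have hsemi : ∀ r s t, r ≤ s → s ≤ t → ∀ lam, 0 < lam → V t lam r = V s (V t lam s) r := by
    intro r s t hrs hst lam hlam
    obtain ⟨hm, ⟨B, hB⟩, hs⟩ := hV t lam hlam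
    have hs' := hs.restrict_time measurable_fst (p.integrableOn_branchingField hm hB t) hst
    exact huniq s _ (hpos s t hst lam hlam) _
      (BranchingParameters.isSolution_of_solvesBackward hp (hpos s t hst lam hlam) hm hB hs') r hrs
  have hrefl : ∀ t lam, 0 < lam → V t lam t = lam := fun t lam hlam =>
    (hV t lam hlam).2.2.terminal
  obtain ⟨Q, hQ, hQL⟩ := exists_transitionSemigroup (v := fun r t lam => V t lam r)
    (fun r t hrt => hVB t r hrt) hpos hrefl hsemi
  refine ⟨fun r t lam => V t lam r, fun t lam hlam => ⟨hsol t lam hlam, huniq t lam hlam⟩,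
    ⟨hpos, hsemi, fun r t hrt => (hVB t r hrt).levyKhintchine (hpos r t hrt 1 one_pos)⟩,
    fun r t hrt => (hVB t r hrt).continuousOn, Q, hQ, hQL, fun r t hrt x μ hμ hμL => ?_⟩
  have := hQ.markov r t hrt
  exact eq_of_integral_expNeg_eq fun lam hlam => by rw [hμL lam hlam, hQL r t hrt x lam hlam]
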